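/- Let $d\ge 1$ and $n\ge 0$ be integers and $q\in\mathbb C\setminus\{0\}$. Let $B_n$ be the classical braid group on $n$ strands with standard generators $\sigma_1,\dots,\sigma_{n-1}$. The modular framed braid group $\mathcal F_{d,n}\cong(\mathbb Z/d\mathbb Z)^n\rtimes B_n$ is generated by $\sigma_1,\dots,\sigma_{n-1}$ and $t_1,\dots,t_n$, subject to the braid relations, $t_it_j=t_jt_i$, $t_j\sigma_i=\sigma_i t_{s_i(j)}$ with $s_i=(i,i+1)$, and $t_j^d=1$. The Yokonuma–Hecke algebra $\mathrm Y_{d,n}(q)$ is the quotient of $\mathbb C\mathcal F_{d,n}$ by the relations $$\sigma_i^2=1+(q-q^{-1})\,e_i\sigma_i,\qquad e_i=\frac1d\sum_{s=0}^{d-1}t_i^s t_{i+1}^{d-s}\qquad(1\le i\le n-1),$$ and $g_i$ denotes the image of $\sigma_i$. Let $D$ be a non-empty subset of $\mathbb Z/d\mathbb Z$, put $E_D=1/|D|$, and let $$\mathrm x_k=\frac1{|D|}\sum_{m\in D}\exp(2\pi i mk/d)\qquad(1\le k\le d-1)$$ be the solution $X_D$, parametrized by $D$, of the E-system $\sum_{s=0}^{d-1}x_{k+s}x_{d-s}=x_k\sum_{s=0}^{d-1}x_sx_{d-s}$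 (indices modulo $d$, $x_0=1$). The specialized trace $\mathrm{tr}_{d,D}:\bigcup_{n\ge0}\mathrm Y_{d,n}(q)\to\mathbb C[z]$ is the unique linear map (its existence and uniqueness are included in the statement) such that, for all $n$ and all $a,b\in \mathrm Y_{d,n}(q)$, $$\mathrm{tr}_{d,D}(ab)=\mathrm{tr}_{d,D}(ba),\quad \mathrm{tr}_{d,D}(1)=1,\quad \mathrm{tr}_{d,D}(ag_n)=z\,\mathrm{tr}_{d,D}(a)\ (n\ge1),\quad \mathrm{tr}_{d,D}(at_{n+1}^k)=\mathrm x_k\,\mathrm{tr}_{d,D}(a)\ (1\le k\le d-1).$$ Put $\lambda_D=\dfrac{z-(q-q^{-1})E_D}{z}$. For $\alpha\in B_n$ with exponent sum $\epsilon(\alpha)$ and closure $\widehat\alpha$, put $$\Theta_{d,D}(q,z)(\widehat\alpha)=\Big(\frac1{z\sqrt{\lambda_D}}\Big)^{n-1}\big(\sqrt{\lambda_D}\big)^{\epsilon(\alpha)}\,\mathrm{tr}_{d,D}(\alpha)\in\mathbb C[z^{\pm1},\sqrt{\lambda_D}^{\,\pm1}],$$ where $\mathrm{tr}_{d,D}$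 is applied to the image of $\alpha$ under $\sigma_i\mapsto g_i$. Put $\Theta_d=\Theta_{d,\mathbb Z/d\mathbb Z}$. The Homflypt polynomial is $P(q,z)=\Theta_1(q,z)=\Theta_{1,\{0\}}(q,z)$. The expression $P(q,z/E_D)$ is obtained from $P(q,z)$ by substituting $z/E_D$ for $z$ and $\sqrt{\lambda_D}$ for $\sqrt{\lambda_{\{0\}}}$; this makes sense because $\lambda_{\{0\}}$ at $z/E_D$ equals $\lambda_D$ at $z$. **Theorem.** For every non-empty $D\subseteq\mathbb Z/d\mathbb Z$ and every braid $\alpha\in B_n$ whose closure $\widehat\alpha$ is a knot, $$\Theta_{d,D}(q,z)(\widehat\alpha)=\Theta_1(q,z/E_D)(\widehat\alpha)=P(q,z/E_D)(\widehat\alpha).$$ In particular, for $D=\mathbb Z/d\mathbb Z$ (so $E_D=1/d$), $\Theta_d(q,z)(\widehat\alpha)=P(q,z/E_D)(\widehat\alpha)$. The identity also holds for the values of both sides in any commutative $\mathbb C$-algebra at an invertible $z$ and an invertible square root of $\lambda_D$. -/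

import Mathlib

namespace YokonumaHecke

open scoped Polynomial

/-! ### Braid groups and modular framed braid groups -/

/-- The group given by generators `G` and relations `a = b` for `R a b`. -/
abbrev GroupOfRelations {G : Type} (R : FreeGroup G → FreeGroup G → Prop) : Type :=
  PresentedGroup {r : FreeGroup G | ∃ a b, R a b ∧ r = a * b⁻¹}

/-- A map on generators that respects the relations extends to a group homomorphism. -/
def GroupOfRelations.lift {G H : Type} [Group H] {R : FreeGroup G → FreeGroup G → Prop}
    (f : G → H) (h : ∀ a b, R a b → FreeGroup.lift f a = FreeGroup.lift f b) :
    GroupOfRelations R →* H :=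
  PresentedGroup.toGroup (f := f) (by
    rintro r ⟨a, b, hab, rfl⟩
    rw [map_mul, map_inv, h a b hab, mul_inv_cancel])

theorem GroupOfRelations.lift_of {G H : Type} [Group H] {R : FreeGroup G → FreeGroup G → Prop}
    (f : G → H) (h : ∀ a b, R a b → FreeGroup.lift f a = FreeGroup.lift f b) (x : G) :
    GroupOfRelations.lift f h (PresentedGroup.of x) = f x := by
  rw [GroupOfRelations.lift, PresentedGroup.toGroup.of]

/-- Artin's braid relations. The generators `σ_1, …, σ_{n-1}` are indexed by `Fin (n - 1)`,
so that the index `i` stands for `σ_{i+1}`. -/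
inductive BraidRel (n : ℕ) : FreeGroup (Fin (n - 1)) → FreeGroup (Fin (n - 1)) → Prop
  | braid (i j : Fin (n - 1)) (h : i.val + 1 = j.val ∨ j.val + 1 = i.val) :
      BraidRel n (.of i * .of j * .of i) (.of j * .of i * .of j)
  | comm (i j : Fin (n - 1)) (h : i.val + 1 < j.val ∨ j.val + 1 < i.val) :
      BraidRel n (.of i * .of j) (.of j * .of i)

/-- The classical braid group `B_n` on `n` strands. -/
abbrev BraidGroup (n : ℕ) : Type := GroupOfRelations (BraidRel n)

/-- The left strand position affected by the `i`-th braiding generator. -/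
def leftPos {n : ℕ} (i : Fin (n - 1)) : Fin n := ⟨i.val, by omega⟩

/-- The right strand position affected by the `i`-th braiding generator. -/
def rightPos {n : ℕ} (i : Fin (n - 1)) : Fin n := ⟨i.val + 1, by omega⟩

/-- The defining relations of the modular framed braid group: `Sum.inl i` is a braiding
generator `σ`, and `Sum.inr j` is a framing generator `t`. -/
inductive FramedRel (d n : ℕ) :
    FreeGroup (Fin (n - 1) ⊕ Fin n) → FreeGroup (Fin (n - 1) ⊕ Fin n) → Prop
  | braid (i j : Fin (n - 1)) (h : i.val + 1 = j.val ∨ j.val + 1 = i.val) :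
      FramedRel d n (.of (.inl i) * .of (.inl j) * .of (.inl i))
        (.of (.inl j) * .of (.inl i) * .of (.inl j))
  | comm (i j : Fin (n - 1)) (h : i.val + 1 < j.val ∨ j.val + 1 < i.val) :
      FramedRel d n (.of (.inl i) * .of (.inl j)) (.of (.inl j) * .of (.inl i))
  | framing_comm (i j : Fin n) :
      FramedRel d n (.of (.inr i) * .of (.inr j)) (.of (.inr j) * .of (.inr i))
  | framing_braid (i : Fin (n - 1)) (j : Fin n) :
      FramedRel d n (.of (.inr j) * .of (.inl i))
        (.of (.inl i) * .of (.inr (Equiv.swap (leftPos i) (rightPos i) j)))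
  | modular (j : Fin n) : FramedRel d n (.of (.inr j) ^ d) 1

/-- The modular framed braid group `F_{d,n} ≅ (ℤ/dℤ)^n ⋊ B_n`. -/
abbrev FramedBraidGroup (d n : ℕ) : Type := GroupOfRelations (FramedRel d n)

/-- The braiding generators of the modular framed braid group. -/
def sigma (d n : ℕ) (i : Fin (n - 1)) : FramedBraidGroup d n := PresentedGroup.of (.inl i)

/-- The framing generators of the modular framed braid group. -/
def framing (d n : ℕ) (j : Fin n) : FramedBraidGroup d n := PresentedGroup.of (.inr j)

theorem framedRel_eq {d n : ℕ} {a b : FreeGroup (Fin (n - 1) ⊕ Fin n)} (h : FramedRel d n a b) :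
    (PresentedGroup.mk _ a : FramedBraidGroup d n) = PresentedGroup.mk _ b := by
  rw [← mul_inv_eq_one, ← map_inv, ← map_mul]
  exact PresentedGroup.one_of_mem ⟨a, b, h, rfl⟩

/-- The homomorphism from `B_n` to the modular framed braid group (all framings zero). -/
def braidToFramed (d n : ℕ) : BraidGroup n →* FramedBraidGroup d n :=
  GroupOfRelations.lift (fun i => sigma d n i) (by
    intro a b h
    cases h with
    | braid i j h => simpa [sigma, PresentedGroup.of] using framedRel_eq (FramedRel.braid (d := d) i j h)
    | comm i j h => simpa [sigma, PresentedGroup.of] using framedRel_eq (FramedRel.comm (d := d) i j h))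

/-- The inclusion of strands `1, …, n` among `1, …, n + 1`, on generators. -/
def inclGen (n : ℕ) : Fin (n - 1) ⊕ Fin n → Fin (n + 1 - 1) ⊕ Fin (n + 1) :=
  Sum.map (fun i => ⟨i.val, by omega⟩) (fun j => j.castSucc)

/-- The natural homomorphism `F_{d,n} → F_{d,n+1}`. -/
def framedIncl (d n : ℕ) : FramedBraidGroup d n →* FramedBraidGroup d (n + 1) :=
  GroupOfRelations.lift (fun x => PresentedGroup.of (inclGen n x)) (by
    intro a b h
    cases h with
    | braid i j h =>
      simpa [inclGen, PresentedGroup.of] using framedRel_eq (FramedRel.braid (d := d) (n := n + 1)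
        ⟨i.val, by omega⟩ ⟨j.val, by omega⟩ h)
    | comm i j h =>
      simpa [inclGen, PresentedGroup.of] using framedRel_eq (FramedRel.comm (d := d) (n := n + 1)
        ⟨i.val, by omega⟩ ⟨j.val, by omega⟩ h)
    | framing_comm i j =>
      simpa [inclGen, PresentedGroup.of] using framedRel_eq (FramedRel.framing_comm (d := d) (n := n + 1)
        i.castSucc j.castSucc)
    | framing_braid i j =>
      have key : (Equiv.swap (leftPos i) (rightPos i) j).castSucc =
          Equiv.swap (leftPos (n := n + 1) ⟨i.val, by omega⟩)
            (rightPos (n := n + 1) ⟨i.val, by omega⟩) j.castSucc := by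
        simp only [Equiv.swap_apply_def, leftPos, rightPos, Fin.ext_iff, Fin.val_castSucc]
        split_ifs <;> simp
      simpa [inclGen, key, PresentedGroup.of] using framedRel_eq (FramedRel.framing_braid (d := d) (n := n + 1)
        ⟨i.val, by omega⟩ j.castSucc)
    | modular j =>
      simpa [inclGen, PresentedGroup.of] using framedRel_eq (FramedRel.modular (d := d) (n := n + 1) j.castSucc))

/-- The exponent sum `ε(α)` of the braiding generators. -/
def exponentSum {n : ℕ} (α : BraidGroup n) : ℤ :=
  Multiplicative.toAdd
    (GroupOfRelations.lift (R := BraidRel n) (fun _ => Multiplicative.ofAdd (1 : ℤ)) (by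
      intro a b h
      cases h <;> simp) α)

/-! ### The closure of a braid -/

/-- The strand that starts at position `p` in an elementary braid, at time `s ∈ [0, 1]`:
its distance from the left edge of the braid, and its height above the plane of projection.
For the letter `(i, true)`, that is `σ_i`, (or `(i, false)`, that is `σ_i⁻¹`) the strands at
positions `i` and `i + 1` exchange their places along the two halves of a circle, the one moving
to the right passing over (or under) the other. For `none` all strands go straight on. -/
noncomputable def strand {n : ℕ} (c : Option (Fin (n - 1) × Bool)) (p : Fin n) (s : ℝ) : ℝ × ℝ :=
  match c with
  | none => (p.val, 0)
  | some (i, b) =>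
    let sgn : ℝ := if b then 1 else -1
    if p = leftPos i then
      (i.val + 1 / 2 - Real.cos (Real.pi * s) / 2, sgn * Real.sin (Real.pi * s) / 2)
    else if p = rightPos i then
      (i.val + 1 / 2 + Real.cos (Real.pi * s) / 2, -(sgn * Real.sin (Real.pi * s) / 2))
    else (p.val, 0)

/-- The closure in `ℝ³` of the geometric braid on `n` strands described by the braid word `w`.
The elementary braids of the letters of `w`, followed by a trivial one, occupy consecutive sectors
`2πk/L ≤ θ ≤ 2π(k+1)/L` around the vertical axis, so that the ends of the strands are joined to
their beginnings. -/
noncomputable def closedBraid {n : ℕ} (w : List (Fin (n - 1) × Bool)) :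
    Set (EuclideanSpace ℝ (Fin 3)) :=
  {P | ∃ k : ℕ, k < w.length + 1 ∧ ∃ s ∈ Set.Icc (0 : ℝ) 1, ∃ p : Fin n,
    let θ : ℝ := 2 * Real.pi * ((k + s) / (w.length + 1))
    let x := strand w[k]? p s
    P = !₂[(1 + x.1) * Real.cos θ, (1 + x.1) * Real.sin θ, x.2]}

/-- The closure of the braid `α` is a knot: it has exactly one connected component. -/
def ClosureIsKnot {n : ℕ} (α : BraidGroup n) : Prop :=
  ∃ w : List (Fin (n - 1) × Bool),
    PresentedGroup.mk _ (FreeGroup.mk w) = α ∧ IsConnected (closedBraid w)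

/-! ### The Yokonuma–Hecke algebra -/

/-- The element `e_i = (1/d) ∑_{s=0}^{d-1} t_i^s t_{i+1}^{d-s}` of the group algebra. -/
noncomputable def e (d n : ℕ) (i : Fin (n - 1)) : MonoidAlgebra ℂ (FramedBraidGroup d n) :=
  (d : ℂ)⁻¹ • ∑ s ∈ Finset.range d, MonoidAlgebra.of ℂ _
    (framing d n (leftPos i) ^ s * framing d n (rightPos i) ^ (d - s))

/-- The quadratic relations `σ_i² = 1 + (q - q⁻¹) e_i σ_i`. -/
inductive QuadraticRel (d n : ℕ) (q : ℂ) :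
    MonoidAlgebra ℂ (FramedBraidGroup d n) → MonoidAlgebra ℂ (FramedBraidGroup d n) → Prop
  | quadratic (i : Fin (n - 1)) :
      QuadraticRel d n q (MonoidAlgebra.of ℂ _ (sigma d n i) ^ 2)
        (1 + (q - q⁻¹) • (e d n i * MonoidAlgebra.of ℂ _ (sigma d n i)))

/-- The Yokonuma–Hecke algebra `Y_{d,n}(q)`; for `d = 1` this is the Iwahori–Hecke algebra
`H_n(q)`. -/
abbrev Y (d n : ℕ) (q : ℂ) : Type := RingQuot (QuadraticRel d n q)

/-- The projection from the group algebra of `F_{d,n}` onto `Y_{d,n}(q)`. -/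
noncomputable def proj (d n : ℕ) (q : ℂ) :
    MonoidAlgebra ℂ (FramedBraidGroup d n) →ₐ[ℂ] Y d n q :=
  RingQuot.mkAlgHom ℂ (QuadraticRel d n q)

/-- The generator `g` of `Y_{d,n}(q)` corresponding to a braiding generator. -/
noncomputable def g (d n : ℕ) (q : ℂ) (i : Fin (n - 1)) : Y d n q :=
  proj d n q (MonoidAlgebra.of ℂ _ (sigma d n i))

/-- The generator `t` of `Y_{d,n}(q)` corresponding to a framing generator. -/
noncomputable def t (d n : ℕ) (q : ℂ) (j : Fin n) : Y d n q :=
  proj d n q (MonoidAlgebra.of ℂ _ (framing d n j))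

/-- The image `δ(α)` in `Y_{d,n}(q)` of a classical braid `α`. -/
noncomputable def delta (d : ℕ) {n : ℕ} (q : ℂ) (α : BraidGroup n) : Y d n q :=
  proj d n q (MonoidAlgebra.of ℂ _ (braidToFramed d n α))

/-- The natural homomorphism `ℂF_{d,n} → ℂF_{d,n+1}`. -/
noncomputable def algebraIncl (d n : ℕ) :
    MonoidAlgebra ℂ (FramedBraidGroup d n) →ₐ[ℂ] MonoidAlgebra ℂ (FramedBraidGroup d (n + 1)) :=
  MonoidAlgebra.lift ℂ _ _ ((MonoidAlgebra.of ℂ _).comp (framedIncl d n))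

theorem algebraIncl_of (d n : ℕ) (x : FramedBraidGroup d n) :
    algebraIncl d n (MonoidAlgebra.of ℂ _ x) = MonoidAlgebra.of ℂ _ (framedIncl d n x) := by
  simp only [algebraIncl, MonoidAlgebra.lift_of, MonoidHom.comp_apply]

theorem framedIncl_sigma (d n : ℕ) (i : Fin (n - 1)) :
    framedIncl d n (sigma d n i) = sigma d (n + 1) ⟨i.val, by omega⟩ :=
  GroupOfRelations.lift_of _ _ _

theorem framedIncl_framing (d n : ℕ) (j : Fin n) :
    framedIncl d n (framing d n j) = framing d (n + 1) j.castSucc :=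
  GroupOfRelations.lift_of _ _ _

theorem algebraIncl_e (d n : ℕ) (i : Fin (n - 1)) :
    algebraIncl d n (e d n i) = e d (n + 1) ⟨i.val, by omega⟩ := by
  simp only [e, map_smul, map_sum, algebraIncl_of, map_mul, map_pow, framedIncl_framing]
  rfl

/-- The natural homomorphism `Y_{d,n}(q) → Y_{d,n+1}(q)`. -/
noncomputable def incl (d n : ℕ) (q : ℂ) : Y d n q →ₐ[ℂ] Y d (n + 1) q :=
  RingQuot.liftAlgHom ℂ ⟨(proj d (n + 1) q).comp (algebraIncl d n), by
    rintro _ _ ⟨i⟩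
    have h := RingQuot.mkAlgHom_rel ℂ
      (QuadraticRel.quadratic (d := d) (n := n + 1) (q := q) ⟨i.val, by omega⟩)
    simp only [AlgHom.comp_apply, map_add, map_mul, map_pow, map_smul, map_one, algebraIncl_of,
      framedIncl_sigma, algebraIncl_e] at h ⊢
    exact h⟩

/-! ### The E-system and the specialized trace -/

/-- The E-system for `x_0 = 1, x_1, …, x_{d-1}`, with indices modulo `d`. -/
def IsESystemSolution {d : ℕ} [NeZero d] (x : ZMod d → ℂ) : Prop :=
  x 0 = 1 ∧ ∀ k : ZMod d, k ≠ 0 →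
    ∑ s : ZMod d, x (k + s) * x (-s) = x k * ∑ s : ZMod d, x s * x (-s)

/-- The solution `X_D` of the E-system parametrized by the non-empty subset `D` of `ℤ/dℤ`:
`x_k = (1/|D|) ∑_{m ∈ D} exp(2πimk/d)`. -/
noncomputable def solX {d : ℕ} [NeZero d] (D : Finset (ZMod d)) (k : ZMod d) : ℂ :=
  (D.card : ℂ)⁻¹ * ∑ m ∈ D, ZMod.stdAddChar (m * k)

/-- The number `E_D = 1/|D|`. -/
noncomputable def E {d : ℕ} (D : Finset (ZMod d)) : ℂ := (D.card : ℂ)⁻¹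

theorem solX_convolution {d : ℕ} [NeZero d] (D : Finset (ZMod d)) (k : ZMod d) :
    ∑ s : ZMod d, solX D (k + s) * solX D (-s) = d * E D * solX D k := by
  have h (a b : ZMod d) : ∑ s : ZMod d, (ZMod.stdAddChar (a * (k + s)) : ℂ)
      * ZMod.stdAddChar (b * -s) = if a = b then (d : ℂ) * ZMod.stdAddChar (a * k) else 0 := by
    have := AddChar.sum_mulShift (a - b) (ZMod.isPrimitive_stdAddChar d)
    simp only [sub_eq_zero, ZMod.card] at this
    calc _ = ∑ s : ZMod d, (ZMod.stdAddChar (a * k) : ℂ) * ZMod.stdAddChar (s * (a - b)) := by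
          refine Finset.sum_congr rfl fun s _ => ?_
          rw [← AddChar.map_add_eq_mul, ← AddChar.map_add_eq_mul]
          congr 1
          ring
      _ = _ := by
          rw [← Finset.mul_sum, this]
          split_ifs <;> simp [mul_comm]
  calc _ = ∑ s : ZMod d, ∑ a ∈ D, ∑ b ∈ D, E D * E D *
          ((ZMod.stdAddChar (a * (k + s)) : ℂ) * ZMod.stdAddChar (b * -s)) := by
        refine Finset.sum_congr rfl fun s _ => ?_
        simp only [solX, E, ← Finset.mul_sum, ← Finset.sum_mul]
        ring
    _ = ∑ a ∈ D, ∑ b ∈ D, E D * E D *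
          (if a = b then (d : ℂ) * ZMod.stdAddChar (a * k) else 0) := by
        rw [Finset.sum_comm]
        refine Finset.sum_congr rfl fun a _ => ?_
        rw [Finset.sum_comm]
        refine Finset.sum_congr rfl fun b _ => ?_
        rw [← Finset.mul_sum, h]
    _ = _ := by
        simp only [solX, E, ← Finset.mul_sum, Finset.sum_ite_eq]
        rw [Finset.sum_ite_mem, Finset.inter_self, ← Finset.mul_sum]
        ring

theorem solX_zero {d : ℕ} [NeZero d] {D : Finset (ZMod d)} (hD : D.Nonempty) :
    solX D 0 = 1 := by
  have : (D.card : ℂ) ≠ 0 := by exact_mod_cast hD.card_pos.ne'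
  simp [solX, this]

theorem E_eq_sum {d : ℕ} [NeZero d] {D : Finset (ZMod d)} (hD : D.Nonempty) :
    E D = (d : ℂ)⁻¹ * ∑ s : ZMod d, solX D s * solX D (-s) := by
  have hd : (d : ℂ) ≠ 0 := by exact_mod_cast NeZero.ne d
  have h := solX_convolution D 0
  simp only [zero_add, solX_zero hD] at h
  rw [h]
  field_simp

theorem isESystemSolution_solX {d : ℕ} [NeZero d] {D : Finset (ZMod d)} (hD : D.Nonempty) :
    IsESystemSolution (solX D) := by
  refine ⟨solX_zero hD, fun k _ => ?_⟩
  have h := solX_convolution D 0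
  simp only [zero_add, solX_zero hD] at h
  rw [solX_convolution, h]
  ring

/-- The defining rules of the specialized trace `tr_{d,D}`, a linear map on `⋃_n Y_{d,n}(q)` with
values in `ℂ[z]`; such a map is a family of linear maps on the `Y_{d,n}(q)` that is compatible with
the inclusions. -/
structure IsSpecializedTrace (d : ℕ) [NeZero d] (D : Finset (ZMod d)) (q : ℂ)
    (tr : (n : ℕ) → Y d n q →ₗ[ℂ] ℂ[X]) : Prop where
  compat : ∀ (n : ℕ) (a : Y d n q), tr (n + 1) (incl d n q a) = tr n a
  trace : ∀ (n : ℕ) (a b : Y d n q), tr n (a * b) = tr n (b * a)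
  one : ∀ n : ℕ, tr n 1 = 1
  markov : ∀ (n : ℕ) (a : Y d (n + 1) q),
    tr (n + 2) (incl d (n + 1) q a * g d (n + 2) q (Fin.last n)) = Polynomial.X * tr (n + 1) a
  framing : ∀ (n : ℕ) (a : Y d n q) (k : ℕ), 1 ≤ k → k ≤ d - 1 →
    tr (n + 1) (incl d n q a * t d (n + 1) q (Fin.last n) ^ k) = solX D (k : ZMod d) • tr n a

/-- The specialized trace `tr_{d,D}`: the family of linear maps determined by the rules above. -/
noncomputable def specializedTrace (d : ℕ) [NeZero d] (D : Finset (ZMod d)) (q : ℂ) :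
    (n : ℕ) → Y d n q →ₗ[ℂ] ℂ[X] :=
  Classical.epsilon (IsSpecializedTrace d D q)

/-! ### The link invariants -/

/-- Values, in a commutative `ℂ`-algebra `A`, of the variable `z` and of the square root of
`λ_D = (z - (q - q⁻¹) E_D) / z`, both invertible. Equivalently, a homomorphism to `A` from the ring
`ℂ[z^{±1}, √λ_D^{±1}]`; the variables themselves are the case where `A` is that ring. -/
structure Variables {d : ℕ} (D : Finset (ZMod d)) (q : ℂ) (A : Type*) [CommRing A]
    [Algebra ℂ A] where
  z : Aˣ
  sqrtLambda : Aˣ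
  sq_eq : (sqrtLambda : A) ^ 2 = ((z : A) - algebraMap ℂ A ((q - q⁻¹) * E D)) * ((z⁻¹ : Aˣ) : A)

/-- The invariant `Θ_{d,D}(q,z)` of the closure of `α ∈ B_n`:
`Λ_D^{n-1} (√λ_D)^{ε(α)} tr_{d,D}(α)` with `Λ_D = 1 / (z √λ_D)`. -/
noncomputable def Theta (d : ℕ) [NeZero d] (D : Finset (ZMod d)) (q : ℂ) {A : Type*} [CommRing A]
    [Algebra ℂ A] (v : Variables D q A) {n : ℕ} (α : BraidGroup n) : A :=
  (((v.z * v.sqrtLambda)⁻¹ ^ ((n : ℤ) - 1) : Aˣ) : A) * ((v.sqrtLambda ^ exponentSum α : Aˣ) : A)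
    * Polynomial.aeval (v.z : A) (specializedTrace d D q n (delta d q α))

/-- The Homflypt polynomial `P(q,z)`, defined as `Θ_{1,{0}}(q,z)`: since `Y_{1,n}(q) = H_n(q)`, the
trace `tr_{1,{0}}` is the Ocneanu trace `τ`. -/
noncomputable def Homflypt (q : ℂ) {A : Type*} [CommRing A] [Algebra ℂ A]
    (v : Variables ({0} : Finset (ZMod 1)) q A) {n : ℕ} (α : BraidGroup n) : A :=
  Theta 1 {0} q v α

/-- The change of variables `z ↦ z / E_D`, which takes `√λ_{0}` to `√λ_D`. -/
noncomputable def Variables.divE {d : ℕ} {D : Finset (ZMod d)} (hD : D.Nonempty) {q : ℂ}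
    {A : Type*} [CommRing A] [Algebra ℂ A] (v : Variables D q A) :
    Variables ({0} : Finset (ZMod 1)) q A where
  z := v.z / Units.map (algebraMap ℂ A).toMonoidHom
    (Units.mk0 (E D) (inv_ne_zero (by exact_mod_cast hD.card_pos.ne')))
  sqrtLambda := v.sqrtLambda
  sq_eq := by
    set u : Aˣ := Units.map (algebraMap ℂ A).toMonoidHom
      (Units.mk0 (E D) (inv_ne_zero (by exact_mod_cast hD.card_pos.ne'))) with hu
    have h : (u : A) = algebraMap ℂ A (E D) := rfl
    have h0 : E ({0} : Finset (ZMod 1)) = 1 := by simp [E]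
    rw [v.sq_eq, h0, mul_one, map_mul, ← h, inv_div, div_eq_mul_inv, div_eq_mul_inv]
    simp only [Units.val_mul]
    have h1 : (u : A) * ((u⁻¹ : Aˣ) : A) = 1 := u.mul_inv
    linear_combination (-((v.z : A) * ((v.z⁻¹ : Aˣ) : A))) * h1

end YokonumaHecke

/-!
Write `E = 1 / |D|`. The specialized trace on `Y_{d,n}(q)` is given by a sum over the colorings of
the strands by elements of `D`, in which a coloring contributes a product, over the colors, of
Ocneanu traces of Hecke algebras with parameter `z / E`. A braid contributes only through the
colorings that it fixes; when the closure is a knot, these are the constant ones, and each of them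
contributes the Ocneanu trace of the braid, with parameter `z / E`.

*The Ocneanu trace.* Let `H_n` be the Hecke algebra on `n` strands. The free right `H_n`-module of
rank `n + 1`, which is `H_{n+1}` by the basis theorem, carries an action of `H_{n+1}` by explicit
formulas (`Hecke.rep`), and this action can be checked without the basis theorem. The coordinates of
the image of `1` give a conditional expectation `H_{n+1} → H_n` (`Hecke.condExp`); the composite of
these is the trace `Hecke.ocneanu`. The trace property `Hecke.ocneanu_mul_comm` comes down to the
symmetric formula `Hecke.condExp_gen_mul_up_mul_gen`.

*The colored representation.* `Y_{d,n}(q)` acts by monomial matrices indexed by the colorings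
`Fin n → D` with coefficients in a tensor product of Hecke algebras, one for each color
(`colRep`, `ColAlg`). The framing generator `t_j` acts at a coloring `χ` by `exp (2πi χ(j) / d)`,
and `g_i` permutes the positions `i` and `i + 1`. If both carry the same color, its coefficient is
a generator of the Hecke algebra of that color, whose index counts the strands of that color to the
left; otherwise it is `1`. Then `e_i` becomes the projection onto the colorings with equal colors
at `i` and `i + 1`, which gives the quadratic relation. The diagonal entry at `χ` lies in the
subalgebra on as many strands of each color as `χ` has (`colRep_mem`). Hence the matrix trace,
followed by the product of the Ocneanu traces and scaled by `E ^ n`, satisfies the defining rules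
(`isSpecializedTrace_stateSum`).

*Uniqueness.* Every element of `Y_{d,n+1}(q)` is a linear combination of elements `a t_{n+1}^k` and
`a g_n b` with `a, b` in `Y_{d,n}(q)` (`reducedY_eq_top`), whose traces the rules determine.

*Knots.* A coloring fixed by a braid word extends along the strands to a locally constant function
on the closure of the braid, so it is constant if the closure is connected
(`coloring_const_of_isConnected`). The `|D|` constant colorings give
`tr_{d,D}(α) = E ^ (n - 1) τ(α)(z / E)`, where `τ` is the Ocneanu trace (`stateSum_delta`). The same
formula with `D = {0}` computes `P`, and the power of `E` is the ratio of the normalizing factors.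
-/

namespace YokonumaHecke

open scoped Polynomial TensorProduct

/-! ### The Hecke algebra of type A -/

/-- The elements `f 0, …, f (n - 1)` of `A` satisfy the relations of the generators of the Hecke
algebra of type `A_n` with quadratic relation `x² = 1 + h x`. -/
structure IsHeckeFamily {R A : Type*} [CommRing R] [Ring A] [Algebra R A] (h : R) (n : ℕ)
    (f : ℕ → A) : Prop where
  quad : ∀ i, i < n → f i * f i = 1 + h • f i
  braid : ∀ i, i + 1 < n → f i * f (i + 1) * f i = f (i + 1) * f i * f (i + 1)
  comm : ∀ i j, i + 1 < j → j < n → f i * f j = f j * f i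

/-- The defining relations of the Hecke algebra of type `A_n`. -/
inductive HeckeRel {R : Type*} [CommRing R] (h : R) (n : ℕ) :
    FreeAlgebra R (Fin n) → FreeAlgebra R (Fin n) → Prop
  | quad (i : Fin n) : HeckeRel h n (FreeAlgebra.ι R i * FreeAlgebra.ι R i)
      (1 + h • FreeAlgebra.ι R i)
  | braid (i j : Fin n) (hij : i.val + 1 = j.val) :
      HeckeRel h n (FreeAlgebra.ι R i * FreeAlgebra.ι R j * FreeAlgebra.ι R i)
        (FreeAlgebra.ι R j * FreeAlgebra.ι R i * FreeAlgebra.ι R j)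
  | comm (i j : Fin n) (hij : i.val + 1 < j.val) :
      HeckeRel h n (FreeAlgebra.ι R i * FreeAlgebra.ι R j) (FreeAlgebra.ι R j * FreeAlgebra.ι R i)

/-- The Hecke algebra of type `A_n` (that is, on `n + 1` strands) over a commutative ring, with
quadratic relation `x² = 1 + h x`. -/
def Hecke {R : Type*} [CommRing R] (h : R) (n : ℕ) : Type _ := RingQuot (HeckeRel h n)

namespace Hecke

variable {R : Type*} [CommRing R] {h : R}

noncomputable instance (n : ℕ) : Ring (Hecke h n) := inferInstanceAs (Ring (RingQuot _))

noncomputable instance (n : ℕ) : Algebra R (Hecke h n) :=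
  inferInstanceAs (Algebra R (RingQuot _))

/-- The projection of the free algebra onto the Hecke algebra. -/
noncomputable def mk (h : R) (n : ℕ) : FreeAlgebra R (Fin n) →ₐ[R] Hecke h n :=
  RingQuot.mkAlgHom R (HeckeRel h n)

theorem mk_rel {n : ℕ} {a b : FreeAlgebra R (Fin n)} (hab : HeckeRel h n a b) :
    mk h n a = mk h n b :=
  RingQuot.mkAlgHom_rel R hab

/-- The generators of the Hecke algebra, indexed by `i < n` and extended by zero. -/
noncomputable def gen (h : R) (n i : ℕ) : Hecke h n :=
  if hi : i < n then mk h n (FreeAlgebra.ι R ⟨i, hi⟩) else 0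

theorem isHeckeFamily_gen (h : R) (n : ℕ) : IsHeckeFamily h n (gen h n) where
  quad i hi := by
    simpa [gen, hi] using mk_rel (HeckeRel.quad (h := h) ⟨i, hi⟩)
  braid i hi := by
    have hi' : i < n := by omega
    simpa [gen, hi, hi'] using mk_rel
      (HeckeRel.braid (h := h) ⟨i, hi'⟩ ⟨i + 1, hi⟩ rfl)
  comm i j hij hj := by
    have hi : i < n := by omega
    simpa [gen, hi, hj] using mk_rel
      (HeckeRel.comm (h := h) ⟨i, hi⟩ ⟨j, hj⟩ hij)

theorem adjoin_gen (h : R) (n : ℕ) :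
    Algebra.adjoin R {x | ∃ i < n, x = gen h n i} = ⊤ := by
  rw [eq_top_iff]
  rintro x -
  obtain ⟨y, rfl⟩ := RingQuot.mkAlgHom_surjective R (HeckeRel h n) x
  induction y using FreeAlgebra.induction with
  | grade0 r => exact (AlgHom.commutes (mk h n) r).symm ▸ Subalgebra.algebraMap_mem _ r
  | grade1 i => exact Algebra.subset_adjoin ⟨i, i.2, by rw [gen, dif_pos i.2]; rfl⟩
  | mul a b ha hb => exact (map_mul (mk h n) a b) ▸ mul_mem ha hb
  | add a b ha hb => exact (map_add (mk h n) a b) ▸ add_mem ha hb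

/-- To prove a property of all elements of the Hecke algebra it suffices to check scalars and to
check that it is stable under sums and left multiplication by generators. -/
theorem induction {n : ℕ} {p : Hecke h n → Prop} (one : p 1)
    (smul : ∀ (r : R) x, p x → p (r • x)) (add : ∀ x y, p x → p y → p (x + y))
    (gen_mul : ∀ i < n, ∀ x, p x → p (gen h n i * x)) (x : Hecke h n) : p x := by
  let S : Submodule R (Hecke h n) :=
    { carrier := {x | p x}
      add_mem' := fun ha hb => add _ _ ha hb
      zero_mem' := by simpa using smul 0 1 one
      smul_mem' := fun r x hx => smul r x hx }
  let B : Subalgebra R (Hecke h n) :=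
    { carrier := {a | ∀ x ∈ S, a * x ∈ S}
      mul_mem' := fun {a b} ha hb x hx => by rw [mul_assoc]; exact ha _ (hb _ hx)
      add_mem' := fun {a b} ha hb x hx => by rw [add_mul]; exact S.add_mem (ha _ hx) (hb _ hx)
      algebraMap_mem' := fun r x hx => by
        rw [Algebra.algebraMap_eq_smul_one, smul_mul_assoc, one_mul]; exact S.smul_mem r hx }
  have hB : (⊤ : Subalgebra R (Hecke h n)) ≤ B := by
    rw [← adjoin_gen, Algebra.adjoin_le_iff]
    rintro _ ⟨i, hi, rfl⟩ x hx
    exact gen_mul i hi x hx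
  have := hB (Algebra.mem_top (x := x)) 1 one
  rwa [mul_one] at this

section lift
variable {A : Type*} [Ring A] [Algebra R A]

/-- The universal property of the Hecke algebra. -/
noncomputable def lift {n : ℕ} {f : ℕ → A} (hf : IsHeckeFamily h n f) : Hecke h n →ₐ[R] A :=
  RingQuot.liftAlgHom R ⟨FreeAlgebra.lift R fun i : Fin n => f i, by
    rintro _ _ (⟨i⟩ | ⟨i, j, hij⟩ | ⟨i, j, hij⟩)
    · simpa using hf.quad i i.2
    · have := hf.braid i (by omega)
      simpa [hij] using this
    · simpa using hf.comm i j hij j.2⟩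

theorem lift_gen {n : ℕ} {f : ℕ → A} (hf : IsHeckeFamily h n f) {i : ℕ} (hi : i < n) :
    lift hf (gen h n i) = f i := by
  rw [gen, dif_pos hi]
  exact (RingQuot.liftAlgHom_mkAlgHom_apply R _ _ _).trans (FreeAlgebra.lift_ι_apply _ _)

end lift

theorem isHeckeFamily_mono {A : Type*} [Ring A] [Algebra R A] {m n : ℕ} (hmn : m ≤ n) {f : ℕ → A}
    (hf : IsHeckeFamily h n f) : IsHeckeFamily h m f :=
  ⟨fun i hi => hf.quad i (by omega), fun i hi => hf.braid i (by omega),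
    fun i j hij hj => hf.comm i j hij (by omega)⟩

/-- The natural map from the Hecke algebra of type `A_m` to that of type `A_n`, for `m ≤ n`. -/
noncomputable def map (h : R) {m n : ℕ} (hmn : m ≤ n) : Hecke h m →ₐ[R] Hecke h n :=
  lift (isHeckeFamily_mono hmn (isHeckeFamily_gen h n))

theorem map_gen {m n : ℕ} (hmn : m ≤ n) {i : ℕ} (hi : i < m) :
    map h hmn (gen h m i) = gen h n i :=
  lift_gen _ hi

theorem algHom_ext {A : Type*} [Ring A] [Algebra R A] {n : ℕ} {f f' : Hecke h n →ₐ[R] A}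
    (H : ∀ i < n, f (gen h n i) = f' (gen h n i)) : f = f' :=
  AlgHom.ext_of_adjoin_eq_top (adjoin_gen h n) (by rintro _ ⟨i, hi, rfl⟩; exact H i hi)

theorem map_map {l m n : ℕ} (hlm : l ≤ m) (hmn : m ≤ n) (x : Hecke h l) :
    map h hmn (map h hlm x) = map h (hlm.trans hmn) x := by
  suffices (map h hmn).comp (map h hlm) = map h (hlm.trans hmn) from DFunLike.congr_fun this x
  refine algHom_ext fun i hi => ?_
  simp [map_gen _ hi, map_gen hmn (lt_of_lt_of_le hi hlm)]

theorem map_self {n : ℕ} (x : Hecke h n) : map h le_rfl x = x := by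
  suffices map h le_rfl = AlgHom.id R (Hecke h n) from DFunLike.congr_fun this x
  exact algHom_ext fun i hi => by simp [map_gen _ hi]

/-- The inclusion of the Hecke algebra of type `A_n` into that of type `A_{n+1}`. -/
noncomputable abbrev up {n : ℕ} : Hecke h n →ₐ[R] Hecke h (n + 1) := map h n.le_succ

theorem up_gen {n i : ℕ} (hi : i < n) : (up (gen h n i) : Hecke h (n + 1)) = gen h (n + 1) i :=
  map_gen _ hi

theorem commute_gen_map {m n k : ℕ} (hmn : m ≤ n) (hk : m < k) (hkn : k < n) (x : Hecke h m) :
    gen h n k * map h hmn x = map h hmn x * gen h n k := by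
  induction x using induction with
  | one => simp
  | smul r x hx => simp [hx]
  | add x y hx hy => simp [mul_add, add_mul, hx, hy]
  | gen_mul i hi x hx =>
    rw [map_mul, map_gen _ hi, ← mul_assoc,
      ← (isHeckeFamily_gen h n).comm i k (by omega) hkn, mul_assoc, hx, mul_assoc]

/-! ### The Hecke algebra acting on an induced module -/

/-- The action of the `i`-th generator on a family of coefficients. The family `m` stands for the
element `∑ b_j m_j` of the algebra on one more generator, where `b_j = g_j ⋯ g_n` for `j ≤ n` and
`b_{n+1} = 1`. -/
noncomputable def act (h : R) (n i : ℕ) : (ℕ → Hecke h n) →ₗ[R] (ℕ → Hecke h n) where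
  toFun m j := if n + 1 < j then 0 else if j < i then gen h n (i - 1) * m j
    else if j = i then m (i + 1) + h • m i else if j = i + 1 then m i else gen h n i * m j
  map_add' m m' := by
    funext j; simp only [Pi.add_apply]
    split_ifs <;> simp only [mul_add, smul_add, add_zero]
    abel
  map_smul' r m := by
    funext j; simp only [Pi.smul_apply, RingHom.id_apply]
    split_ifs <;> simp [smul_comm h r]

theorem act_apply (n i : ℕ) (m : ℕ → Hecke h n) (j : ℕ) : act h n i m j =
    if n + 1 < j then 0 else if j < i then gen h n (i - 1) * m j
    else if j = i then m (i + 1) + h • m i else if j = i + 1 then m i else gen h n i * m j := rfl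

/-- The families of coefficients supported on the indices `0, …, n + 1`. -/
def coeffs (h : R) (n : ℕ) : Submodule R (ℕ → Hecke h n) where
  carrier := {m | ∀ j, n + 1 < j → m j = 0}
  add_mem' ha hb j hj := by simp [ha j hj, hb j hj]
  zero_mem' j _ := rfl
  smul_mem' r m hm j hj := by simp [hm j hj]

/-- The action of the `i`-th generator on `coeffs h n`. -/
noncomputable def actC (h : R) (n i : ℕ) : Module.End R (coeffs h n) :=
  (act h n i).restrict fun m _ j hj => by simp [act_apply, hj]

theorem coe_actC (n i : ℕ) (m : coeffs h n) : (actC h n i m).1 = act h n i m.1 := rfl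

/-- The relations hold coefficient by coefficient, by the relations of the smaller algebra. -/
theorem isHeckeFamily_actC (h : R) (n : ℕ) : IsHeckeFamily h (n + 1) (actC h n) where
  quad i hi := by
    refine LinearMap.ext fun m => Subtype.ext (funext fun j => ?_)
    have q := (isHeckeFamily_gen h n).quad
    have hm := m.2 j
    simp only [Module.End.mul_apply, coe_actC, LinearMap.add_apply, Module.End.one_apply,
      LinearMap.smul_apply, Submodule.coe_add, Submodule.coe_smul, Pi.add_apply, Pi.smul_apply]
    rcases lt_or_ge (n + 1) j with hj | hj
    · simp [act_apply, hj, hm hj]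
    rcases lt_trichotomy j i with hji | rfl | hji
    · have h1 := q (i - 1) (by omega)
      simp [act_apply, hj.not_gt, hji, ← mul_assoc, h1, add_mul]
    · have h0 : ¬ n + 1 < j + 1 := by omega
      simp [act_apply, hj.not_gt, h0]
    · rcases eq_or_ne j (i + 1) with rfl | hne
      · have h0 : ¬ n + 1 < i := by omega
        simp [act_apply, hj.not_gt, h0]
      · have h1 := q i (by omega)
        simp [act_apply, hj.not_gt, hji.not_gt, hji.ne', hne, ← mul_assoc, h1, add_mul]
  braid i hi := by
    refine LinearMap.ext fun m => Subtype.ext (funext fun j => ?_)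
    have q := (isHeckeFamily_gen h n).quad
    have b := (isHeckeFamily_gen h n).braid
    have hm := m.2 j
    simp only [Module.End.mul_apply, coe_actC]
    rcases lt_or_ge (n + 1) j with hj | hj
    · simp [act_apply, hj]
    rcases lt_trichotomy j i with hji | rfl | hji
    · have h1 := b (i - 1) (by omega)
      have h2 : i - 1 + 1 = i := by omega
      have h3 : j < i + 1 := by omega
      rw [h2] at h1
      simp [act_apply, hj.not_gt, hji, h3, ← mul_assoc, h1]
    · have h0 : ¬ n + 1 < j + 1 := by omega
      have h1 : ¬ n + 1 < j + 1 + 1 := by omega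
      have h2 : ¬ j + 1 + 1 < j := by omega
      have h3 : j + 1 + 1 ≠ j := by omega
      have h4 (x : Hecke h n) : gen h n j * (gen h n j * x) = x + h • (gen h n j * x) := by
        rw [← mul_assoc, q j (by omega), add_mul, one_mul, smul_mul_assoc]
      simp only [act_apply, hj.not_gt, h0, h1, h2, h3, mul_add, if_false, if_true,
        lt_irrefl, lt_add_iff_pos_right, zero_lt_one, mul_smul_comm, smul_add,
        Nat.add_eq_left, one_ne_zero]
      simp only [add_tsub_cancel_right, show ¬ j + 1 < j by omega, if_false, h4, smul_add]
      abel
    · rcases eq_or_ne j (i + 1) with rfl | hne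
      · have h0 : ¬ n + 1 < i := by omega
        have h1 : ¬ n + 1 < i + 1 + 1 := by omega
        have h2 : ¬ i + 1 + 1 < i := by omega
        have h3 : i + 1 + 1 ≠ i := by omega
        simp [act_apply, hj.not_gt, h0, h1, h2, h3, mul_add]
      · rcases eq_or_ne j (i + 2) with rfl | hne2
        · have h0 : ¬ n + 1 < i := by omega
          have h1 : ¬ n + 1 < i + 1 := by omega
          simp [act_apply, hj.not_gt, h0, h1]
        · have h1 := b i (by omega)
          have h2 : ¬ j < i + 1 := by omega
          simp [act_apply, hj.not_gt, hji.not_gt, hji.ne', hne, h2, hne2, ← mul_assoc, h1]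
  comm i k hik hk := by
    refine LinearMap.ext fun m => Subtype.ext (funext fun j => ?_)
    have c := (isHeckeFamily_gen h n).comm
    simp only [Module.End.mul_apply, coe_actC]
    rcases lt_or_ge (n + 1) j with hj | hj
    · simp [act_apply, hj]
    rcases lt_trichotomy j i with hji | rfl | hji
    · have h1 := c (i - 1) (k - 1) (by omega) (by omega)
      have h3 : j < k := by omega
      simp [act_apply, hj.not_gt, hji, h3, ← mul_assoc, h1]
    · have h0 : ¬ n + 1 < j + 1 := by omega
      have h1 : j < k := by omega
      simp [act_apply, hj.not_gt, h0, h1, hik, mul_add]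
    · rcases eq_or_ne j (i + 1) with rfl | hne
      · have h0 : ¬ n + 1 < i := by omega
        have h1 : i < k := by omega
        simp [act_apply, hj.not_gt, h0, h1, hik]
      · rcases lt_trichotomy j k with hjk | rfl | hjk
        · have h1 := c i (k - 1) (by omega) (by omega)
          simp [act_apply, hj.not_gt, hji.not_gt, hji.ne', hne, hjk, ← mul_assoc, h1]
        · have h0 : ¬ n + 1 < j + 1 := by omega
          have h1 : ¬ j + 1 < i := by omega
          have h2 : j + 1 ≠ i := by omega
          simp [act_apply, hj.not_gt, hji.not_gt, hji.ne', hne, h0, h1, h2, mul_add]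
        · rcases eq_or_ne j (k + 1) with rfl | hne2
          · have h0 : ¬ n + 1 < k := by omega
            have h1 : ¬ k < i := by omega
            have h2 : k ≠ i := by omega
            have h3 : k ≠ i + 1 := by omega
            have h4 : ¬ k + 1 < i := by omega
            have h5 : k + 1 ≠ i := by omega
            simp [act_apply, hj.not_gt, h0, h1, h2, h3, h4, h5]
          · have h1 := c i k hik (by omega)
            have h2 : ¬ j < k := by omega
            have h3 : j ≠ k := by omega
            simp [act_apply, hj.not_gt, hji.not_gt, hji.ne', hne, h2, h3, hne2, ← mul_assoc, h1]

/-- The representation of the Hecke algebra on the coefficient families of `coeffs h n`. -/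
noncomputable def rep (h : R) (n : ℕ) : Hecke h (n + 1) →ₐ[R] Module.End R (coeffs h n) :=
  lift (isHeckeFamily_actC h n)

theorem coe_rep_gen_mul {n i : ℕ} (hi : i < n + 1) (a : Hecke h (n + 1)) (m : coeffs h n) :
    (rep h n (gen h (n + 1) i * a) m).1 = act h n i (rep h n a m).1 := by
  rw [map_mul, rep, lift_gen _ hi]; rfl

theorem coe_rep_smul {n : ℕ} (r : R) (a : Hecke h (n + 1)) (m : coeffs h n) (j : ℕ) :
    (rep h n (r • a) m).1 j = r • (rep h n a m).1 j := by
  rw [map_smul]; rfl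

theorem coe_rep_add {n : ℕ} (a b : Hecke h (n + 1)) (m : coeffs h n) (j : ℕ) :
    (rep h n (a + b) m).1 j = (rep h n a m).1 j + (rep h n b m).1 j := by
  rw [map_add]; rfl

/-- The coefficients of the element `y` of the subalgebra. -/
noncomputable def top {n : ℕ} (y : Hecke h n) : coeffs h n :=
  ⟨Pi.single (n + 1) y, fun j hj => by simp [(show j ≠ n + 1 by omega)]⟩

theorem coe_top {n : ℕ} (y : Hecke h n) : (top y).1 = Pi.single (n + 1) y := rfl

/-- The action commutes with right multiplication by the subalgebra. -/
theorem rep_top {n : ℕ} (a : Hecke h (n + 1)) (x y : Hecke h n) (j : ℕ) :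
    (rep h n a (top (x * y))).1 j = (rep h n a (top x)).1 j * y := by
  induction a using induction generalizing j with
  | one =>
    simp only [map_one, Module.End.one_apply, coe_top]
    rcases eq_or_ne j (n + 1) with rfl | hj <;> simp [*]
  | smul r a ha => rw [coe_rep_smul, coe_rep_smul, ha, smul_mul_assoc]
  | add a b ha hb => rw [coe_rep_add, coe_rep_add, ha, hb, add_mul]
  | gen_mul i hi a ha =>
    rw [coe_rep_gen_mul hi, coe_rep_gen_mul hi, act_apply, act_apply]
    split_ifs <;> simp [ha, mul_assoc, add_mul]

theorem rep_up_top {n : ℕ} (x y : Hecke h n) (j : ℕ) :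
    (rep h n (up x) (top y)).1 j = (top (x * y)).1 j := by
  induction x using induction generalizing j with
  | one => simp
  | smul r a ha => rw [map_smul, coe_rep_smul, ha, smul_mul_assoc]; simp [coe_top, Pi.single_smul]
  | add a b ha hb => rw [map_add, coe_rep_add, ha, hb, add_mul]; simp [coe_top, Pi.single_add]
  | gen_mul i hi a ha =>
    rw [map_mul, up_gen hi, coe_rep_gen_mul (by omega), act_apply]
    simp only [ha, coe_top, Pi.single_apply]
    split_ifs <;> first | omega | simp [mul_assoc]

/-- The product `g_j g_{j+1} ⋯ g_{n-1}`, where `j = n - k`. -/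
noncomputable def chainAux (h : R) (n : ℕ) : ℕ → Hecke h n
  | 0 => 1
  | k + 1 => gen h n (n - (k + 1)) * chainAux h n k

/-- The product `g_j g_{j+1} ⋯ g_{n-1}`. -/
noncomputable def chain (h : R) (n j : ℕ) : Hecke h n := chainAux h n (n - j)

theorem chain_self (n : ℕ) : chain h n n = 1 := by simp [chain, chainAux]

theorem chain_succ {n j : ℕ} (hj : j < n) : chain h n j = gen h n j * chain h n (j + 1) := by
  have h1 : n - j = n - (j + 1) + 1 := by omega
  rw [chain, chain, h1, chainAux]
  congr 2; omega

theorem gen_mul_chain_of_lt {n i j : ℕ} (hij : i + 1 < j) (hj : j ≤ n) :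
    gen h n i * chain h n j = chain h n j * gen h n i := by
  induction hj using Nat.decreasingInduction with
  | self => simp [chain_self]
  | of_succ k hk ih =>
    rw [chain_succ hk, ← mul_assoc, (isHeckeFamily_gen h n).comm i k hij hk, mul_assoc,
      ih (by omega), mul_assoc]

theorem gen_mul_chain_of_gt {n i j : ℕ} (hji : j < i) (hi : i < n) :
    gen h n i * chain h n j = chain h n j * gen h n (i - 1) := by
  have hj : j ≤ i - 1 := by omega
  induction hj using Nat.decreasingInduction with
  | self =>
    have h1 := (isHeckeFamily_gen h n).braid (i - 1) (by omega)
    have h2 : i - 1 + 1 = i := by omega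
    rw [h2] at h1
    rw [chain_succ (by omega), h2, chain_succ hi]
    simp only [mul_assoc] at h1 ⊢
    rw [← gen_mul_chain_of_lt (by omega) (by omega)]
    simp only [← mul_assoc] at h1 ⊢
    rw [h1]
  | of_succ k hk ih =>
    rw [chain_succ (by omega), ← mul_assoc, ← (isHeckeFamily_gen h n).comm k i (by omega) hi,
      mul_assoc, ih (by omega), mul_assoc]

/-- The image of a family of coefficients under the right linear map with `b_{n+1} ↦ 1` and
`b_j ↦ z g_j ⋯ g_{n-1}`. -/
noncomputable def counit (h z : R) (n : ℕ) : (ℕ → Hecke h n) →ₗ[R] Hecke h n where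
  toFun m := m (n + 1) + z • ∑ j ∈ Finset.range (n + 1), chain h n j * m j
  map_add' m m' := by
    simp only [Pi.add_apply, mul_add, Finset.sum_add_distrib, smul_add]; abel
  map_smul' r m := by
    simp [← Finset.smul_sum, smul_comm z r]

theorem counit_apply (z : R) (n : ℕ) (m : ℕ → Hecke h n) : counit h z n m =
    m (n + 1) + z • ∑ j ∈ Finset.range (n + 1), chain h n j * m j := rfl

/-- The map is left linear over the subalgebra. -/
theorem counit_act (z : R) {n i : ℕ} (hi : i < n) (m : ℕ → Hecke h n) :
    counit h z n (act h n i m) = gen h n i * counit h z n m := by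
  rw [counit_apply, counit_apply, mul_add, mul_smul_comm, Finset.mul_sum]
  congr 1
  · simp [act_apply, (show ¬ n + 1 < i by omega), (show n + 1 ≠ i by omega),
      (show n ≠ i by omega)]
  congr 1
  -- the terms with `j = i` and `j = i + 1` are exchanged, all others agree
  rw [← Finset.sum_sdiff (s₁ := {i, i + 1}) (s₂ := Finset.range (n + 1)) (by
      intro x; simp; omega),
    ← Finset.sum_sdiff (s₁ := {i, i + 1}) (s₂ := Finset.range (n + 1)) (by
      intro x; simp; omega)]
  congr 1
  · refine Finset.sum_congr rfl fun j hj => ?_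
    simp only [Finset.mem_sdiff, Finset.mem_range, Finset.mem_insert, Finset.mem_singleton,
      not_or] at hj
    obtain ⟨hj, hji, hji'⟩ := hj
    rw [act_apply, if_neg (by omega), if_neg hji, if_neg hji']
    split_ifs with h1
    · rw [← mul_assoc, ← mul_assoc, gen_mul_chain_of_gt h1 hi]
    · rw [← mul_assoc, ← mul_assoc, gen_mul_chain_of_lt (by omega) (by omega)]
  · rw [Finset.sum_pair (by omega), Finset.sum_pair (by omega)]
    have q := (isHeckeFamily_gen h n).quad i hi
    simp only [act_apply, show ¬ n + 1 < i by omega, show ¬ n + 1 < i + 1 by omega, if_false,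
      lt_irrefl, if_true, show ¬ i + 1 < i by omega, show i + 1 ≠ i by omega]
    simp only [chain_succ hi, ← mul_assoc, q, mul_add, add_mul, one_mul, smul_mul_assoc,
      mul_smul_comm]
    abel

theorem counit_mul (z : R) {n : ℕ} (m : ℕ → Hecke h n) (y : Hecke h n) :
    counit h z n (fun j => m j * y) = counit h z n m * y := by
  simp [counit_apply, add_mul, Finset.sum_mul, mul_assoc]

/-- The conditional expectation from the Hecke algebra of type `A_{n+1}` to that of type `A_n`:
the bimodule map that takes the last generator to `z`. -/
noncomputable def condExp (h z : R) (n : ℕ) : Hecke h (n + 1) →ₗ[R] Hecke h n where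
  toFun a := counit h z n (rep h n a (top 1)).1
  map_add' a b := by rw [map_add]; exact map_add (counit h z n) _ _
  map_smul' r a := by rw [map_smul]; exact map_smul (counit h z n) r _

theorem condExp_apply (z : R) (n : ℕ) (a : Hecke h (n + 1)) :
    condExp h z n a = counit h z n (rep h n a (top 1)).1 := rfl

theorem condExp_one (z : R) (n : ℕ) : condExp h z n 1 = 1 := by
  have (j) (hj : j ∈ Finset.range (n + 1)) :
      chain h n j * (Pi.single (n + 1) 1 : ℕ → Hecke h n) j = 0 := by
    rw [Finset.mem_range] at hj
    simp [hj.ne]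
  simp [condExp_apply, counit_apply, coe_top, Finset.sum_congr rfl this]

theorem condExp_mul_up (z : R) {n : ℕ} (a : Hecke h (n + 1)) (x : Hecke h n) :
    condExp h z n (a * up x) = condExp h z n a * x := by
  rw [condExp_apply, condExp_apply, ← counit_mul]
  congr 1
  funext j
  have h1 : rep h n (up x) (top 1) = top x := by
    refine Subtype.ext (funext fun j => ?_)
    rw [rep_up_top, mul_one]
  rw [map_mul, Module.End.mul_apply, h1, ← rep_top, one_mul]

theorem condExp_up_mul (z : R) {n : ℕ} (x : Hecke h n) (a : Hecke h (n + 1)) :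
    condExp h z n (up x * a) = x * condExp h z n a := by
  induction x using induction with
  | one => simp
  | smul r x hx => simp [hx]
  | add x y hx hy => simp [add_mul, hx, hy]
  | gen_mul i hi x hx =>
    rw [map_mul up, up_gen hi, mul_assoc, condExp_apply, coe_rep_gen_mul (by omega),
      counit_act z hi, ← condExp_apply, hx, mul_assoc]

theorem condExp_up (z : R) {n : ℕ} (x : Hecke h n) : condExp h z n (up x) = x := by
  simpa [condExp_one] using condExp_up_mul z x 1

theorem condExp_gen (z : R) (n : ℕ) :
    condExp h z n (gen h (n + 1) n) = algebraMap R _ z := by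
  have h1 := coe_rep_gen_mul (h := h) (Nat.lt_succ_self n) 1 (top 1)
  rw [mul_one] at h1
  rw [condExp_apply, h1, counit_apply, Finset.sum_range_succ, Finset.sum_eq_zero]
  · simp [act_apply, coe_top, chain_self, Algebra.algebraMap_eq_smul_one]
  · intro j hj
    rw [Finset.mem_range] at hj
    simp [act_apply, coe_top, hj, (show ¬ n + 1 < j by omega), (show j ≠ n + 1 by omega)]

/-! ### The Ocneanu trace -/

/-- The span of the Hecke algebra of type `A_n` and of its bimodule generated by the last
generator, inside the Hecke algebra of type `A_{n+1}`. -/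
noncomputable def reduced (h : R) (n : ℕ) : Submodule R (Hecke h (n + 1)) :=
  Submodule.span R ({x | ∃ a, x = up a} ∪ {x | ∃ a b, x = up a * gen h (n + 1) n * up b})

theorem up_mem_reduced {n : ℕ} (a : Hecke h n) : up a ∈ reduced h n :=
  Submodule.subset_span (Or.inl ⟨a, rfl⟩)

theorem up_mul_gen_mul_up_mem_reduced {n : ℕ} (a b : Hecke h n) :
    up a * gen h (n + 1) n * up b ∈ reduced h n :=
  Submodule.subset_span (Or.inr ⟨a, b, rfl⟩)

theorem reduced_induction {n : ℕ} {p : (x : Hecke h (n + 1)) → x ∈ reduced h n → Prop}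
    (up : ∀ a, p (up a) (up_mem_reduced a))
    (up_gen : ∀ a b, p (Hecke.up a * gen h (n + 1) n * Hecke.up b)
      (up_mul_gen_mul_up_mem_reduced a b))
    (add : ∀ x y hx hy, p x hx → p y hy → p (x + y) (add_mem hx hy))
    (smul : ∀ (r : R) x hx, p x hx → p (r • x) (Submodule.smul_mem _ r hx))
    {x : Hecke h (n + 1)} (hx : x ∈ reduced h n) : p x hx := by
  induction hx using Submodule.span_induction with
  | mem x hx => rcases hx with ⟨a, rfl⟩ | ⟨a, b, rfl⟩ <;> simp [*]
  | zero => simpa using up 0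
  | add x y _ _ hx hy => exact add x y _ _ hx hy
  | smul r x _ hx => exact smul r x _ hx

theorem mul_up_mem_reduced {n : ℕ} {x : Hecke h (n + 1)} (hx : x ∈ reduced h n) (y : Hecke h n) :
    x * up y ∈ reduced h n := by
  induction hx using reduced_induction with
  | up a => rw [← map_mul]; exact up_mem_reduced _
  | up_gen a b => rw [mul_assoc, ← map_mul]; exact up_mul_gen_mul_up_mem_reduced _ _
  | add x y _ _ hx hy => rw [add_mul]; exact add_mem hx hy
  | smul r x _ hx => rw [smul_mul_assoc]; exact Submodule.smul_mem _ r hx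

theorem up_mul_mem_reduced {n : ℕ} {x : Hecke h (n + 1)} (hx : x ∈ reduced h n) (y : Hecke h n) :
    up y * x ∈ reduced h n := by
  induction hx using reduced_induction with
  | up a => rw [← map_mul]; exact up_mem_reduced _
  | up_gen a b => rw [← mul_assoc, ← mul_assoc, ← map_mul]; exact up_mul_gen_mul_up_mem_reduced _ _
  | add x y _ _ hx hy => rw [mul_add]; exact add_mem hx hy
  | smul r x _ hx => rw [mul_smul_comm]; exact Submodule.smul_mem _ r hx

/-- The last generator sandwiching an element that commutes with it. -/
theorem gen_mul_mul_gen_of_comm {n : ℕ} {x : Hecke h (n + 1)}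
    (hx : gen h (n + 1) n * x = x * gen h (n + 1) n) :
    gen h (n + 1) n * x * gen h (n + 1) n = x + h • (x * gen h (n + 1) n) := by
  rw [hx, mul_assoc, (isHeckeFamily_gen h (n + 1)).quad n (by omega), mul_add, mul_one,
    mul_smul_comm]

theorem gen_mul_up_up_mul_gen {n : ℕ} (u : Hecke h n) :
    gen h (n + 2) (n + 1) * up (up u) * gen h (n + 2) (n + 1)
      = up (up u) + h • (up (up u) * gen h (n + 2) (n + 1)) := by
  refine gen_mul_mul_gen_of_comm ?_
  rw [map_map]
  exact commute_gen_map _ (by omega) (by omega) u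

theorem gen_mul_up_gen_mul_gen {n : ℕ} (u v : Hecke h n) :
    gen h (n + 2) (n + 1) * up (up u * gen h (n + 1) n * up v) * gen h (n + 2) (n + 1)
      = up (up u * gen h (n + 1) n) * gen h (n + 2) (n + 1) * up (gen h (n + 1) n * up v) := by
  have hu (u : Hecke h n) : gen h (n + 2) (n + 1) * up (up u)
      = up (up u) * gen h (n + 2) (n + 1) := by
    rw [map_map]
    exact commute_gen_map _ (by omega) (by omega) u
  have b := (isHeckeFamily_gen h (n + 2)).braid n (by omega)
  simp only [map_mul, up_gen (Nat.lt_succ_self n)]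
  calc _ = (gen h (n + 2) (n + 1) * up (up u)) * gen h (n + 2) n
          * (up (up v) * gen h (n + 2) (n + 1)) := by simp only [mul_assoc]
    _ = up (up u) * (gen h (n + 2) (n + 1) * gen h (n + 2) n * gen h (n + 2) (n + 1))
          * up (up v) := by rw [hu, ← hu v]; simp only [mul_assoc]
    _ = _ := by rw [← b]; simp only [mul_assoc]

/-- On one strand there are only scalars. -/
theorem eq_algebraMap (x : Hecke h 0) : ∃ r, x = algebraMap R _ r := by
  induction x using induction with
  | one => exact ⟨1, by simp⟩
  | smul r x hx =>
    obtain ⟨s, rfl⟩ := hx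
    exact ⟨r * s, by rw [map_mul, Algebra.smul_def]⟩
  | add x y hx hy =>
    obtain ⟨r, rfl⟩ := hx
    obtain ⟨s, rfl⟩ := hy
    exact ⟨r + s, by simp⟩
  | gen_mul i hi => omega

/-- The span is everything as soon as sandwiching by the last generator preserves it. -/
theorem reduced_eq_top_of {n : ℕ}
    (key : ∀ a : Hecke h n, gen h (n + 1) n * up a * gen h (n + 1) n ∈ reduced h n) :
    reduced h n = ⊤ := by
  rw [eq_top_iff]
  rintro x -
  induction x using induction with
  | one => simpa using up_mem_reduced (h := h) (n := n) 1
  | smul r x hx => exact Submodule.smul_mem _ r hx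
  | add x y hx hy => exact add_mem hx hy
  | gen_mul i hi x hx =>
    rcases eq_or_ne i n with rfl | hne
    · induction hx using reduced_induction with
      | up a => simpa using up_mul_gen_mul_up_mem_reduced 1 a
      | up_gen a b =>
        rw [← mul_assoc, ← mul_assoc]
        exact mul_up_mem_reduced (key a) b
      | add x y _ _ hx hy => rw [mul_add]; exact add_mem hx hy
      | smul r x _ hx => rw [mul_smul_comm]; exact Submodule.smul_mem _ r hx
    · rw [← up_gen (by omega)]
      exact up_mul_mem_reduced hx _

/-- By induction on the number of generators: between two copies of the last generator, an element
reduced for one generator less contains the previous generator at most once, and the quadratic or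
the braid relation applies. -/
theorem reduced_eq_top (h : R) (n : ℕ) : reduced h n = ⊤ := by
  induction n with
  | zero =>
    refine reduced_eq_top_of fun a => ?_
    obtain ⟨r, rfl⟩ := eq_algebraMap a
    rw [gen_mul_mul_gen_of_comm (by rw [AlgHom.commutes, Algebra.commutes])]
    refine add_mem (up_mem_reduced _) (Submodule.smul_mem _ _ ?_)
    simpa using up_mul_gen_mul_up_mem_reduced (algebraMap R (Hecke h 0) r) 1
  | succ n ih =>
    refine reduced_eq_top_of fun a => ?_
    have ha : a ∈ reduced h n := ih ▸ Submodule.mem_top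
    induction ha using reduced_induction with
    | up u =>
      rw [gen_mul_up_up_mul_gen]
      refine add_mem (up_mem_reduced _) (Submodule.smul_mem _ _ ?_)
      simpa using up_mul_gen_mul_up_mem_reduced (up u) 1
    | up_gen u v =>
      rw [gen_mul_up_gen_mul_gen]
      exact up_mul_gen_mul_up_mem_reduced _ _
    | add x y _ _ hx hy => rw [map_add, mul_add, add_mul]; exact add_mem hx hy
    | smul r x _ hx =>
      rw [map_smul, mul_smul_comm, smul_mul_assoc]; exact Submodule.smul_mem _ r hx

/-- Every element is in `reduced h n`, as an induction principle. -/
theorem reduced_rec {n : ℕ} {p : Hecke h (n + 1) → Prop} (up : ∀ a, p (up a))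
    (up_gen : ∀ a b, p (Hecke.up a * gen h (n + 1) n * Hecke.up b))
    (add : ∀ x y, p x → p y → p (x + y)) (smul : ∀ (r : R) x, p x → p (r • x))
    (x : Hecke h (n + 1)) : p x :=
  reduced_induction (p := fun x _ => p x) up up_gen (fun x y _ _ => add x y)
    (fun r x _ => smul r x) (reduced_eq_top h n ▸ Submodule.mem_top)

/-- The value of the conditional expectation on elements sandwiched by the last generator. It is
symmetric enough in `x` to give the trace property. -/
theorem condExp_gen_mul_up_mul_gen (z : R) {n : ℕ} (x : Hecke h (n + 1)) :
    condExp h z (n + 1) (gen h (n + 2) (n + 1) * up x * gen h (n + 2) (n + 1))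
      = (h * z) • x + up (condExp h z n x) := by
  induction x using reduced_rec with
  | up u =>
    rw [gen_mul_up_up_mul_gen, map_add, map_smul, condExp_up, condExp_up_mul, condExp_gen,
      condExp_up, ← Algebra.commutes, ← Algebra.smul_def, smul_smul]
    abel
  | up_gen u v =>
    rw [gen_mul_up_gen_mul_gen, condExp_mul_up, condExp_up_mul, condExp_gen, condExp_mul_up,
      condExp_up_mul, condExp_gen, ← Algebra.commutes, ← Algebra.commutes, ← Algebra.smul_def,
      ← Algebra.smul_def]
    have q := (isHeckeFamily_gen h (n + 1)).quad n (by omega)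
    calc _ = z • (up u * (gen h (n + 1) n * gen h (n + 1) n) * up v) := by
          simp only [smul_mul_assoc, mul_assoc]
      _ = _ := by
          rw [q]
          simp only [mul_add, add_mul, mul_one, smul_mul_assoc, mul_smul_comm, smul_add, map_smul,
            map_mul, smul_smul, mul_comm z h]
          abel
  | add x y hx hy =>
    simp only [map_add, mul_add, add_mul, hx, hy, smul_add]; abel
  | smul r x hx =>
    simp only [map_smul, mul_smul_comm, smul_mul_assoc, hx, smul_add, smul_comm r]

/-- The projection of the Hecke algebra of type `A_0` onto its scalars. -/
noncomputable def scalar (h : R) : Hecke h 0 →ₐ[R] R :=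
  lift (f := fun _ => 0) ⟨fun _ hi => by omega, fun _ hi => by omega, fun _ _ _ hj => by omega⟩

/-- The Ocneanu trace with parameter `z`, normalized so as to take the value `1` at `1`. -/
noncomputable def ocneanu (h z : R) : (n : ℕ) → Hecke h n →ₗ[R] R
  | 0 => (scalar h).toLinearMap
  | n + 1 => ocneanu h z n ∘ₗ condExp h z n

theorem ocneanu_succ (z : R) {n : ℕ} (x : Hecke h (n + 1)) :
    ocneanu h z (n + 1) x = ocneanu h z n (condExp h z n x) := rfl

theorem ocneanu_one (z : R) (n : ℕ) : ocneanu h z n 1 = 1 := by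
  induction n with
  | zero => simp [ocneanu]
  | succ n ih => rw [ocneanu_succ, condExp_one, ih]

theorem ocneanu_map (z : R) {m n : ℕ} (hmn : m ≤ n) (x : Hecke h m) :
    ocneanu h z n (map h hmn x) = ocneanu h z m x := by
  induction n, hmn using Nat.le_induction with
  | base => rw [map_self]
  | succ n hmn ih => rw [← map_map hmn n.le_succ, ocneanu_succ, condExp_up, ih]

theorem ocneanu_up_mul_gen_mul_up (z : R) {n : ℕ} (x y : Hecke h n) :
    ocneanu h z (n + 1) (up x * gen h (n + 1) n * up y) = z * ocneanu h z n (x * y) := by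
  rw [ocneanu_succ, condExp_mul_up, condExp_up_mul, condExp_gen, ← Algebra.commutes,
    ← Algebra.smul_def, smul_mul_assoc, map_smul, smul_eq_mul]

/-- It suffices to commute elements of the subalgebra, where the bimodule property of the
conditional expectation applies, and the last generator. -/
theorem ocneanu_mul_comm (z : R) {n : ℕ} (a b : Hecke h n) :
    ocneanu h z n (a * b) = ocneanu h z n (b * a) := by
  induction n with
  | zero =>
    obtain ⟨r, rfl⟩ := eq_algebraMap a
    rw [Algebra.commutes]
  | succ n ih =>
    have up_comm (x : Hecke h n) (c : Hecke h (n + 1)) :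
        ocneanu h z (n + 1) (up x * c) = ocneanu h z (n + 1) (c * up x) := by
      rw [ocneanu_succ, ocneanu_succ, condExp_mul_up, condExp_up_mul, ih]
    have gen_comm (c : Hecke h (n + 1)) :
        ocneanu h z (n + 1) (gen h (n + 1) n * c) = ocneanu h z (n + 1) (c * gen h (n + 1) n) := by
      induction c using reduced_rec with
      | up x => rw [up_comm]
      | up_gen x y =>
        cases n with
        | zero =>
          obtain ⟨r, rfl⟩ := eq_algebraMap x
          obtain ⟨s, rfl⟩ := eq_algebraMap y
          simp only [AlgHom.commutes, mul_assoc]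
          simp only [← Algebra.smul_def, mul_smul_comm, ← Algebra.commutes s]
        | succ k =>
          have h1 : gen h (k + 2) (k + 1) * (up x * gen h (k + 2) (k + 1) * up y)
              = gen h (k + 2) (k + 1) * up x * gen h (k + 2) (k + 1) * up y := by
            simp only [mul_assoc]
          have h2 : up x * gen h (k + 2) (k + 1) * up y * gen h (k + 2) (k + 1)
              = up x * (gen h (k + 2) (k + 1) * up y * gen h (k + 2) (k + 1)) := by
            simp only [mul_assoc]
          rw [h1, h2, ocneanu_succ, ocneanu_succ z (up x * _), condExp_mul_up, condExp_up_mul,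
            condExp_gen_mul_up_mul_gen, condExp_gen_mul_up_mul_gen, add_mul, mul_add, map_add,
            map_add, smul_mul_assoc, mul_smul_comm, ocneanu_succ z (up _ * y),
            ocneanu_succ z (x * up _), condExp_mul_up, condExp_up_mul]
      | add x y hx hy => simp [mul_add, add_mul, hx, hy]
      | smul r x hx => simp [hx]
    induction a using reduced_rec generalizing b with
    | up x => exact up_comm x b
    | up_gen x y =>
      calc _ = ocneanu h z (n + 1) (up x * (gen h (n + 1) n * (up y * b))) := by
            simp only [mul_assoc]
        _ = ocneanu h z (n + 1) (gen h (n + 1) n * (up y * b * up x)) := by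
            rw [up_comm]; simp only [mul_assoc]
        _ = ocneanu h z (n + 1) (up y * (b * up x * gen h (n + 1) n)) := by
            rw [gen_comm]; simp only [mul_assoc]
        _ = _ := by rw [up_comm]; simp only [mul_assoc]
    | add x y hx hy => simp [mul_add, add_mul, hx, hy]
    | smul r x hx => simp [hx]

/-- The Markov property of the Ocneanu trace. -/
theorem ocneanu_mul_gen (z : R) {n k : ℕ} (hk : k < n) {x : Hecke h n}
    (hx : x ∈ Algebra.adjoin R {x | ∃ i < k, x = gen h n i}) :
    ocneanu h z n (x * gen h n k) = z * ocneanu h z n x := by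
  have hle : Algebra.adjoin R {x | ∃ i < k, x = gen h n i} ≤ (map h hk.le).range := by
    rw [Algebra.adjoin_le_iff]
    rintro _ ⟨i, hi, rfl⟩
    exact ⟨_, map_gen _ hi⟩
  obtain ⟨y, rfl⟩ := hle hx
  have h1 : map h hk.le y * gen h n k = map h hk (up y * gen h (k + 1) k * up 1) := by
    rw [map_one, mul_one, map_mul, map_gen _ (Nat.lt_succ_self k)]
    congr 1
    exact (map_map _ _ y).symm
  change ocneanu h z n (map h hk.le y * _) = z * ocneanu h z n (map h hk.le y)
  rw [h1, ocneanu_map, ocneanu_map, ocneanu_up_mul_gen_mul_up, mul_one]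

end Hecke

/-! ### Generators of the Yokonuma–Hecke algebra -/

section Generators
variable {d n : ℕ} {q : ℂ}

theorem proj_framedRel {a b : FreeGroup (Fin (n - 1) ⊕ Fin n)} (h : FramedRel d n a b) :
    proj d n q (MonoidAlgebra.of ℂ _ (PresentedGroup.mk _ a : FramedBraidGroup d n))
      = proj d n q (MonoidAlgebra.of ℂ _ (PresentedGroup.mk _ b : FramedBraidGroup d n)) := by
  rw [framedRel_eq h]

theorem g_braid (i j : Fin (n - 1)) (h : i.val + 1 = j.val) :
    g d n q i * g d n q j * g d n q i = g d n q j * g d n q i * g d n q j := by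
  have := proj_framedRel (q := q) (FramedRel.braid (d := d) i j (Or.inl h))
  simp only [map_mul] at this
  exact this

theorem g_comm (i j : Fin (n - 1)) (h : i.val + 1 < j.val ∨ j.val + 1 < i.val) :
    g d n q i * g d n q j = g d n q j * g d n q i := by
  have := proj_framedRel (q := q) (FramedRel.comm (d := d) i j h)
  simp only [map_mul] at this
  exact this

theorem t_comm (i j : Fin n) : t d n q i * t d n q j = t d n q j * t d n q i := by
  have := proj_framedRel (q := q) (FramedRel.framing_comm (d := d) i j)
  simp only [map_mul] at this
  exact this

theorem t_mul_g (i : Fin (n - 1)) (j : Fin n) : t d n q j * g d n q i =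
    g d n q i * t d n q (Equiv.swap (leftPos i) (rightPos i) j) := by
  have := proj_framedRel (q := q) (FramedRel.framing_braid (d := d) i j)
  simp only [map_mul] at this
  exact this

theorem t_pow (j : Fin n) : t d n q j ^ d = 1 := by
  have := proj_framedRel (q := q) (FramedRel.modular (d := d) j)
  simp only [map_pow, map_one] at this
  exact this

theorem proj_e (i : Fin (n - 1)) : proj d n q (e d n i) =
    (d : ℂ)⁻¹ • ∑ s ∈ Finset.range d, t d n q (leftPos i) ^ s * t d n q (rightPos i) ^ (d - s) := by
  simp only [e, map_smul, map_sum, map_mul, map_pow, t]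

theorem g_mul_g (i : Fin (n - 1)) :
    g d n q i * g d n q i = 1 + (q - q⁻¹) • (proj d n q (e d n i) * g d n q i) := by
  have := RingQuot.mkAlgHom_rel ℂ (QuadraticRel.quadratic (d := d) (n := n) (q := q) i)
  change proj d n q _ = proj d n q _ at this
  rwa [pow_two, map_mul, map_add, map_one, map_smul, map_mul] at this

/-- Inverses of the generators are not needed to generate the algebra: `g_i` is inverted by its
quadratic relation and `t_j` by `t_j ^ d = 1`. -/
theorem proj_of_mem_adjoin [NeZero d] (x : FramedBraidGroup d n) :
    proj d n q (MonoidAlgebra.of ℂ _ x) ∈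
      Algebra.adjoin ℂ (Set.range (g d n q) ∪ Set.range (t d n q)) := by
  set S := Algebra.adjoin ℂ (Set.range (g d n q) ∪ Set.range (t d n q))
  have hg (i) : g d n q i ∈ S := Algebra.subset_adjoin (Or.inl ⟨i, rfl⟩)
  have ht (i) : t d n q i ∈ S := Algebra.subset_adjoin (Or.inr ⟨i, rfl⟩)
  have hx : x ∈ Subgroup.closure (Set.range PresentedGroup.of) := by
    rw [PresentedGroup.closure_range_of]; trivial
  -- the inverse of a generator, once identified with an element of the subalgebra
  have inv_eq (y : FramedBraidGroup d n) (b : Y d n q)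
      (hb : b * proj d n q (MonoidAlgebra.of ℂ _ y) = 1) :
      proj d n q (MonoidAlgebra.of ℂ _ y⁻¹) = b := by
    have h1 : proj d n q (MonoidAlgebra.of ℂ _ y) * proj d n q (MonoidAlgebra.of ℂ _ y⁻¹) = 1 := by
      rw [← map_mul, ← map_mul, mul_inv_cancel, map_one, map_one]
    exact (left_inv_eq_right_inv hb h1).symm
  induction hx using Subgroup.closure_induction'' with
  | mem y hy =>
    obtain ⟨i | j, rfl⟩ := hy
    · exact hg i
    · exact ht j
  | inv_mem y hy =>
    obtain ⟨i | j, rfl⟩ := hy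
    · rw [inv_eq (PresentedGroup.of (Sum.inl i)) (g d n q i - (q - q⁻¹) • proj d n q (e d n i))]
      · refine S.sub_mem (hg i) (S.smul_mem ?_ _)
        rw [proj_e]
        exact S.smul_mem (S.sum_mem fun s _ => S.mul_mem (S.pow_mem (ht _) _)
          (S.pow_mem (ht _) _)) _
      · change _ * g d n q i = 1
        rw [sub_mul, g_mul_g, smul_mul_assoc, add_sub_cancel_right]
    · rw [inv_eq (PresentedGroup.of (Sum.inr j)) (t d n q j ^ (d - 1))]
      · exact S.pow_mem (ht j) _
      · change _ * t d n q j = 1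
        rw [← pow_succ, Nat.sub_add_cancel (NeZero.one_le), t_pow]
  | one => rw [map_one, map_one]; exact S.one_mem
  | mul x y _ _ hx hy => rw [map_mul, map_mul]; exact S.mul_mem hx hy

theorem adjoin_g_t (d n : ℕ) [NeZero d] (q : ℂ) :
    Algebra.adjoin ℂ (Set.range (g d n q) ∪ Set.range (t d n q)) = ⊤ := by
  rw [eq_top_iff]
  rintro x -
  obtain ⟨y, rfl⟩ := RingQuot.mkAlgHom_surjective ℂ (QuadraticRel d n q) x
  change proj d n q y ∈ _
  induction y using MonoidAlgebra.induction_on with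
  | of x => exact proj_of_mem_adjoin x
  | add a b ha hb => rw [map_add]; exact Subalgebra.add_mem _ ha hb
  | smul r a ha => rw [map_smul]; exact Subalgebra.smul_mem _ ha _

theorem Y_induction [NeZero d] {p : Y d n q → Prop} (g : ∀ i, p (g d n q i))
    (t : ∀ j, p (t d n q j)) (scalar : ∀ r : ℂ, p (algebraMap ℂ _ r))
    (add : ∀ x y, p x → p y → p (x + y)) (mul : ∀ x y, p x → p y → p (x * y))
    (x : Y d n q) : p x := by
  have hx : x ∈ Algebra.adjoin ℂ (Set.range (YokonumaHecke.g d n q) ∪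
      Set.range (YokonumaHecke.t d n q)) := adjoin_g_t d n q ▸ Algebra.mem_top
  induction hx using Algebra.adjoin_induction with
  | mem x hx => rcases hx with ⟨i, rfl⟩ | ⟨j, rfl⟩ <;> simp [*]
  | algebraMap r => exact scalar r
  | add x y _ _ hx hy => exact add x y hx hy
  | mul x y _ _ hx hy => exact mul x y hx hy

theorem incl_proj (x : MonoidAlgebra ℂ (FramedBraidGroup d n)) :
    incl d n q (proj d n q x) = proj d (n + 1) q (algebraIncl d n x) :=
  RingQuot.liftAlgHom_mkAlgHom_apply ℂ _ _ _

theorem incl_g (i : Fin (n - 1)) :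
    incl d n q (g d n q i) = g d (n + 1) q ⟨i.val, by omega⟩ := by
  rw [g, incl_proj, algebraIncl_of, framedIncl_sigma, g]

theorem incl_t (j : Fin n) : incl d n q (t d n q j) = t d (n + 1) q j.castSucc := by
  rw [t, incl_proj, algebraIncl_of, framedIncl_framing, t]

end Generators

/-! ### Monomial matrices indexed by colorings -/

section Colored

variable {C A : Type} {n : ℕ}

/-- The transposition of positions that underlies a braiding generator. -/
def strandSwap (i : Fin (n - 1)) : Equiv.Perm (Fin n) := Equiv.swap (leftPos i) (rightPos i)

theorem strandSwap_mul_self (i : Fin (n - 1)) : strandSwap i * strandSwap i = 1 :=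
  Equiv.swap_mul_self _ _

theorem comp_strandSwap_left (χ : Fin n → C) (i : Fin (n - 1)) :
    (χ ∘ strandSwap i) (leftPos i) = χ (rightPos i) := by
  simp [strandSwap]

theorem comp_strandSwap_right (χ : Fin n → C) (i : Fin (n - 1)) :
    (χ ∘ strandSwap i) (rightPos i) = χ (leftPos i) := by
  simp [strandSwap]

theorem strandSwap_of_ne {i : Fin (n - 1)} {j : Fin n} (h1 : j.val ≠ i.val)
    (h2 : j.val ≠ i.val + 1) : strandSwap i j = j :=
  Equiv.swap_apply_of_ne_of_ne (fun h => h1 (congrArg Fin.val h)) (fun h => h2 (congrArg Fin.val h))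

theorem comp_strandSwap_of_ne (χ : Fin n → C) {i : Fin (n - 1)} {j : Fin n} (h1 : j.val ≠ i.val)
    (h2 : j.val ≠ i.val + 1) : (χ ∘ strandSwap i) j = χ j := by
  rw [Function.comp_apply, strandSwap_of_ne h1 h2]

theorem comp_strandSwap_of_eq {χ : Fin n → C} {i : Fin (n - 1)}
    (h : χ (leftPos i) = χ (rightPos i)) : χ ∘ strandSwap i = χ := by
  funext j
  simp only [Function.comp_apply, strandSwap, Equiv.swap_apply_def]
  split_ifs with h1 h2
  · rw [h1, h]
  · rw [h2, h]
  · rfl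

variable [DecidableEq C] [Ring A]

/-- The matrix, with rows and columns indexed by the colorings of `n` strands, whose only non-zero
entry in the row `χ` is `a χ`, in the column `χ ∘ σ`. -/
def mono (σ : Equiv.Perm (Fin n)) (a : (Fin n → C) → A) : Matrix (Fin n → C) (Fin n → C) A :=
  Matrix.of fun χ χ' => if χ' = χ ∘ σ then a χ else 0

theorem mono_apply (σ : Equiv.Perm (Fin n)) (a : (Fin n → C) → A) (χ χ' : Fin n → C) :
    mono σ a χ χ' = if χ' = χ ∘ σ then a χ else 0 := rfl

theorem mono_one_apply (a : (Fin n → C) → A) (χ χ' : Fin n → C) :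
    mono 1 a χ χ' = if χ' = χ then a χ else 0 := by
  rw [mono_apply]; congr

theorem mono_mul [Fintype C] (σ τ : Equiv.Perm (Fin n)) (a b : (Fin n → C) → A) :
    mono σ a * mono τ b = mono (σ * τ) fun χ => a χ * b (χ ∘ σ) := by
  ext χ χ'
  rw [Matrix.mul_apply, Finset.sum_eq_single (χ ∘ σ)]
  · simp [mono_apply, Function.comp_assoc]
    rfl
  · intro χ'' _ hne
    rw [mono_apply, if_neg hne, zero_mul]
  · simp

theorem mono_one : mono (C := C) (A := A) (n := n) 1 (fun _ => 1) = 1 := by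
  ext χ χ'
  simp [mono_apply, Matrix.one_apply, eq_comm]

theorem mono_one_pow [Fintype C] (a : (Fin n → C) → A) (k : ℕ) :
    mono 1 a ^ k = mono 1 fun χ => a χ ^ k := by
  induction k with
  | zero => simp [mono_one]
  | succ k ih => rw [pow_succ, ih, mono_mul]; simp [pow_succ]

theorem mul_mono_apply [Fintype C] (M : Matrix (Fin n → C) (Fin n → C) A) {σ : Equiv.Perm (Fin n)}
    (a : (Fin n → C) → A) (χ χ' : Fin n → C) :
    (M * mono σ a) χ χ' = M χ (χ' ∘ σ.symm) * a (χ' ∘ σ.symm) := by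
  rw [Matrix.mul_apply, Finset.sum_eq_single (χ' ∘ σ.symm)]
  · simp [mono_apply, Function.comp_assoc]
  · intro χ'' _ hne
    rw [mono_apply, if_neg, mul_zero]
    rintro rfl
    simp [Function.comp_assoc] at hne
  · simp

/-- The number of strands of color `c` among the first `m` strands. -/
def colorCount (χ : Fin n → C) (m : ℕ) (c : C) : ℕ :=
  (Finset.univ.filter fun j : Fin n => j.val < m ∧ χ j = c).card

theorem colorCount_comp (χ : Fin n → C) (σ : Equiv.Perm (Fin n)) {m : ℕ}
    (hσ : ∀ j, (σ j).val < m ↔ j.val < m) (c : C) :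
    colorCount (χ ∘ σ) m c = colorCount χ m c :=
  Finset.card_equiv σ (by simp [hσ])

theorem colorCount_succ (χ : Fin n → C) (m : ℕ) (hm : m < n) (c : C) :
    colorCount χ (m + 1) c = colorCount χ m c + if χ ⟨m, hm⟩ = c then 1 else 0 := by
  have : (Finset.univ.filter fun j : Fin n => j.val < m + 1 ∧ χ j = c)
      = (Finset.univ.filter fun j : Fin n => j.val < m ∧ χ j = c) ∪
        (Finset.univ.filter fun j : Fin n => j.val = m ∧ χ j = c) := by
    ext j; simp only [Finset.mem_filter, Finset.mem_univ, true_and, Finset.mem_union]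
    constructor
    · rintro ⟨h1, h2⟩
      rcases Nat.lt_succ_iff_lt_or_eq.mp h1 with h | h
      · exact Or.inl ⟨h, h2⟩
      · exact Or.inr ⟨h, h2⟩
    · rintro (⟨h1, h2⟩ | ⟨h1, h2⟩)
      · exact ⟨by omega, h2⟩
      · exact ⟨by omega, h2⟩
  rw [colorCount, this, Finset.card_union_of_disjoint, colorCount]
  · congr 1
    split_ifs with h
    · rw [Finset.card_eq_one]
      refine ⟨⟨m, hm⟩, ?_⟩
      ext j
      simp only [Finset.mem_filter, Finset.mem_univ, true_and, Finset.mem_singleton, Fin.ext_iff]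
      refine ⟨fun h => h.1, fun h1 => ⟨h1, ?_⟩⟩
      rw [← h]; congr 1; exact Fin.ext h1
    · rw [Finset.card_eq_zero, Finset.filter_eq_empty_iff]
      rintro j - ⟨h1, h2⟩
      exact h (by rw [← h2]; congr 1; exact Fin.ext h1.symm)
  · rw [Finset.disjoint_filter]
    rintro j - ⟨h1, -⟩ ⟨h2, -⟩
    omega

theorem colorCount_mono (χ : Fin n → C) {m m' : ℕ} (h : m ≤ m') (c : C) :
    colorCount χ m c ≤ colorCount χ m' c :=
  Finset.card_le_card fun j hj => by
    simp only [Finset.mem_filter, Finset.mem_univ, true_and] at hj ⊢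
    exact ⟨by omega, hj.2⟩

theorem colorCount_le (χ : Fin n → C) (m : ℕ) (c : C) : colorCount χ m c ≤ m := by
  refine (Finset.card_le_card_of_injOn Fin.val (t := Finset.range m) ?_
    (Fin.val_injective.injOn)).trans (Finset.card_range m).le
  intro j hj
  simp only [Finset.coe_filter, Finset.mem_univ, true_and, Set.mem_ofPred_eq] at hj
  simpa using hj.1

theorem colorCount_init (χ : Fin (n + 1) → C) {m : ℕ} (hm : m ≤ n) (c : C) :
    colorCount (Fin.init χ) m c = colorCount χ m c := by
  rw [colorCount, colorCount, ← Finset.card_map (Fin.castSuccEmb)]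
  congr 1
  ext j
  simp only [Finset.mem_map, Finset.mem_filter, Finset.mem_univ, true_and, Fin.init,
    Fin.coe_castSuccEmb]
  constructor
  · rintro ⟨i, hi, rfl⟩
    exact (Finset.mem_filter.mp hi).2
  · rintro ⟨h1, h2⟩
    exact ⟨⟨j, by omega⟩, Finset.mem_filter.mpr ⟨Finset.mem_univ _, h1, h2⟩, rfl⟩

theorem colorCount_comp_strandSwap (χ : Fin n → C) (i : Fin (n - 1)) {m : ℕ}
    (hm : m ≤ i.val ∨ i.val + 2 ≤ m) (c : C) :
    colorCount (χ ∘ strandSwap i) m c = colorCount χ m c := by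
  refine colorCount_comp χ _ (fun j => ?_) c
  simp only [strandSwap, Equiv.swap_apply_def, Fin.ext_iff, leftPos, rightPos]
  split_ifs <;> simp <;> omega

end Colored

/-! ### The colored representation of the Yokonuma–Hecke algebra -/

/-- Elements `γ c i` (`i < N`) of an algebra that, for each color `c`, satisfy the relations of the
generators of a Hecke algebra, and commute for distinct colors. -/
structure IsColoredFamily {C A : Type} [Ring A] [Algebra ℂ A] (h : ℂ) (N : ℕ) (γ : C → ℕ → A) :
    Prop where
  hecke : ∀ c, IsHeckeFamily h N (γ c)
  comm : ∀ c c' i j, c ≠ c' → γ c i * γ c' j = γ c' j * γ c i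

section Rep

variable {C A : Type} [DecidableEq C] [Ring A] [Algebra ℂ A] {n N : ℕ}

/-- The coefficient of the `i`-th braiding generator at the coloring `χ`: if the two strands have
the same color `c`, it is the generator `γ c k`, where `k` is the number of strands of color `c`
further left, and otherwise it is `1`. -/
def weight (γ : C → ℕ → A) (i : Fin (n - 1)) (χ : Fin n → C) : A :=
  if χ (leftPos i) = χ (rightPos i) then
    γ (χ (leftPos i)) (colorCount χ i.val (χ (leftPos i))) else 1

/-- The coefficient of the inverse of the `i`-th braiding generator at the coloring `χ`. -/
noncomputable def weightInv (h : ℂ) (γ : C → ℕ → A) (i : Fin (n - 1)) (χ : Fin n → C) : A :=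
  if χ (leftPos i) = χ (rightPos i) then
    γ (χ (leftPos i)) (colorCount χ i.val (χ (leftPos i))) - h • 1 else 1

/-- The matrix of the `i`-th braiding generator. -/
def sigmaMat (γ : C → ℕ → A) (i : Fin (n - 1)) : Matrix (Fin n → C) (Fin n → C) A :=
  mono (strandSwap i) (weight γ i)

theorem colorCount_lt_of_le (hn : n ≤ N) (i : Fin (n - 1)) (χ : Fin n → C) (c : C) :
    colorCount χ i.val c < N :=
  (colorCount_le χ i.val c).trans_lt (by omega)

theorem weight_mul_weightInv {h : ℂ} {γ : C → ℕ → A} (hγ : IsColoredFamily h N γ) (hn : n ≤ N)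
    (i : Fin (n - 1)) (χ : Fin n → C) :
    weight γ i χ * weightInv h γ i (χ ∘ strandSwap i) = 1 := by
  rw [weight, weightInv, comp_strandSwap_left, comp_strandSwap_right]
  by_cases hc : χ (leftPos i) = χ (rightPos i)
  · have q := (hγ.hecke (χ (leftPos i))).quad _ (colorCount_lt_of_le hn i χ (χ (leftPos i)))
    rw [if_pos hc, if_pos hc.symm, comp_strandSwap_of_eq hc, ← hc, mul_sub, q, mul_smul_comm,
      mul_one, add_sub_cancel_right]
  · rw [if_neg hc, if_neg (Ne.symm hc), one_mul]

theorem weightInv_mul_weight {h : ℂ} {γ : C → ℕ → A} (hγ : IsColoredFamily h N γ) (hn : n ≤ N)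
    (i : Fin (n - 1)) (χ : Fin n → C) :
    weightInv h γ i χ * weight γ i (χ ∘ strandSwap i) = 1 := by
  rw [weight, weightInv, comp_strandSwap_left, comp_strandSwap_right]
  by_cases hc : χ (leftPos i) = χ (rightPos i)
  · have q := (hγ.hecke (χ (leftPos i))).quad _ (colorCount_lt_of_le hn i χ (χ (leftPos i)))
    rw [if_pos hc, if_pos hc.symm, comp_strandSwap_of_eq hc, ← hc, sub_mul, q, smul_mul_assoc,
      one_mul, add_sub_cancel_right]
  · rw [if_neg hc, if_neg (Ne.symm hc), one_mul]

variable [Fintype C]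

/-- The matrix of the `i`-th braiding generator as a unit. -/
noncomputable def sigmaUnit {h : ℂ} {γ : C → ℕ → A} (hγ : IsColoredFamily h N γ) (hn : n ≤ N)
    (i : Fin (n - 1)) : (Matrix (Fin n → C) (Fin n → C) A)ˣ where
  val := sigmaMat γ i
  inv := mono (strandSwap i) (weightInv h γ i)
  val_inv := by
    rw [sigmaMat, mono_mul, strandSwap_mul_self, ← mono_one]
    exact congrArg _ (funext fun χ => weight_mul_weightInv hγ hn i χ)
  inv_val := by
    rw [sigmaMat, mono_mul, strandSwap_mul_self, ← mono_one]
    exact congrArg _ (funext fun χ => weightInv_mul_weight hγ hn i χ)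

/-- The matrix of the `j`-th framing generator, where the color `c` stands for the eigenvalue
`exp(2πi c / d)`. -/
noncomputable def framingMat {d : ℕ} [NeZero d] (A : Type) [Ring A] [Algebra ℂ A] (col : C → ZMod d)
    (j : Fin n) : Matrix (Fin n → C) (Fin n → C) A :=
  mono 1 fun χ => algebraMap ℂ A (ZMod.stdAddChar (col (χ j)))

theorem framingMat_pow {d : ℕ} [NeZero d] (col : C → ZMod d) (j : Fin n) (k : ℕ) :
    framingMat A col j ^ k
      = mono 1 fun χ => algebraMap ℂ A (ZMod.stdAddChar ((k : ZMod d) * col (χ j))) := by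
  rw [framingMat, mono_one_pow]
  congr 1; funext χ
  rw [← map_pow, ← AddChar.map_nsmul_eq_pow, nsmul_eq_mul]

theorem framingMat_pow_d {d : ℕ} [NeZero d] (col : C → ZMod d) (j : Fin n) :
    framingMat A col j ^ d = 1 := by
  rw [framingMat_pow, ← mono_one]
  simp

theorem framingMat_mul_framingMat {d : ℕ} [NeZero d] (col : C → ZMod d) (i j : Fin n) :
    framingMat A col i * framingMat A col j = framingMat A col j * framingMat A col i := by
  rw [framingMat, framingMat, mono_mul, mono_mul]
  congr 1; funext χ
  exact (Algebra.commutes _ _)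

theorem framingMat_mul_sigmaMat {d : ℕ} [NeZero d] (col : C → ZMod d) (γ : C → ℕ → A)
    (i : Fin (n - 1)) (j : Fin n) :
    framingMat A col j * sigmaMat γ i = sigmaMat γ i * framingMat A col (strandSwap i j) := by
  rw [framingMat, framingMat, sigmaMat, mono_mul, mono_mul, one_mul, mul_one]
  congr 1; funext χ
  have h1 : strandSwap i (strandSwap i j) = j := Equiv.swap_apply_self _ _ _
  simp only [Function.comp_apply, h1, Equiv.Perm.coe_one, Function.comp_id]
  exact Algebra.commutes _ _

/-- The matrix of a framing generator as a unit. -/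
noncomputable def framingUnit {d : ℕ} [NeZero d] (A : Type) [Ring A] [Algebra ℂ A]
    (col : C → ZMod d) (j : Fin n) : (Matrix (Fin n → C) (Fin n → C) A)ˣ :=
  Units.ofPowEqOne (framingMat A col j) d (framingMat_pow_d col j) (NeZero.ne d)

theorem sigmaMat_braid {h : ℂ} {γ : C → ℕ → A} (hγ : IsColoredFamily h N γ) (hn : n ≤ N)
    (i j : Fin (n - 1)) (hij : i.val + 1 = j.val) :
    sigmaMat γ i * sigmaMat γ j * sigmaMat γ i = sigmaMat γ j * sigmaMat γ i * sigmaMat γ j := by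
  have hj : leftPos j = rightPos i := Fin.ext hij.symm
  have hne1 : (leftPos i).val ≠ j.val := by simp only [leftPos]; omega
  have hne2 : (leftPos i).val ≠ j.val + 1 := by simp only [leftPos]; omega
  have hne3 : (rightPos j).val ≠ i.val := by simp only [rightPos]; omega
  have hne4 : (rightPos j).val ≠ i.val + 1 := by simp only [rightPos]; omega
  have hperm : strandSwap i * strandSwap j * strandSwap i
      = strandSwap j * strandSwap i * strandSwap j := by
    have h1 := Equiv.swap_mul_swap_mul_swap (x := leftPos i) (y := rightPos i) (z := rightPos j)
      (by simp [leftPos, rightPos, Fin.ext_iff]) (by simp [leftPos, rightPos, Fin.ext_iff]; omega)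
    have h2 := Equiv.swap_mul_swap_mul_swap (x := rightPos j) (y := rightPos i) (z := leftPos i)
      (by simp [rightPos, Fin.ext_iff]; omega) (by simp [leftPos, rightPos, Fin.ext_iff]; omega)
    rw [Equiv.swap_comm (rightPos i) (leftPos i), Equiv.swap_comm (rightPos j) (rightPos i),
      Equiv.swap_comm (leftPos i) (rightPos j)] at h2
    simp only [strandSwap, hj, h1, h2]
  -- the weight of the right generator, in terms of the colors to the left of both generators
  have hw (χ : Fin n → C) : weight γ j χ = if χ (rightPos i) = χ (rightPos j) then
      γ (χ (rightPos i)) (colorCount χ i.val (χ (rightPos i)) +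
        if χ (leftPos i) = χ (rightPos i) then 1 else 0) else 1 := by
    rw [weight, hj, ← hij, colorCount_succ χ i.val (by omega)]; rfl
  have hwi (χ : Fin n → C) : weight γ i χ = if χ (leftPos i) = χ (rightPos i) then
      γ (χ (leftPos i)) (colorCount χ i.val (χ (leftPos i))) else 1 := rfl
  have hl (χ : Fin n → C) : (χ ∘ strandSwap j) (leftPos i) = χ (leftPos i) :=
    comp_strandSwap_of_ne χ hne1 hne2
  have hr (χ : Fin n → C) : (χ ∘ strandSwap i) (rightPos j) = χ (rightPos j) :=
    comp_strandSwap_of_ne χ hne3 hne4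
  have hm (χ : Fin n → C) : (χ ∘ strandSwap j) (rightPos i) = χ (rightPos j) := by
    rw [← hj]; exact comp_strandSwap_left χ j
  have hm' (χ : Fin n → C) : (χ ∘ strandSwap j) (rightPos j) = χ (rightPos i) := by
    rw [← hj]; exact comp_strandSwap_right χ j
  have hci (χ : Fin n → C) (c : C) : colorCount (χ ∘ strandSwap i) i.val c
      = colorCount χ i.val c := colorCount_comp_strandSwap χ i (Or.inl le_rfl) c
  have hcj (χ : Fin n → C) (c : C) : colorCount (χ ∘ strandSwap j) i.val c
      = colorCount χ i.val c := colorCount_comp_strandSwap χ j (Or.inl (by omega)) c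
  simp only [sigmaMat, mono_mul, hperm]
  congr 1; funext χ
  simp only [Equiv.Perm.coe_mul, ← Function.comp_assoc]
  simp only [hw, hwi, hci, hcj, hl, hr, hm, hm', comp_strandSwap_left, comp_strandSwap_right]
  generalize hx : χ (leftPos i) = x
  generalize hy : χ (rightPos i) = y
  generalize hu : χ (rightPos j) = u
  by_cases hxy : x = y
  · subst hxy
    by_cases hxu : x = u
    · subst hxu
      have hb := (hγ.hecke x).braid (colorCount χ i.val x) (by
        have := colorCount_le χ i.val x
        omega)
      simpa using hb
    · simp [hxu, Ne.symm hxu]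
  · by_cases hxu : x = u
    · subst hxu
      simp [hxy, Ne.symm hxy]
    · by_cases hyu : y = u
      · subst hyu
        simp [hxy]
      · simp [hxy, hxu, hyu]

theorem sigmaMat_comm {h : ℂ} {γ : C → ℕ → A} (hγ : IsColoredFamily h N γ) (hn : n ≤ N)
    (i j : Fin (n - 1)) (hij : i.val + 1 < j.val) :
    sigmaMat γ i * sigmaMat γ j = sigmaMat γ j * sigmaMat γ i := by
  have hperm : strandSwap i * strandSwap j = strandSwap j * strandSwap i := by
    refine (Equiv.Perm.Disjoint.commute ?_).eq
    intro x
    by_cases hx : x.val = i.val ∨ x.val = i.val + 1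
    · exact Or.inr (strandSwap_of_ne (by omega) (by omega))
    · exact Or.inl (strandSwap_of_ne (by omega) (by omega))
  have h1 (χ : Fin n → C) : weight γ j (χ ∘ strandSwap i) = weight γ j χ := by
    rw [weight, weight, comp_strandSwap_of_ne, comp_strandSwap_of_ne, colorCount_comp_strandSwap]
    all_goals first | omega | (simp only [leftPos, rightPos]; omega)
  have h2 (χ : Fin n → C) : weight γ i (χ ∘ strandSwap j) = weight γ i χ := by
    rw [weight, weight, comp_strandSwap_of_ne, comp_strandSwap_of_ne, colorCount_comp_strandSwap]
    all_goals first | omega | (simp only [leftPos, rightPos]; omega)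
  simp only [sigmaMat, mono_mul, hperm, h1, h2]
  congr 1; funext χ
  simp only [weight]
  split_ifs with hi hj
  · rcases eq_or_ne (χ (leftPos i)) (χ (leftPos j)) with hc | hc
    · rw [← hc]
      refine (hγ.hecke _).comm _ _ ?_ (colorCount_lt_of_le hn j χ _)
      have e1 := colorCount_succ χ i.val (by omega) (χ (leftPos i))
      have e2 := colorCount_succ χ (i.val + 1) (by omega) (χ (leftPos i))
      rw [if_pos (show χ ⟨i.val, _⟩ = χ (leftPos i) from rfl)] at e1
      rw [if_pos (show χ ⟨i.val + 1, _⟩ = χ (leftPos i) from hi.symm)] at e2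
      have e3 := colorCount_mono χ (show i.val + 1 + 1 ≤ j.val by omega) (χ (leftPos i))
      omega
    · exact hγ.comm _ _ _ _ hc
  all_goals simp

variable {d : ℕ} [NeZero d]

/-- The representation of the modular framed braid group by monomial matrices indexed by
colorings. -/
noncomputable def framedRep {h : ℂ} {γ : C → ℕ → A} (hγ : IsColoredFamily h N γ) (hn : n ≤ N)
    (col : C → ZMod d) : FramedBraidGroup d n →* (Matrix (Fin n → C) (Fin n → C) A)ˣ :=
  GroupOfRelations.lift (Sum.elim (sigmaUnit hγ hn) (framingUnit A col)) (by
    rintro _ _ (⟨i, j, hij⟩ | ⟨i, j, hij⟩ | ⟨i, j⟩ | ⟨i, j⟩ | ⟨j⟩) <;> ext1 <;>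
      simp only [map_mul, map_pow, map_one, FreeGroup.lift_apply_of, Sum.elim_inl, Sum.elim_inr,
        Units.val_mul, Units.val_pow_eq_pow_val, Units.val_one]
    · rcases hij with hij | hij
      · exact sigmaMat_braid hγ hn i j hij
      · exact (sigmaMat_braid hγ hn j i hij).symm
    · rcases hij with hij | hij
      · exact sigmaMat_comm hγ hn i j hij
      · exact (sigmaMat_comm hγ hn j i hij).symm
    · exact framingMat_mul_framingMat col i j
    · exact framingMat_mul_sigmaMat col γ i j
    · exact framingMat_pow_d col j)

theorem framedRep_sigma {h : ℂ} {γ : C → ℕ → A} (hγ : IsColoredFamily h N γ) (hn : n ≤ N)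
    (col : C → ZMod d) (i : Fin (n - 1)) :
    (framedRep hγ hn col (sigma d n i)).val = sigmaMat γ i := by
  rw [framedRep, sigma, GroupOfRelations.lift_of]; rfl

theorem framedRep_framing {h : ℂ} {γ : C → ℕ → A} (hγ : IsColoredFamily h N γ) (hn : n ≤ N)
    (col : C → ZMod d) (j : Fin n) :
    (framedRep hγ hn col (framing d n j)).val = framingMat A col j := by
  rw [framedRep, framing, GroupOfRelations.lift_of]; rfl

/-- Orthogonality of characters. This makes `e_i` the projection onto the colorings with equal
colors at `i` and `i + 1`. -/
theorem sum_stdAddChar_pow {x y : ZMod d} :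
    (d : ℂ)⁻¹ * ∑ s ∈ Finset.range d, (ZMod.stdAddChar x : ℂ) ^ s * ZMod.stdAddChar y ^ (d - s)
      = if x = y then 1 else 0 := by
  have hd : (d : ℂ) ≠ 0 := by exact_mod_cast NeZero.ne d
  have hy : (ZMod.stdAddChar y : ℂ) ≠ 0 := by
    rw [ZMod.stdAddChar_apply]; exact Circle.coe_ne_zero _
  have hone (x : ZMod d) : (ZMod.stdAddChar x : ℂ) ^ d = 1 := by
    rw [← AddChar.map_nsmul_eq_pow]; simp
  split_ifs with hxy
  · subst hxy
    rw [Finset.sum_congr rfl (g := fun _ => (1 : ℂ)), Finset.sum_const, Finset.card_range,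
      nsmul_eq_mul, mul_one, inv_mul_cancel₀ hd]
    intro s hs
    rw [← pow_add, Nat.add_sub_cancel' (Finset.mem_range.mp hs).le, hone]
  · set r : ℂ := ZMod.stdAddChar x / ZMod.stdAddChar y with hr
    have hr1 : r - 1 ≠ 0 := by
      rw [sub_ne_zero, hr, Ne, div_eq_one_iff_eq hy]
      exact fun h => hxy (ZMod.injective_stdAddChar h)
    have hrd : r ^ d = 1 := by rw [hr, div_pow, hone, hone, div_one]
    have hsum : ∑ s ∈ Finset.range d, r ^ s = 0 := by
      have := geom_sum_mul r d
      rw [hrd, sub_self] at this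
      exact (mul_eq_zero.mp this).resolve_right hr1
    rw [Finset.sum_congr rfl (g := fun s => r ^ s), hsum, mul_zero]
    intro s hs
    rw [hr, div_pow, pow_sub₀ _ hy (Finset.mem_range.mp hs).le, hone, one_mul]; rfl

theorem sum_framingMat {col : C → ZMod d} (hcol : Function.Injective col) (i j : Fin n) :
    (d : ℂ)⁻¹ • ∑ s ∈ Finset.range d, framingMat A col i ^ s * framingMat A col j ^ (d - s)
      = mono 1 fun χ => if χ i = χ j then 1 else 0 := by
  ext χ χ'
  rw [Matrix.smul_apply, Matrix.sum_apply]
  simp only [framingMat, mono_one_pow, mono_mul, one_mul, mono_one_apply, Equiv.Perm.coe_one,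
    Function.comp_id]
  rcases eq_or_ne χ' χ with h1 | h1
  · have := congrArg (algebraMap ℂ A) (sum_stdAddChar_pow (x := col (χ i)) (y := col (χ j)))
    rw [map_mul, map_sum] at this
    simp only [map_mul, map_pow] at this
    simp only [if_pos h1]
    rw [Algebra.smul_def, this]
    simp only [hcol.eq_iff]
    split_ifs <;> simp
  · simp only [if_neg h1, Finset.sum_const_zero, smul_zero]

/-- The representation of the Yokonuma–Hecke algebra by matrices indexed by colorings. -/
noncomputable def colRep {q : ℂ} {γ : C → ℕ → A} (hγ : IsColoredFamily (q - q⁻¹) N γ) (hn : n ≤ N)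
    {col : C → ZMod d} (hcol : Function.Injective col) :
    Y d n q →ₐ[ℂ] Matrix (Fin n → C) (Fin n → C) A :=
  RingQuot.liftAlgHom ℂ ⟨MonoidAlgebra.lift ℂ _ _
    ((Units.coeHom _).comp (framedRep hγ hn col)), by
    rintro _ _ ⟨i⟩
    have he : MonoidAlgebra.lift ℂ _ _ ((Units.coeHom _).comp (framedRep hγ hn col)) (e d n i)
        = mono 1 fun χ => if χ (leftPos i) = χ (rightPos i) then 1 else 0 := by
      rw [← sum_framingMat hcol]
      simp only [e, map_smul, map_sum, MonoidAlgebra.lift_of, MonoidHom.comp_apply, map_mul,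
        map_pow, Units.coeHom_apply, framedRep_framing]
    rw [map_add, map_smul, map_mul, he, map_one, map_pow, MonoidAlgebra.lift_of,
      MonoidHom.comp_apply, Units.coeHom_apply, framedRep_sigma, pow_two, sigmaMat, mono_mul,
      mono_mul, strandSwap_mul_self, one_mul]
    rw [← mono_one]
    ext χ χ'
    rw [Matrix.add_apply, Matrix.smul_apply, mono_one_apply, mono_one_apply, mono_apply]
    by_cases hc : χ (leftPos i) = χ (rightPos i)
    · have hq := (hγ.hecke (χ (leftPos i))).quad _ (colorCount_lt_of_le hn i χ (χ (leftPos i)))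
      have hw : weight γ i χ = γ (χ (leftPos i)) (colorCount χ i.val (χ (leftPos i))) := if_pos hc
      rw [← hw] at hq
      simp only [comp_strandSwap_of_eq hc, hq, Equiv.Perm.coe_one, Function.comp_id, if_pos hc,
        one_mul]
      split_ifs <;> simp
    · have hw : weight γ i χ = 1 := if_neg hc
      have hw' : weight γ i (χ ∘ strandSwap i) = 1 := by
        rw [weight, comp_strandSwap_left, comp_strandSwap_right, if_neg (Ne.symm hc)]
      simp only [hw, hw', if_neg hc, mul_one, zero_mul, ite_self, smul_zero, add_zero]⟩

variable {q : ℂ} {γ : C → ℕ → A} (hγ : IsColoredFamily (q - q⁻¹) N γ) {col : C → ZMod d}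
  (hcol : Function.Injective col)

theorem colRep_proj_of (hn : n ≤ N) (x : FramedBraidGroup d n) :
    colRep hγ hn hcol (proj d n q (MonoidAlgebra.of ℂ _ x)) = (framedRep hγ hn col x).val := by
  refine (RingQuot.liftAlgHom_mkAlgHom_apply ℂ _ _ _).trans ?_
  rw [MonoidAlgebra.lift_of]; rfl

theorem colRep_g (hn : n ≤ N) (i : Fin (n - 1)) : colRep hγ hn hcol (g d n q i) = sigmaMat γ i := by
  rw [g, colRep_proj_of, framedRep_sigma]

theorem colRep_t (hn : n ≤ N) (j : Fin n) :
    colRep hγ hn hcol (t d n q j) = framingMat A col j := by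
  rw [t, colRep_proj_of, framedRep_framing]

end Rep

/-! ### The trace defined by a sum over colorings -/

section Trace

variable {C A P : Type} [Ring A] [Algebra ℂ A] [CommRing P] [Algebra ℂ P]

/-- The subalgebra generated by the `γ c i` that involve only the first `m c` strands of color `c`,
for each `c`. -/
def contentAlg (γ : C → ℕ → A) (m : C → ℕ) : Subalgebra ℂ A :=
  Algebra.adjoin ℂ {x | ∃ c i, i + 1 < m c ∧ x = γ c i}

theorem gen_mem_contentAlg {γ : C → ℕ → A} {m : C → ℕ} {c : C} {i : ℕ} (h : i + 1 < m c) :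
    γ c i ∈ contentAlg γ m :=
  Algebra.subset_adjoin ⟨c, i, h, rfl⟩

/-- A normalized trace on an algebra with a colored family of generators that has the Markov
property, with parameter `z`, separately in each color. -/
structure IsColoredTrace (N : ℕ) (γ : C → ℕ → A) (z : P) (T : A →ₗ[ℂ] P) : Prop where
  one : T 1 = 1
  comm : ∀ a b, T (a * b) = T (b * a)
  markov : ∀ c k, k < N → ∀ m : C → ℕ, m c ≤ k + 1 → ∀ x ∈ contentAlg γ m,
    T (x * γ c k) = z * T x

variable [Fintype C] [DecidableEq C] {n N d : ℕ} [NeZero d] {q : ℂ} {γ : C → ℕ → A}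
  (hγ : IsColoredFamily (q - q⁻¹) N γ) {col : C → ZMod d} (hcol : Function.Injective col)

/-- The entries of the matrices of the representation: they involve only as many strands of each
color as the row has, and vanish unless the row and the column have the same content. -/
theorem colRep_mem (hn : n ≤ N) (a : Y d n q) (χ χ' : Fin n → C) :
    colRep hγ hn hcol a χ χ' ∈ contentAlg γ (colorCount χ n) ∧
      (colRep hγ hn hcol a χ χ' ≠ 0 → colorCount χ' n = colorCount χ n) := by
  have diag (f : (Fin n → C) → ℂ) (χ χ' : Fin n → C) :
      mono 1 (fun χ => algebraMap ℂ A (f χ)) χ χ' ∈ contentAlg γ (colorCount χ n) ∧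
      (mono 1 (fun χ => algebraMap ℂ A (f χ)) χ χ' ≠ 0 → colorCount χ' n = colorCount χ n) := by
    rw [mono_one_apply]
    split_ifs with h
    · exact ⟨Subalgebra.algebraMap_mem _ _, fun _ => by rw [h]⟩
    · exact ⟨Subalgebra.zero_mem _, fun h0 => absurd rfl h0⟩
  induction a using Y_induction generalizing χ χ' with
  | g i =>
    rw [colRep_g, sigmaMat, mono_apply]
    split_ifs with h
    · refine ⟨?_, fun _ => ?_⟩
      · rw [weight]
        split_ifs with hc
        · refine gen_mem_contentAlg ?_
          have e1 := colorCount_succ χ i.val (by omega) (χ (leftPos i))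
          have e2 := colorCount_succ χ (i.val + 1) (by omega) (χ (leftPos i))
          rw [if_pos (show χ ⟨i.val, _⟩ = χ (leftPos i) from rfl)] at e1
          rw [if_pos (show χ ⟨i.val + 1, _⟩ = χ (leftPos i) from hc.symm)] at e2
          have e3 := colorCount_mono χ (show i.val + 1 + 1 ≤ n by omega) (χ (leftPos i))
          omega
        · exact Subalgebra.one_mem _
      · subst h
        funext c
        exact colorCount_comp_strandSwap χ i (Or.inr (by omega)) c
    · exact ⟨Subalgebra.zero_mem _, fun h0 => absurd rfl h0⟩
  | t j =>
    rw [colRep_t, framingMat]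
    exact diag _ χ χ'
  | scalar r =>
    rw [AlgHom.commutes, Algebra.algebraMap_eq_smul_one, ← mono_one, Matrix.smul_apply,
      mono_one_apply]
    split_ifs with h
    · exact ⟨Subalgebra.smul_mem _ (Subalgebra.one_mem _) _, fun _ => by rw [h]⟩
    · rw [smul_zero]
      exact ⟨Subalgebra.zero_mem _, fun h0 => absurd rfl h0⟩
  | add x y hx hy =>
    rw [map_add, Matrix.add_apply]
    refine ⟨Subalgebra.add_mem _ (hx χ χ').1 (hy χ χ').1, fun h => ?_⟩
    by_cases h0 : colRep hγ hn hcol x χ χ' = 0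
    · exact (hy χ χ').2 fun h1 => h (by rw [h0, h1, add_zero])
    · exact (hx χ χ').2 h0
  | mul x y hx hy =>
    rw [map_mul, Matrix.mul_apply]
    refine ⟨Subalgebra.sum_mem _ fun χ'' _ => ?_, fun h => ?_⟩
    · by_cases h0 : colRep hγ hn hcol x χ χ'' = 0
      · rw [h0, zero_mul]; exact Subalgebra.zero_mem _
      · refine Subalgebra.mul_mem _ (hx χ χ'').1 ?_
        rw [← (hx χ χ'').2 h0]
        exact (hy χ'' χ').1
    · obtain ⟨χ'', -, h0⟩ := Finset.exists_ne_zero_of_sum_ne_zero h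
      rw [(hy χ'' χ').2 (right_ne_zero_of_mul h0), (hx χ χ'').2 (left_ne_zero_of_mul h0)]

/-- A coloring of `n + 1` strands is a coloring of the first `n` strands and a color for the last
one. -/
theorem sum_colorings {C M : Type*} [Fintype C] [AddCommMonoid M] {n : ℕ}
    (f : (Fin (n + 1) → C) → M) :
    ∑ χ, f χ = ∑ χ : Fin n → C, ∑ c : C, f (Fin.snoc (α := fun _ => C) χ c) := by
  rw [← (Fin.snocEquiv (fun _ : Fin (n + 1) => C)).sum_comp, Fintype.sum_prod_type,
    Finset.sum_comm]
  rfl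

/-- Coloring an additional strand that is not involved. -/
theorem colRep_incl (hn : n + 1 ≤ N) (a : Y d n q) (χ χ' : Fin (n + 1) → C) :
    colRep hγ hn hcol (incl d n q a) χ χ' = if χ (Fin.last n) = χ' (Fin.last n) then
      colRep hγ (n.le_succ.trans hn) hcol a (Fin.init χ) (Fin.init χ') else 0 := by
  have key (χ χ' : Fin (n + 1) → C) (x : A) : (if χ' = χ then x else 0) =
      if χ (Fin.last n) = χ' (Fin.last n) then if Fin.init χ' = Fin.init χ then x else 0
      else 0 := by
    by_cases h : χ' = χ
    · subst h; simp
    · rw [if_neg h]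
      split_ifs with h1 h2
      · exact absurd (by rw [← Fin.snoc_init_self χ, ← Fin.snoc_init_self χ', h1, h2]) h
      · rfl
      · rfl
  induction a using Y_induction generalizing χ χ' with
  | g i =>
    rw [incl_g, colRep_g, colRep_g, sigmaMat, sigmaMat, mono_apply, mono_apply]
    set i' : Fin (n + 1 - 1) := ⟨i.val, by omega⟩ with hi'
    have h1 : Fin.init (χ ∘ strandSwap i') = Fin.init χ ∘ strandSwap i := by
      funext j
      simp only [Fin.init, Function.comp_apply, strandSwap, Equiv.swap_apply_def, leftPos, rightPos,
        Fin.ext_iff, hi', Fin.val_castSucc]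
      split_ifs <;> rfl
    have h2 : (χ ∘ strandSwap i') (Fin.last n) = χ (Fin.last n) := by
      apply comp_strandSwap_of_ne <;> simp only [Fin.val_last, hi'] <;> omega
    have h3 : weight γ i' χ = weight γ i (Fin.init χ) := by
      rw [weight, weight, colorCount_init χ (by omega)]; rfl
    rw [key]
    simp only [h1, h2, h3]
  | t j =>
    rw [incl_t, colRep_t, colRep_t, framingMat, framingMat, mono_one_apply, mono_one_apply, key]
    rfl
  | scalar r =>
    rw [AlgHom.commutes, AlgHom.commutes, AlgHom.commutes, Algebra.algebraMap_eq_smul_one,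
      Algebra.algebraMap_eq_smul_one, ← mono_one, ← mono_one, Matrix.smul_apply, Matrix.smul_apply,
      mono_one_apply, mono_one_apply, key]
    split_ifs <;> simp
  | add x y hx hy =>
    rw [map_add, map_add, map_add, Matrix.add_apply, Matrix.add_apply, hx, hy]
    split_ifs <;> simp
  | mul x y hx hy =>
    rw [map_mul, map_mul, map_mul, Matrix.mul_apply, Matrix.mul_apply, sum_colorings]
    simp only [hx, hy, Fin.snoc_last, Fin.init_snoc]
    split_ifs with h
    · refine Finset.sum_congr rfl fun χ'' _ => ?_
      rw [Finset.sum_eq_single (χ (Fin.last n))]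
      · simp [h]
      · intro c _ hc
        rw [if_neg hc.symm, zero_mul]
      · simp
    · refine Finset.sum_eq_zero fun χ'' _ => Finset.sum_eq_zero fun c _ => ?_
      by_cases hc : χ (Fin.last n) = c
      · rw [if_neg (fun h' => h (hc.trans h')), mul_zero]
      · rw [if_neg hc, zero_mul]

/-- The sum over all colorings of the diagonal entries of the colored representation, with weight
`κ` for each strand. -/
noncomputable def colTrace (κ : ℂ) (T : A →ₗ[ℂ] P) (hn : n ≤ N) : Y d n q →ₗ[ℂ] P where
  toFun a := κ ^ n • ∑ χ, T (colRep hγ hn hcol a χ χ)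
  map_add' a b := by
    simp only [map_add, Matrix.add_apply, Finset.sum_add_distrib, smul_add]
  map_smul' r a := by
    simp only [map_smul, Matrix.smul_apply, ← Finset.smul_sum, RingHom.id_apply, smul_comm r]

theorem colTrace_apply (κ : ℂ) (T : A →ₗ[ℂ] P) (hn : n ≤ N) (a : Y d n q) :
    colTrace hγ hcol κ T hn a = κ ^ n • ∑ χ, T (colRep hγ hn hcol a χ χ) := rfl

variable {κ : ℂ} {z : P} {T : A →ₗ[ℂ] P}

theorem colTrace_mul_comm (hT : IsColoredTrace N γ z T) (hn : n ≤ N) (a b : Y d n q) :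
    colTrace hγ hcol κ T hn (a * b) = colTrace hγ hcol κ T hn (b * a) := by
  simp only [colTrace_apply, map_mul, Matrix.mul_apply, map_sum]
  rw [Finset.sum_comm]
  simp only [hT.comm]

theorem colTrace_one (hκ : κ * Fintype.card C = 1) (hT : IsColoredTrace N γ z T) (hn : n ≤ N) :
    colTrace hγ hcol κ T hn (1 : Y d n q) = 1 := by
  simp only [colTrace_apply, map_one, Matrix.one_apply_eq, hT.one, Finset.sum_const,
    Finset.card_univ, Fintype.card_fun, Fintype.card_fin]
  rw [← Nat.cast_smul_eq_nsmul ℂ, smul_smul, Nat.cast_pow, ← mul_pow, hκ, one_pow, one_smul]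

theorem colTrace_incl_mul_t_pow (hn : n + 1 ≤ N) (a : Y d n q) (k : ℕ) :
    colTrace hγ hcol κ T hn (incl d n q a * t d (n + 1) q (Fin.last n) ^ k)
      = (κ * ∑ c, ZMod.stdAddChar ((k : ZMod d) * col c)) •
        colTrace hγ hcol κ T (n.le_succ.trans hn) a := by
  have h1 (χ : Fin (n + 1) → C) : colRep hγ hn hcol
      (incl d n q a * t d (n + 1) q (Fin.last n) ^ k) χ χ
      = (ZMod.stdAddChar ((k : ZMod d) * col (χ (Fin.last n))) : ℂ) •
        colRep hγ (n.le_succ.trans hn) hcol a (Fin.init χ) (Fin.init χ) := by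
    rw [map_mul, map_pow, colRep_t, framingMat_pow, mul_mono_apply]
    change colRep hγ hn hcol (incl d n q a) χ χ * algebraMap ℂ A _ = _
    rw [colRep_incl, if_pos rfl, Algebra.smul_def, Algebra.commutes]
    rfl
  simp only [colTrace_apply, h1, map_smul]
  rw [sum_colorings]
  simp only [Fin.snoc_last, Fin.init_snoc, ← Finset.sum_smul]
  rw [← Finset.smul_sum, smul_smul, smul_smul, pow_succ]
  congr 1
  ring

theorem colTrace_incl (hκ : κ * Fintype.card C = 1) (hn : n + 1 ≤ N) (a : Y d n q) :
    colTrace hγ hcol κ T hn (incl d n q a) = colTrace hγ hcol κ T (n.le_succ.trans hn) a := by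
  have h := colTrace_incl_mul_t_pow hγ hcol (κ := κ) (T := T) hn a 0
  simpa [hκ] using h

theorem colTrace_incl_mul_g (hT : IsColoredTrace N γ z T) (hn : n + 2 ≤ N) (a : Y d (n + 1) q) :
    colTrace hγ hcol κ T hn (incl d (n + 1) q a * g d (n + 2) q (Fin.last n))
      = κ • (z * colTrace hγ hcol κ T ((n + 1).le_succ.trans hn) a) := by
  have h1 (χ : Fin (n + 2) → C) : T (colRep hγ hn hcol
      (incl d (n + 1) q a * g d (n + 2) q (Fin.last n)) χ χ)
      = if χ (Fin.last n).castSucc = χ (Fin.last (n + 1)) then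
        z * T (colRep hγ ((n + 1).le_succ.trans hn) hcol a (Fin.init χ) (Fin.init χ)) else 0 := by
    have hl : leftPos (n := n + 2) (Fin.last n) = (Fin.last n).castSucc := rfl
    have hr : rightPos (n := n + 2) (Fin.last n) = Fin.last (n + 1) := rfl
    have hs : (strandSwap (n := n + 2) (Fin.last n)).symm = strandSwap (n := n + 2) (Fin.last n) :=
      Equiv.symm_swap _ _
    rw [map_mul, colRep_g, sigmaMat, mul_mono_apply, hs, colRep_incl]
    have h2 : (χ ∘ strandSwap (n := n + 2) (Fin.last n)) (Fin.last (n + 1))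
        = χ (Fin.last n).castSucc := by rw [← hr, comp_strandSwap_right, hl]
    rw [h2]
    by_cases hc : χ (Fin.last n).castSucc = χ (Fin.last (n + 1))
    · have h3 : χ (leftPos (n := n + 2) (Fin.last n)) = χ (rightPos (n := n + 2) (Fin.last n)) := hc
      rw [if_pos hc, if_pos hc.symm, comp_strandSwap_of_eq h3, weight, if_pos h3]
      refine hT.markov _ _ (colorCount_lt_of_le hn _ χ _) (colorCount (Fin.init χ) (n + 1)) ?_ _
        (colRep_mem hγ hcol _ a _ _).1
      rw [colorCount_init χ le_rfl, colorCount_succ χ n (by omega)]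
      refine Nat.add_le_add le_rfl ?_
      split_ifs <;> simp
    · rw [if_neg hc, if_neg (Ne.symm hc), zero_mul, map_zero]
  simp only [colTrace_apply, h1]
  rw [sum_colorings]
  have h2 (χ : Fin (n + 1) → C) (c : C) :
      (Fin.snoc (α := fun _ => C) χ c : Fin (n + 2) → C) (Fin.last n).castSucc = χ (Fin.last n) :=
    Fin.snoc_castSucc (α := fun _ => C) c χ (Fin.last n)
  simp only [Fin.snoc_last, Fin.init_snoc, h2, Finset.sum_ite_eq, Finset.mem_univ, if_true]
  rw [← Finset.mul_sum, mul_smul_comm, smul_smul, pow_succ' κ (n + 1)]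

/-- The trace does not depend on the algebra of coefficients. -/
theorem colTrace_congr {A' : Type} [Ring A'] [Algebra ℂ A'] {γ' : C → ℕ → A'} {N' : ℕ}
    (hγ' : IsColoredFamily (q - q⁻¹) N' γ') {T' : A' →ₗ[ℂ] P} (F : A →ₐ[ℂ] A')
    (hF : ∀ c i, i < N → F (γ c i) = γ' c i) (hTF : ∀ a, T' (F a) = T a) (hn : n ≤ N)
    (hn' : n ≤ N') (a : Y d n q) :
    colTrace hγ' hcol κ T' hn' a = colTrace hγ hcol κ T hn a := by
  have key : colRep hγ' hn' hcol = (F.mapMatrix).comp (colRep hγ hn hcol) := by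
    refine AlgHom.ext_of_adjoin_eq_top (adjoin_g_t d n q) ?_
    rintro _ (⟨i, rfl⟩ | ⟨j, rfl⟩)
    · rw [AlgHom.comp_apply, colRep_g, colRep_g]
      ext χ χ'
      rw [AlgHom.mapMatrix_apply, Matrix.map_apply, sigmaMat, sigmaMat, mono_apply, mono_apply,
        weight, weight]
      split_ifs <;> simp [hF _ _ (colorCount_lt_of_le hn i χ _)]
    · rw [AlgHom.comp_apply, colRep_t, colRep_t]
      ext χ χ'
      rw [AlgHom.mapMatrix_apply, Matrix.map_apply, framingMat, framingMat, mono_apply, mono_apply]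
      split_ifs <;> simp
  simp only [colTrace_apply, key, AlgHom.comp_apply, AlgHom.mapMatrix_apply, Matrix.map_apply, hTF]

end Trace

/-! ### The tensor power of a Hecke algebra, with one factor for each color -/

/-- The tensor product over `ℂ[X]`, with one factor for each color, of Hecke algebras of type
`A_N`. -/
def ColAlg (C : Type) (h : ℂ) (N : ℕ) : Type :=
  ⨂[ℂ[X]] _ : C, Hecke (Polynomial.C h) N

namespace ColAlg

variable {C : Type} {h : ℂ} {N N' : ℕ}

noncomputable instance : Ring (ColAlg C h N) :=
  inferInstanceAs (Ring (⨂[ℂ[X]] _ : C, Hecke (Polynomial.C h) N))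

noncomputable instance : Algebra ℂ[X] (ColAlg C h N) :=
  inferInstanceAs (Algebra ℂ[X] (⨂[ℂ[X]] _ : C, Hecke (Polynomial.C h) N))

noncomputable instance : Algebra ℂ (ColAlg C h N) :=
  Algebra.compHom (ColAlg C h N) (algebraMap ℂ ℂ[X])

theorem C_smul (r : ℂ) (x : ColAlg C h N) : Polynomial.C r • x = r • x := rfl

instance : IsScalarTower ℂ ℂ[X] (ColAlg C h N) :=
  IsScalarTower.of_algebraMap_eq fun _ => rfl

/-- The pure tensors. -/
noncomputable def pure (h : ℂ) (N : ℕ) :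
    MultilinearMap ℂ[X] (fun _ : C => Hecke (Polynomial.C h) N) (ColAlg C h N) :=
  PiTensorProduct.tprod ℂ[X]

theorem pure_mul_pure (f f' : C → Hecke (Polynomial.C h) N) :
    pure h N f * pure h N f' = pure h N (f * f') :=
  PiTensorProduct.tprod_mul_tprod f f'

theorem pure_one : pure h N (1 : C → Hecke (Polynomial.C h) N) = 1 := rfl

theorem span_pure : Submodule.span ℂ[X] (Set.range (pure (C := C) h N)) = ⊤ :=
  PiTensorProduct.span_tprod_eq_top

/-- The linear map on the tensor product given by a multilinear map. -/
noncomputable def lift {M : Type} [AddCommGroup M] [Module ℂ[X] M]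
    (f : MultilinearMap ℂ[X] (fun _ : C => Hecke (Polynomial.C h) N) M) :
    ColAlg C h N →ₗ[ℂ[X]] M :=
  PiTensorProduct.lift f

theorem lift_pure {M : Type} [AddCommGroup M] [Module ℂ[X] M]
    (f : MultilinearMap ℂ[X] (fun _ : C => Hecke (Polynomial.C h) N) M)
    (x : C → Hecke (Polynomial.C h) N) : lift f (pure h N x) = f x :=
  PiTensorProduct.lift.tprod x

theorem induction {p : ColAlg C h N → Prop} (pure : ∀ f, p (pure h N f))
    (add : ∀ x y, p x → p y → p (x + y)) (smul : ∀ (r : ℂ[X]) x, p x → p (r • x))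
    (x : ColAlg C h N) : p x := by
  have hx : x ∈ Submodule.span ℂ[X] (Set.range (ColAlg.pure (C := C) h N)) :=
    span_pure ▸ Submodule.mem_top
  induction hx using Submodule.span_induction with
  | mem x hx => obtain ⟨f, rfl⟩ := hx; exact pure f
  | zero => simpa using smul 0 _ (pure 1)
  | add x y _ _ hx hy => exact add x y hx hy
  | smul r x _ hx => exact smul r x hx

/-- The map of tensor products induced by the inclusion of Hecke algebras. -/
noncomputable def map (hN : N ≤ N') : ColAlg C h N →ₐ[ℂ[X]] ColAlg C h N' :=
  PiTensorProduct.liftAlgHom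
    ((pure h N').compLinearMap fun _ => (Hecke.map (Polynomial.C h) hN).toLinearMap)
    (by
      rw [MultilinearMap.compLinearMap_apply, ← pure_one]
      congr 1; funext c; simp)
    (by
      intro x y
      rw [MultilinearMap.compLinearMap_apply, MultilinearMap.compLinearMap_apply,
        MultilinearMap.compLinearMap_apply, pure_mul_pure]
      congr 1; funext c; simp)

theorem map_pure (hN : N ≤ N') (f : C → Hecke (Polynomial.C h) N) :
    map hN (pure h N f) = pure h N' fun c => Hecke.map (Polynomial.C h) hN (f c) :=
  PiTensorProduct.lift.tprod f

section Factors

variable [DecidableEq C]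

/-- The inclusion of the tensor factor of the color `c`. -/
noncomputable def single (c : C) : Hecke (Polynomial.C h) N →ₐ[ℂ[X]] ColAlg C h N :=
  PiTensorProduct.singleAlgHom (R := ℂ[X]) (A := fun _ : C => Hecke (Polynomial.C h) N) c

theorem single_apply (c : C) (x : Hecke (Polynomial.C h) N) :
    single c x = pure h N (Pi.mulSingle c x) := rfl

/-- The generators of the tensor factor of the color `c`. -/
noncomputable def gen (h : ℂ) (N : ℕ) (c : C) (i : ℕ) : ColAlg C h N :=
  single c (Hecke.gen (Polynomial.C h) N i)

theorem isColoredFamily_gen : IsColoredFamily h N (gen (C := C) h N) where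
  hecke c :=
    { quad := fun i hi => by
        rw [gen, ← map_mul, (Hecke.isHeckeFamily_gen _ N).quad i hi, map_add, map_one, map_smul]
        rfl
      braid := fun i hi => by
        simp only [gen, ← map_mul, (Hecke.isHeckeFamily_gen _ N).braid i hi]
      comm := fun i j hij hj => by
        simp only [gen, ← map_mul, (Hecke.isHeckeFamily_gen _ N).comm i j hij hj] }
  comm c c' i j hcc' := by
    rw [gen, gen, single_apply, single_apply, pure_mul_pure, pure_mul_pure,
      (Pi.mulSingle_commute hcc' _ _).eq]

theorem map_gen (hN : N ≤ N') (c : C) {i : ℕ} (hi : i < N) :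
    map hN (gen h N c i) = gen h N' c i := by
  rw [gen, gen, single_apply, single_apply, map_pure]
  congr 1; funext c'
  rcases eq_or_ne c' c with rfl | hc
  · simp [Hecke.map_gen hN hi]
  · simp [hc]

/-- The span of the pure tensors whose component of color `c` involves the first `m c` strands
only. -/
noncomputable def contentSpan (h : ℂ) (N : ℕ) (m : C → ℕ) : Submodule ℂ[X] (ColAlg C h N) :=
  Submodule.span ℂ[X] {x | ∃ f : C → Hecke (Polynomial.C h) N, (∀ c, f c ∈
    Algebra.adjoin ℂ[X] {y | ∃ i, i + 1 < m c ∧ y = Hecke.gen (Polynomial.C h) N i}) ∧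
    x = pure h N f}

theorem contentAlg_le (m : C → ℕ) {x : ColAlg C h N} (hx : x ∈ contentAlg (gen h N) m) :
    x ∈ contentSpan h N m := by
  have hmul : contentSpan h N m * contentSpan h N m ≤ contentSpan h N m := by
    rw [contentSpan, Submodule.span_mul_span, Submodule.span_le]
    rintro _ ⟨_, ⟨f, hf, rfl⟩, _, ⟨f', hf', rfl⟩, rfl⟩
    exact Submodule.subset_span ⟨f * f', fun c => mul_mem (hf c) (hf' c), pure_mul_pure f f'⟩
  have hone : (1 : ColAlg C h N) ∈ contentSpan h N m :=
    Submodule.subset_span ⟨1, fun c => one_mem _, rfl⟩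
  induction hx using Algebra.adjoin_induction with
  | mem x hx =>
    obtain ⟨c, i, hi, rfl⟩ := hx
    refine Submodule.subset_span ⟨_, fun c' => ?_, rfl⟩
    rcases eq_or_ne c' c with rfl | hc
    · exact Algebra.subset_adjoin ⟨i, hi, by simp⟩
    · simp [hc]
  | algebraMap r =>
    rw [Algebra.algebraMap_eq_smul_one, ← C_smul]
    exact Submodule.smul_mem _ _ hone
  | add x y _ _ hx hy => exact add_mem hx hy
  | mul x y _ _ hx hy => exact hmul (Submodule.mul_mem_mul hx hy)

end Factors

variable [Fintype C]

/-- The product of the Ocneanu traces of the tensor factors. -/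
noncomputable def prodTrace (C : Type) [Fintype C] (h : ℂ) (N : ℕ) : ColAlg C h N →ₗ[ℂ[X]] ℂ[X] :=
  lift ((MultilinearMap.mkPiAlgebra ℂ[X] C ℂ[X]).compLinearMap
    fun _ => Hecke.ocneanu (Polynomial.C h) Polynomial.X N)

theorem prodTrace_pure (f : C → Hecke (Polynomial.C h) N) : prodTrace C h N (pure h N f)
    = ∏ c, Hecke.ocneanu (Polynomial.C h) Polynomial.X N (f c) := by
  rw [prodTrace, lift_pure]; rfl

theorem prodTrace_one : prodTrace C h N 1 = 1 := by
  simp [← pure_one, prodTrace_pure, Hecke.ocneanu_one]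

theorem prodTrace_mul_comm (a b : ColAlg C h N) :
    prodTrace C h N (a * b) = prodTrace C h N (b * a) := by
  induction a using induction with
  | pure f =>
    induction b using induction with
    | pure f' =>
      rw [pure_mul_pure, pure_mul_pure, prodTrace_pure, prodTrace_pure]
      exact Finset.prod_congr rfl fun c _ => Hecke.ocneanu_mul_comm _ _ _
    | add x y hx hy => rw [mul_add, add_mul, _root_.map_add, _root_.map_add, hx, hy]
    | smul r x hx => rw [mul_smul_comm, smul_mul_assoc, _root_.map_smul, _root_.map_smul, hx]
  | add x y hx hy => rw [mul_add, add_mul, _root_.map_add, _root_.map_add, hx, hy]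
  | smul r x hx => rw [mul_smul_comm, smul_mul_assoc, _root_.map_smul, _root_.map_smul, hx]

theorem prodTrace_map (hN : N ≤ N') (a : ColAlg C h N) :
    prodTrace C h N' (map hN a) = prodTrace C h N a := by
  induction a using induction with
  | pure f => simp only [map_pure, prodTrace_pure, Hecke.ocneanu_map]
  | add x y hx hy => simp only [_root_.map_add, hx, hy]
  | smul r x hx => simp only [_root_.map_smul, hx]

/-- The product of the Ocneanu traces after the substitution of `z` for the variable. -/
noncomputable def evalTrace (C : Type) [Fintype C] (h : ℂ) (N : ℕ) (z : ℂ[X]) :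
    ColAlg C h N →ₗ[ℂ] ℂ[X] :=
  (Polynomial.aeval z).toLinearMap ∘ₗ (prodTrace C h N).restrictScalars ℂ

theorem evalTrace_apply (z : ℂ[X]) (x : ColAlg C h N) :
    evalTrace C h N z x = Polynomial.aeval z (prodTrace C h N x) := rfl

variable [DecidableEq C]

theorem prodTrace_single (c : C) (x : Hecke (Polynomial.C h) N) :
    prodTrace C h N (single c x) = Hecke.ocneanu (Polynomial.C h) Polynomial.X N x := by
  rw [single_apply, prodTrace_pure, Finset.prod_eq_single c]
  · simp
  · intro c' _ hc
    simp [hc, Hecke.ocneanu_one]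
  · simp

theorem prodTrace_mul_gen (c : C) {k : ℕ} (hk : k < N) {m : C → ℕ} (hm : m c ≤ k + 1)
    {x : ColAlg C h N} (hx : x ∈ contentAlg (gen h N) m) :
    prodTrace C h N (x * gen h N c k) = Polynomial.X * prodTrace C h N x := by
  replace hx := contentAlg_le m hx
  induction hx using Submodule.span_induction with
  | mem x hx =>
    obtain ⟨f, hf, rfl⟩ := hx
    have h1 (c' : C) : Hecke.ocneanu (Polynomial.C h) Polynomial.X N
        (f c' * Pi.mulSingle (M := fun _ => Hecke (Polynomial.C h) N) c
          (Hecke.gen (Polynomial.C h) N k) c')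
        = (if c' = c then Polynomial.X else 1) *
          Hecke.ocneanu (Polynomial.C h) Polynomial.X N (f c') := by
      split_ifs with hc
      · subst hc
        rw [Pi.mulSingle_eq_same]
        refine Hecke.ocneanu_mul_gen _ hk (Algebra.adjoin_mono ?_ (hf c'))
        rintro _ ⟨i, hi, rfl⟩
        exact ⟨i, by omega, rfl⟩
      · simp [hc]
    rw [gen, single_apply, pure_mul_pure, prodTrace_pure, prodTrace_pure]
    simp only [Pi.mul_apply, h1, Finset.prod_mul_distrib, Finset.prod_ite_eq', Finset.mem_univ,
      if_true]
  | zero => simp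
  | add x y _ _ hx hy => simp only [add_mul, _root_.map_add, hx, hy, mul_add]
  | smul r x _ hx => rw [smul_mul_assoc, _root_.map_smul, _root_.map_smul, hx, mul_smul_comm]

theorem isColoredTrace_evalTrace (z : ℂ[X]) :
    IsColoredTrace N (gen h N) z (evalTrace C h N z) where
  one := by rw [evalTrace_apply, prodTrace_one, map_one]
  comm a b := by rw [evalTrace_apply, evalTrace_apply, prodTrace_mul_comm]
  markov c k hk m hm x hx := by
    rw [evalTrace_apply, evalTrace_apply, prodTrace_mul_gen c hk hm hx, map_mul,
      Polynomial.aeval_X]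

end ColAlg

/-! ### Existence of the specialized trace -/

section Existence

variable {d : ℕ} [NeZero d]

/-- The trace given by the sum over all colorings of the strands by elements of `D`. -/
noncomputable def stateSum (D : Finset (ZMod d)) (q : ℂ) (n : ℕ) : Y d n q →ₗ[ℂ] ℂ[X] :=
  colTrace (C := {m // m ∈ D}) (ColAlg.isColoredFamily_gen (N := n)) Subtype.val_injective (E D)
    (ColAlg.evalTrace _ _ n (Polynomial.C (D.card : ℂ) * Polynomial.X)) le_rfl

/-- Hecke algebras on more strands than necessary may serve as coefficients, which allows the traces
for different numbers of strands to be compared. -/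
theorem stateSum_eq (D : Finset (ZMod d)) (q : ℂ) {n N : ℕ} (hn : n ≤ N) (a : Y d n q) :
    stateSum D q n a = colTrace (C := {m // m ∈ D}) (ColAlg.isColoredFamily_gen (N := N))
      Subtype.val_injective (E D)
      (ColAlg.evalTrace _ _ N (Polynomial.C (D.card : ℂ) * Polynomial.X)) hn a := by
  refine (colTrace_congr _ _ _ ((ColAlg.map hn).restrictScalars ℂ) ?_ ?_ _ _ a).symm
  · intro c i hi
    exact ColAlg.map_gen hn c hi
  · intro x
    rw [ColAlg.evalTrace_apply, ColAlg.evalTrace_apply]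
    congr 1
    exact ColAlg.prodTrace_map hn x

theorem isSpecializedTrace_stateSum {D : Finset (ZMod d)} (hD : D.Nonempty) (q : ℂ) :
    IsSpecializedTrace d D q (stateSum D q) := by
  have hcard : (D.card : ℂ) ≠ 0 := by exact_mod_cast hD.card_pos.ne'
  have hκ : E D * Fintype.card {m // m ∈ D} = 1 := by
    rw [E, Fintype.card_coe, inv_mul_cancel₀ hcard]
  refine ⟨fun n a => ?_, fun n a b => ?_, fun n => ?_, fun n a => ?_, fun n a k _ _ => ?_⟩
  · rw [stateSum_eq D q le_rfl, stateSum_eq D q n.le_succ, colTrace_incl _ _ hκ]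
  · rw [stateSum_eq D q le_rfl, stateSum_eq D q le_rfl,
      colTrace_mul_comm _ _ (ColAlg.isColoredTrace_evalTrace _)]
  · rw [stateSum_eq D q le_rfl, colTrace_one _ _ hκ (ColAlg.isColoredTrace_evalTrace _)]
  · rw [stateSum_eq D q le_rfl, stateSum_eq D q (n + 1).le_succ,
      colTrace_incl_mul_g _ _ (ColAlg.isColoredTrace_evalTrace _), mul_assoc,
      ← Polynomial.smul_eq_C_mul, smul_smul, E, inv_mul_cancel₀ hcard, one_smul]
  · rw [stateSum_eq D q le_rfl, stateSum_eq D q n.le_succ, colTrace_incl_mul_t_pow]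
    congr 1
    rw [solX, E, Finset.sum_coe_sort D fun m => (ZMod.stdAddChar ((k : ZMod d) * m) : ℂ)]
    simp only [mul_comm]

end Existence

/-! ### Uniqueness of the specialized trace -/

section Uniqueness

variable {d n : ℕ} {q : ℂ}

/-- A power of the left framing generator passes a braiding generator and becomes the right one. -/
theorem t_left_pow_mul_g (i : Fin (n - 1)) (k : ℕ) :
    t d n q (leftPos i) ^ k * g d n q i = g d n q i * t d n q (rightPos i) ^ k := by
  have h := t_mul_g (d := d) (q := q) i (leftPos i)
  rw [Equiv.swap_apply_left] at h
  exact (SemiconjBy.pow_right (show SemiconjBy (g d n q i) (t d n q (rightPos i))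
    (t d n q (leftPos i)) from h.symm) k).eq.symm

theorem t_right_pow_mul_g (i : Fin (n - 1)) (k : ℕ) :
    t d n q (rightPos i) ^ k * g d n q i = g d n q i * t d n q (leftPos i) ^ k := by
  have h := t_mul_g (d := d) (q := q) i (rightPos i)
  rw [Equiv.swap_apply_right] at h
  exact (SemiconjBy.pow_right (show SemiconjBy (g d n q i) (t d n q (leftPos i))
    (t d n q (rightPos i)) from h.symm) k).eq.symm

/-- The span in `Y_{d,n+1}` of the elements `a t_{n+1}^k` and `a g_n b`, with `a` and `b` from
`Y_{d,n}`. The index `i` of the generator `g_n` exists only for `n ≠ 0`. -/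
noncomputable def reducedY (d n : ℕ) (q : ℂ) : Submodule ℂ (Y d (n + 1) q) :=
  Submodule.span ℂ ({x | ∃ a k, x = incl d n q a * t d (n + 1) q (Fin.last n) ^ k} ∪
    {x | ∃ a b, ∃ i : Fin (n + 1 - 1), i.val + 1 = n ∧
      x = incl d n q a * g d (n + 1) q i * incl d n q b})

theorem incl_mul_t_pow_mem (a : Y d n q) (k : ℕ) :
    incl d n q a * t d (n + 1) q (Fin.last n) ^ k ∈ reducedY d n q :=
  Submodule.subset_span (Or.inl ⟨a, k, rfl⟩)

theorem incl_mul_g_mul_incl_mem (a b : Y d n q) (i : Fin (n + 1 - 1)) (hi : i.val + 1 = n) :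
    incl d n q a * g d (n + 1) q i * incl d n q b ∈ reducedY d n q :=
  Submodule.subset_span (Or.inr ⟨a, b, i, hi, rfl⟩)

theorem reducedY_induction {p : (x : Y d (n + 1) q) → x ∈ reducedY d n q → Prop}
    (framing : ∀ a k, p _ (incl_mul_t_pow_mem a k))
    (braiding : ∀ a b i hi, p _ (incl_mul_g_mul_incl_mem a b i hi))
    (add : ∀ x y hx hy, p x hx → p y hy → p (x + y) (add_mem hx hy))
    (smul : ∀ (r : ℂ) x hx, p x hx → p (r • x) (Submodule.smul_mem _ r hx))
    {x : Y d (n + 1) q} (hx : x ∈ reducedY d n q) : p x hx := by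
  induction hx using Submodule.span_induction with
  | mem x hx =>
    rcases hx with ⟨a, k, rfl⟩ | ⟨a, b, i, hi, rfl⟩
    · exact framing a k
    · exact braiding a b i hi
  | zero => simpa using smul 0 _ _ (framing 0 0)
  | add x y _ _ hx hy => exact add x y _ _ hx hy
  | smul r x _ hx => exact smul r x _ hx

theorem incl_mul_mem_reducedY (b : Y d n q) {x : Y d (n + 1) q} (hx : x ∈ reducedY d n q) :
    incl d n q b * x ∈ reducedY d n q := by
  induction hx using reducedY_induction with
  | framing a k => rw [← mul_assoc, ← map_mul]; exact incl_mul_t_pow_mem _ _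
  | braiding a c i hi =>
    rw [← mul_assoc, ← mul_assoc, ← map_mul]; exact incl_mul_g_mul_incl_mem _ _ i hi
  | add x y _ _ hx hy => rw [mul_add]; exact add_mem hx hy
  | smul r x _ hx => rw [mul_smul_comm]; exact Submodule.smul_mem _ r hx

/-- The left framing generator of the last braiding generator comes from fewer strands. -/
theorem t_left_eq_incl (i : Fin (n + 1 - 1)) :
    t d (n + 1) q (leftPos i) = incl d n q (t d n q ⟨i.val, i.isLt⟩) := by
  rw [incl_t]; rfl

theorem rightPos_eq_last (i : Fin (n + 1 - 1)) (hi : i.val + 1 = n) : rightPos i = Fin.last n :=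
  Fin.ext hi

/-- A sandwich by the last generator of a power of the framing of the strand before the last. -/
theorem g_mul_t_pow_mul_g_mem (i : Fin (n + 1 - 1)) (hi : i.val + 1 = n) (k : ℕ) :
    g d (n + 1) q i * t d (n + 1) q (leftPos i) ^ k * g d (n + 1) q i ∈ reducedY d n q := by
  rw [mul_assoc, t_left_pow_mul_g, ← mul_assoc, g_mul_g, add_mul, one_mul, smul_mul_assoc, proj_e,
    smul_mul_assoc, smul_mul_assoc, Finset.sum_mul, Finset.sum_mul]
  refine add_mem ?_ (Submodule.smul_mem _ _ (Submodule.smul_mem _ _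
    (Submodule.sum_mem _ fun s _ => ?_)))
  · rw [rightPos_eq_last i hi]
    have := incl_mul_t_pow_mem (d := d) (n := n) (q := q) 1 k
    rwa [map_one, one_mul] at this
  · have h1 : t d (n + 1) q (leftPos i) ^ s * t d (n + 1) q (rightPos i) ^ (d - s) *
        g d (n + 1) q i * t d (n + 1) q (rightPos i) ^ k
        = t d (n + 1) q (leftPos i) ^ s * g d (n + 1) q i *
          (t d (n + 1) q (leftPos i) ^ (d - s)) * t d (n + 1) q (rightPos i) ^ k := by
      simp only [mul_assoc]
      rw [← mul_assoc (t d (n + 1) q (rightPos i) ^ (d - s)), t_right_pow_mul_g, mul_assoc]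
    have h2 : t d (n + 1) q (leftPos i) ^ (d - s) * t d (n + 1) q (rightPos i) ^ k
        = t d (n + 1) q (rightPos i) ^ k * t d (n + 1) q (leftPos i) ^ (d - s) :=
      (Commute.pow_pow (t_comm _ _) _ _).eq
    rw [h1, mul_assoc, h2, ← mul_assoc, mul_assoc _ (g d (n + 1) q i), ← t_left_pow_mul_g,
      ← mul_assoc, ← pow_add, t_left_eq_incl, ← map_pow, ← map_pow]
    exact incl_mul_g_mul_incl_mem _ _ i hi

variable [NeZero d]

theorem t_last_mul_incl (a : Y d n q) :
    t d (n + 1) q (Fin.last n) * incl d n q a = incl d n q a * t d (n + 1) q (Fin.last n) := by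
  induction a using Y_induction with
  | g i =>
    rw [incl_g, t_mul_g]
    congr 2
    exact strandSwap_of_ne (by simp only [Fin.val_last]; omega) (by simp only [Fin.val_last]; omega)
  | t j => rw [incl_t, t_comm]
  | scalar r => rw [AlgHom.commutes, Algebra.commutes]
  | add x y hx hy => rw [map_add, mul_add, add_mul, hx, hy]
  | mul x y hx hy => rw [map_mul, ← mul_assoc, hx, mul_assoc, hy, mul_assoc]

theorem t_last_pow_mul_incl (a : Y d n q) (k : ℕ) :
    t d (n + 1) q (Fin.last n) ^ k * incl d n q a
      = incl d n q a * t d (n + 1) q (Fin.last n) ^ k :=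
  (Commute.pow_left (t_last_mul_incl a) k).eq

theorem g_last_mul_incl_incl (i : Fin (n + 1 + 1 - 1)) (hi : i.val = n) (a : Y d n q) :
    g d (n + 1 + 1) q i * incl d (n + 1) q (incl d n q a)
      = incl d (n + 1) q (incl d n q a) * g d (n + 1 + 1) q i := by
  induction a using Y_induction with
  | g j => rw [incl_g, incl_g]; exact g_comm _ _ (Or.inr (by simp only; omega))
  | t j =>
    rw [incl_t, incl_t, t_mul_g]
    congr 2
    exact (strandSwap_of_ne (by simp only [Fin.val_castSucc]; omega)
      (by simp only [Fin.val_castSucc]; omega)).symm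
  | scalar r => rw [AlgHom.commutes, AlgHom.commutes, Algebra.commutes]
  | add x y hx hy => rw [map_add, map_add, mul_add, add_mul, hx, hy]
  | mul x y hx hy => rw [map_mul, map_mul, ← mul_assoc, hx, mul_assoc, hy, mul_assoc]

theorem mul_incl_mem_reducedY (b : Y d n q) {x : Y d (n + 1) q} (hx : x ∈ reducedY d n q) :
    x * incl d n q b ∈ reducedY d n q := by
  induction hx using reducedY_induction with
  | framing a k =>
    rw [mul_assoc, t_last_pow_mul_incl, ← mul_assoc, ← map_mul]; exact incl_mul_t_pow_mem _ _
  | braiding a c i hi => rw [mul_assoc, ← map_mul]; exact incl_mul_g_mul_incl_mem _ _ i hi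
  | add x y _ _ hx hy => rw [add_mul]; exact add_mem hx hy
  | smul r x _ hx => rw [smul_mul_assoc]; exact Submodule.smul_mem _ r hx

/-- The span is everything as soon as sandwiching by the last generator preserves it. -/
theorem reducedY_eq_top_of
    (key : ∀ (i : Fin (n + 1 - 1)), i.val + 1 = n → ∀ a : Y d n q,
      g d (n + 1) q i * incl d n q a * g d (n + 1) q i ∈ reducedY d n q) :
    reducedY d n q = ⊤ := by
  have hmul (b : Y d (n + 1) q) : ∀ x ∈ reducedY d n q, b * x ∈ reducedY d n q := by
    induction b using Y_induction with
    | g i =>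
      intro x hx
      rcases eq_or_ne (i.val + 1) n with hi | hi
      · have hr := rightPos_eq_last i hi
        induction hx using reducedY_induction with
        | framing a k =>
          rw [← t_last_pow_mul_incl, ← mul_assoc, ← hr, ← t_left_pow_mul_g, t_left_eq_incl,
            ← map_pow]
          exact incl_mul_g_mul_incl_mem _ _ i hi
        | braiding a b j hj =>
          obtain rfl : j = i := Fin.ext (by omega)
          rw [← mul_assoc, ← mul_assoc]
          exact mul_incl_mem_reducedY _ (key j hj a)
        | add x y _ _ hx hy => rw [mul_add]; exact add_mem hx hy
        | smul r x _ hx => rw [mul_smul_comm]; exact Submodule.smul_mem _ r hx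
      · have h1 : g d (n + 1) q i = incl d n q (g d n q ⟨i.val, by omega⟩) := by rw [incl_g]
        rw [h1]
        exact incl_mul_mem_reducedY _ hx
    | t j =>
      intro x hx
      induction j using Fin.lastCases with
      | cast j => rw [← incl_t]; exact incl_mul_mem_reducedY _ hx
      | last =>
        induction hx using reducedY_induction with
        | framing a k =>
          rw [← mul_assoc, t_last_mul_incl, mul_assoc, ← pow_succ']
          exact incl_mul_t_pow_mem _ _
        | braiding a b i hi =>
          have h1 := t_right_pow_mul_g (d := d) (q := q) i 1
          rw [pow_one, pow_one, rightPos_eq_last i hi, t_left_eq_incl] at h1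
          rw [← mul_assoc, ← mul_assoc, t_last_mul_incl, mul_assoc (incl d n q a), h1, mul_assoc,
            mul_assoc, ← map_mul, ← mul_assoc]
          exact incl_mul_g_mul_incl_mem _ _ i hi
        | add x y _ _ hx hy => rw [mul_add]; exact add_mem hx hy
        | smul r x _ hx => rw [mul_smul_comm]; exact Submodule.smul_mem _ r hx
    | scalar r =>
      intro x hx
      rw [← Algebra.smul_def]; exact Submodule.smul_mem _ r hx
    | add x y hx hy =>
      intro z hz
      rw [add_mul]; exact add_mem (hx z hz) (hy z hz)
    | mul x y hx hy =>
      intro z hz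
      rw [mul_assoc]; exact hx _ (hy z hz)
  rw [eq_top_iff]
  rintro x -
  have h1 := incl_mul_t_pow_mem (d := d) (n := n) (q := q) 1 0
  rw [map_one, pow_zero, one_mul] at h1
  have h2 := hmul x 1 h1
  rwa [mul_one] at h2

/-- By induction on the number of strands: between two copies of the last generator, an element
reduced for one strand less contains a power of a framing generator, or the previous braiding
generator, to which the braid relation applies. -/
theorem reducedY_eq_top (d : ℕ) [NeZero d] (n : ℕ) (q : ℂ) : reducedY d n q = ⊤ := by
  induction n with
  | zero => exact reducedY_eq_top_of fun i _ => absurd i.isLt (by omega)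
  | succ n ih =>
    refine reducedY_eq_top_of fun i hi a => ?_
    have hin : i.val = n := by omega
    have ha : a ∈ reducedY d n q := ih ▸ Submodule.mem_top
    induction ha using reducedY_induction with
    | framing u k =>
      have hl : incl d (n + 1) q (t d (n + 1) q (Fin.last n)) = t d (n + 1 + 1) q (leftPos i) := by
        rw [incl_t]; congr 1; exact Fin.ext hin.symm
      rw [map_mul, map_pow, hl, ← mul_assoc, g_last_mul_incl_incl i hin, mul_assoc, mul_assoc,
        ← mul_assoc (g d (n + 1 + 1) q i)]
      exact incl_mul_mem_reducedY _ (g_mul_t_pow_mul_g_mem i hi k)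
    | braiding u v j hj =>
      have hb := g_braid (d := d) (q := q) (n := n + 1 + 1) ⟨j.val, by omega⟩ i
        (by simp only; omega)
      rw [← incl_g] at hb
      have h1 : g d (n + 1 + 1) q i *
          incl d (n + 1) q (incl d n q u * g d (n + 1) q j * incl d n q v) * g d (n + 1 + 1) q i
          = incl d (n + 1) q (incl d n q u * g d (n + 1) q j) * g d (n + 1 + 1) q i *
            incl d (n + 1) q (g d (n + 1) q j * incl d n q v) := by
        simp only [map_mul]
        calc _ = (g d (n + 1 + 1) q i * incl d (n + 1) q (incl d n q u)) *
              incl d (n + 1) q (g d (n + 1) q j) *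
              (incl d (n + 1) q (incl d n q v) * g d (n + 1 + 1) q i) := by simp only [mul_assoc]
          _ = incl d (n + 1) q (incl d n q u) * (g d (n + 1 + 1) q i *
              incl d (n + 1) q (g d (n + 1) q j) * g d (n + 1 + 1) q i) *
              incl d (n + 1) q (incl d n q v) := by
            rw [g_last_mul_incl_incl i hin, ← g_last_mul_incl_incl i hin v]; simp only [mul_assoc]
          _ = _ := by rw [← hb]; simp only [mul_assoc]
      rw [h1]
      exact incl_mul_g_mul_incl_mem _ _ i hi
    | add x y _ _ hx hy => rw [map_add, mul_add, add_mul]; exact add_mem hx hy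
    | smul r x _ hx =>
      rw [map_smul, mul_smul_comm, smul_mul_assoc]; exact Submodule.smul_mem _ r hx

theorem IsSpecializedTrace.unique {D : Finset (ZMod d)}
    {tr tr' : (n : ℕ) → Y d n q →ₗ[ℂ] ℂ[X]} (h : IsSpecializedTrace d D q tr)
    (h' : IsSpecializedTrace d D q tr') : tr = tr' := by
  funext n
  induction n with
  | zero =>
    refine LinearMap.ext fun a => ?_
    have ha : ∃ r : ℂ, a = algebraMap ℂ _ r := by
      induction a using Y_induction with
      | g i => exact absurd i.isLt (by omega)
      | t j => exact absurd j.isLt (by omega)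
      | scalar r => exact ⟨r, rfl⟩
      | add x y hx hy =>
        obtain ⟨r, rfl⟩ := hx
        obtain ⟨s, rfl⟩ := hy
        exact ⟨r + s, by rw [map_add]⟩
      | mul x y hx hy =>
        obtain ⟨r, rfl⟩ := hx
        obtain ⟨s, rfl⟩ := hy
        exact ⟨r * s, by rw [map_mul]⟩
    obtain ⟨r, rfl⟩ := ha
    rw [Algebra.algebraMap_eq_smul_one, map_smul, map_smul, h.one, h'.one]
  | succ n ih =>
    refine LinearMap.ext fun a => ?_
    have ha : a ∈ reducedY d n q := reducedY_eq_top d n q ▸ Submodule.mem_top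
    induction ha using reducedY_induction with
    | framing a k =>
      have hk : t d (n + 1) q (Fin.last n) ^ k = t d (n + 1) q (Fin.last n) ^ (k % d) :=
        pow_eq_pow_mod k (t_pow _)
      have hlt : k % d < d := Nat.mod_lt _ (NeZero.pos d)
      rw [hk]
      rcases Nat.eq_zero_or_pos (k % d) with h0 | h0
      · rw [h0, pow_zero, mul_one, h.compat, h'.compat, ih]
      · rw [h.framing n a _ h0 (by omega), h'.framing n a _ h0 (by omega), ih]
    | braiding a b i hi =>
      obtain ⟨m, rfl⟩ : ∃ m, n = m + 1 := ⟨n - 1, by omega⟩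
      obtain rfl : i = Fin.last m := Fin.ext (by simp only [Fin.val_last]; omega)
      rw [h.trace, h'.trace, ← mul_assoc, ← map_mul, h.markov, h'.markov, ih]
    | add x y _ _ hx hy => rw [map_add, map_add, hx, hy]
    | smul r x _ hx => rw [map_smul, map_smul, hx]

theorem specializedTrace_eq_stateSum {D : Finset (ZMod d)} (hD : D.Nonempty) (q : ℂ) :
    specializedTrace d D q = stateSum D q :=
  (Classical.epsilon_spec (p := IsSpecializedTrace d D q)
    ⟨_, isSpecializedTrace_stateSum hD q⟩).unique (isSpecializedTrace_stateSum hD q)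

end Uniqueness

/-! ### Strands of a closed braid -/

section Topology

variable {n : ℕ} {C : Type*}

/-- The permutation of the positions underlying an elementary braid. -/
def letterPerm (c : Option (Fin (n - 1) × Bool)) : Equiv.Perm (Fin n) :=
  match c with
  | none => 1
  | some (i, _) => strandSwap i

theorem letterPerm_letterPerm (c : Option (Fin (n - 1) × Bool)) (p : Fin n) :
    letterPerm c (letterPerm c p) = p := by
  rcases c with _ | ⟨i, b⟩
  · rfl
  · exact Equiv.swap_apply_self _ _ _

theorem leftPos_ne_rightPos (i : Fin (n - 1)) : leftPos i ≠ rightPos i := by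
  simp [leftPos, rightPos, Fin.ext_iff]

theorem strand_left (i : Fin (n - 1)) (b : Bool) (s : ℝ) : strand (some (i, b)) (leftPos i) s =
    (i.val + 1 / 2 - Real.cos (Real.pi * s) / 2,
      (if b then 1 else -1) * Real.sin (Real.pi * s) / 2) := by
  simp [strand]

theorem strand_right (i : Fin (n - 1)) (b : Bool) (s : ℝ) : strand (some (i, b)) (rightPos i) s =
    (i.val + 1 / 2 + Real.cos (Real.pi * s) / 2,
      -((if b then 1 else -1) * Real.sin (Real.pi * s) / 2)) := by
  simp [strand, (leftPos_ne_rightPos i).symm]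

theorem strand_other {i : Fin (n - 1)} (b : Bool) {p : Fin n} (hl : p ≠ leftPos i)
    (hr : p ≠ rightPos i) (s : ℝ) : strand (some (i, b)) p s = ((p.val : ℝ), 0) := by
  simp [strand, hl, hr]

theorem strand_zero (c : Option (Fin (n - 1) × Bool)) (p : Fin n) :
    strand c p 0 = ((p.val : ℝ), 0) := by
  rcases c with _ | ⟨i, b⟩
  · rfl
  · rcases eq_or_ne p (leftPos i) with rfl | hl
    · rw [strand_left]; simp [leftPos]
    rcases eq_or_ne p (rightPos i) with rfl | hr
    · rw [strand_right]; simp [rightPos]; ring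
    exact strand_other b hl hr 0

theorem strand_one (c : Option (Fin (n - 1) × Bool)) (p : Fin n) :
    strand c p 1 = (((letterPerm c p).val : ℝ), 0) := by
  rcases c with _ | ⟨i, b⟩
  · rfl
  · simp only [letterPerm, strandSwap]
    rcases eq_or_ne p (leftPos i) with rfl | hl
    · rw [strand_left]; simp [rightPos]; ring
    rcases eq_or_ne p (rightPos i) with rfl | hr
    · rw [strand_right]; simp [leftPos]; ring
    rw [strand_other b hl hr, Equiv.swap_apply_of_ne_of_ne hl hr]

theorem strand_fst_nonneg (c : Option (Fin (n - 1) × Bool)) (p : Fin n) (s : ℝ) :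
    0 ≤ (strand c p s).1 := by
  rcases c with _ | ⟨i, b⟩
  · exact Nat.cast_nonneg (α := ℝ) p.val
  · have h1 := Real.cos_le_one (Real.pi * s)
    have h2 := Real.neg_one_le_cos (Real.pi * s)
    have h3 : (0 : ℝ) ≤ i.val := Nat.cast_nonneg _
    rcases eq_or_ne p (leftPos i) with rfl | hl
    · rw [strand_left]; simp only; linarith
    rcases eq_or_ne p (rightPos i) with rfl | hr
    · rw [strand_right]; simp only; linarith
    rw [strand_other b hl hr]
    exact Nat.cast_nonneg (α := ℝ) p.val

/-- Distinct strands of an elementary braid do not meet. -/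
theorem strand_injective (c : Option (Fin (n - 1) × Bool)) (s : ℝ) :
    Function.Injective fun p => strand c p s := by
  rcases c with _ | ⟨i, b⟩
  · intro p p' h
    simpa [strand, Fin.ext_iff] using h
  · have hcs := Real.cos_sq_add_sin_sq (Real.pi * s)
    have hsgn : ((if b then 1 else -1 : ℝ)) ≠ 0 := by split_ifs <;> norm_num
    have hl {p : Fin n} (h : p ≠ leftPos i) : (p.val : ℝ) ≠ i.val := by
      exact_mod_cast fun h' => h (Fin.ext h')
    have hr {p : Fin n} (h : p ≠ rightPos i) : (p.val : ℝ) ≠ i.val + 1 := by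
      exact_mod_cast fun h' => h (Fin.ext h')
    -- at height zero, a crossing strand is at one of its end positions
    have hend (hs : Real.sin (Real.pi * s) = 0) :
        Real.cos (Real.pi * s) = 1 ∨ Real.cos (Real.pi * s) = -1 := by
      rw [hs] at hcs
      exact sq_eq_one_iff.mp (by linarith)
    have hlo {p : Fin n} (h1 : p ≠ leftPos i) (h2 : p ≠ rightPos i) :
        strand (some (i, b)) (leftPos i) s ≠ strand (some (i, b)) p s := by
      rw [strand_left, strand_other b h1 h2]
      intro h
      obtain ⟨e1, e2⟩ := Prod.ext_iff.mp h
      simp only [div_eq_zero_iff, mul_eq_zero, hsgn, false_or, OfNat.ofNat_ne_zero, or_false]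
        at e1 e2
      rcases hend e2 with h3 | h3
      · exact hl h1 (by linarith)
      · exact hr h2 (by linarith)
    have hro {p : Fin n} (h1 : p ≠ leftPos i) (h2 : p ≠ rightPos i) :
        strand (some (i, b)) (rightPos i) s ≠ strand (some (i, b)) p s := by
      rw [strand_right, strand_other b h1 h2]
      intro h
      obtain ⟨e1, e2⟩ := Prod.ext_iff.mp h
      simp only [neg_eq_zero, div_eq_zero_iff, mul_eq_zero, hsgn, false_or, OfNat.ofNat_ne_zero,
        or_false] at e1 e2
      rcases hend e2 with h3 | h3
      · exact hr h2 (by linarith)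
      · exact hl h1 (by linarith)
    have hlr : strand (some (i, b)) (leftPos i) s ≠ strand (some (i, b)) (rightPos i) s := by
      rw [strand_left, strand_right]
      intro h
      obtain ⟨e1, e2⟩ := Prod.ext_iff.mp h
      simp only at e1 e2
      have e3 : (if b then 1 else -1 : ℝ) * Real.sin (Real.pi * s) = 0 := by linarith
      have e4 := (mul_eq_zero.mp e3).resolve_left hsgn
      have e5 : Real.cos (Real.pi * s) = 0 := by linarith
      rw [e4, e5] at hcs
      norm_num at hcs
    intro p p' h
    simp only at h
    rcases eq_or_ne p (leftPos i) with rfl | h1 <;> rcases eq_or_ne p' (leftPos i) with rfl | h1'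
    · rfl
    · rcases eq_or_ne p' (rightPos i) with rfl | h2'
      · exact absurd h hlr
      · exact absurd h (hlo h1' h2')
    · rcases eq_or_ne p (rightPos i) with rfl | h2
      · exact absurd h.symm hlr
      · exact absurd h.symm (hlo h1 h2)
    · rcases eq_or_ne p (rightPos i) with rfl | h2 <;>
        rcases eq_or_ne p' (rightPos i) with rfl | h2'
      · rfl
      · exact absurd h (hro h1' h2')
      · exact absurd h.symm (hro h1 h2)
      · rw [strand_other b h1 h2, strand_other b h1' h2'] at h
        simpa [Fin.ext_iff] using h

/-- The color of each position before the `k`-th letter of the word, when the colors `χ` are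
transported along the strands. -/
def colorAt (w : List (Fin (n - 1) × Bool)) (χ : Fin n → C) : ℕ → Fin n → C
  | 0 => χ
  | k + 1 => colorAt w χ k ∘ letterPerm w[k]?

theorem colorAt_succ_letterPerm (w : List (Fin (n - 1) × Bool)) (χ : Fin n → C) (k : ℕ)
    (p : Fin n) : colorAt w χ (k + 1) (letterPerm w[k]? p) = colorAt w χ k p := by
  rw [colorAt, Function.comp_apply, letterPerm_letterPerm]

/-- The point at time `s` on the strand at position `p` in the `k`-th sector of a closed braid with
`L` sectors, where the elementary braid of that sector is `c`. -/
noncomputable def closedPoint (L : ℕ) (c : Option (Fin (n - 1) × Bool)) (k : ℕ) (p : Fin n)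
    (s : ℝ) : EuclideanSpace ℝ (Fin 3) :=
  !₂[(1 + (strand c p s).1) * Real.cos (2 * Real.pi * ((k + s) / L)),
    (1 + (strand c p s).1) * Real.sin (2 * Real.pi * ((k + s) / L)), (strand c p s).2]

theorem continuous_strand (c : Option (Fin (n - 1) × Bool)) (p : Fin n) :
    Continuous (strand c p) := by
  unfold strand
  rcases c with _ | ⟨i, b⟩
  · exact continuous_const
  · simp only
    split_ifs <;> fun_prop

theorem continuous_closedPoint (L : ℕ) (c : Option (Fin (n - 1) × Bool)) (k : ℕ) (p : Fin n) :
    Continuous (closedPoint L c k p) := by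
  have h := continuous_strand c p
  refine (PiLp.continuous_toLp 2 _).comp (continuous_pi fun j => ?_)
  fin_cases j <;> simp <;> fun_prop

theorem closedPoint_eq {L : ℕ} (hL : 0 < L) {c c' : Option (Fin (n - 1) × Bool)} {k k' : ℕ}
    {p p' : Fin n} {s s' : ℝ} (h : closedPoint L c k p s = closedPoint L c' k' p' s') :
    strand c p s = strand c' p' s' ∧ ∃ m : ℤ, (k + s) - (k' + s') = m * L := by
  have h0 := congrFun (congrArg WithLp.ofLp h) 0
  have h1 := congrFun (congrArg WithLp.ofLp h) 1
  have h2 := congrFun (congrArg WithLp.ofLp h) 2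
  simp only [closedPoint, Matrix.cons_val_zero, Matrix.cons_val_one, Matrix.cons_val] at h0 h1 h2
  have hx := strand_fst_nonneg c p s
  have hx' := strand_fst_nonneg c' p' s'
  set θ := 2 * Real.pi * ((k + s) / L) with hθ
  set θ' := 2 * Real.pi * ((k' + s') / L) with hθ'
  have hr : 1 + (strand c p s).1 = 1 + (strand c' p' s').1 := by
    have e1 := Real.cos_sq_add_sin_sq θ
    have e2 := Real.cos_sq_add_sin_sq θ'
    refine (sq_eq_sq₀ (by linarith) (by linarith)).mp ?_
    calc (1 + (strand c p s).1) ^ 2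
        = ((1 + (strand c p s).1) * Real.cos θ) ^ 2 +
            ((1 + (strand c p s).1) * Real.sin θ) ^ 2 := by
          rw [mul_pow, mul_pow, ← mul_add, e1, mul_one]
      _ = _ := by rw [h0, h1, mul_pow, mul_pow, ← mul_add, e2, mul_one]
  have hne : 1 + (strand c' p' s').1 ≠ 0 := by linarith
  rw [hr] at h0 h1
  have hcos := mul_left_cancel₀ hne h0
  have hsin := mul_left_cancel₀ hne h1
  refine ⟨Prod.ext (by linarith) h2, ?_⟩
  have hang := Real.Angle.cos_sin_inj hcos hsin
  obtain ⟨m, hm⟩ := Real.Angle.angle_eq_iff_two_pi_dvd_sub.mp hang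
  refine ⟨m, ?_⟩
  have hL' : (L : ℝ) ≠ 0 := by exact_mod_cast hL.ne'
  have hpi := Real.pi_ne_zero
  rw [hθ, hθ'] at hm
  field_simp at hm
  linarith

/-- Colors that are transported along the strands and match up at the ends of the braid are
well-defined on the points of the closed braid. -/
theorem colorAt_eq_of_closedPoint_eq {w : List (Fin (n - 1) × Bool)} {χ : Fin n → C}
    (hχ : colorAt w χ w.length = χ) {k k' : ℕ} (hk : k < w.length + 1) (hk' : k' < w.length + 1)
    {p p' : Fin n} {s s' : ℝ} (hs : s ∈ Set.Icc (0 : ℝ) 1) (hs' : s' ∈ Set.Icc (0 : ℝ) 1)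
    (h : closedPoint (w.length + 1) w[k]? k p s = closedPoint (w.length + 1) w[k']? k' p' s') :
    colorAt w χ k p = colorAt w χ k' p' := by
  -- by symmetry, the first point may be assumed to come first along the braid
  wlog hle : k ≤ k' ∧ k + s ≤ k' + s' generalizing k k' p p' s s'
  · refine (this hk' hk hs' hs h.symm ?_).symm
    rcases lt_trichotomy k k' with hkk | rfl | hkk
    · have : (k : ℝ) + 1 ≤ k' := by exact_mod_cast hkk
      exact absurd ⟨hkk.le, by linarith [hs.2, hs'.1]⟩ hle
    · refine ⟨le_rfl, ?_⟩
      rcases le_total s s' with hss | hss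
      · exact absurd ⟨le_rfl, by linarith⟩ hle
      · linarith
    · have : (k' : ℝ) + 1 ≤ k := by exact_mod_cast hkk
      exact ⟨hkk.le, by linarith [hs'.2, hs.1]⟩
  obtain ⟨hkk, hle⟩ := hle
  obtain ⟨hst, m, hm⟩ := closedPoint_eq w.length.succ_pos h
  have hk0 : (0 : ℝ) ≤ k := Nat.cast_nonneg _
  have hkw : (k' : ℝ) ≤ w.length := by exact_mod_cast Nat.lt_succ_iff.mp hk'
  have hL : (0 : ℝ) < (w.length + 1 : ℕ) := by positivity
  push_cast at hm hL
  -- both times are in the interval from `0` to the number of sectors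
  have hm0 : m ≤ 0 := by
    by_contra! hc
    have hc' : (1 : ℝ) ≤ m := by exact_mod_cast hc
    nlinarith
  have hm1 : -1 ≤ m := by
    by_contra! hc
    have hc' : (m : ℝ) ≤ -2 := by exact_mod_cast (by omega : m ≤ -2)
    nlinarith [hs.1, hs'.2]
  obtain rfl | rfl : m = 0 ∨ m = -1 := by omega
  · rw [Int.cast_zero, zero_mul, sub_eq_zero] at hm
    rcases hkk.eq_or_lt with rfl | hlt
    · obtain rfl : s = s' := by linarith
      exact congrArg _ (strand_injective _ _ hst)
    · have h1 : (k : ℝ) + 1 ≤ k' := by exact_mod_cast hlt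
      obtain rfl : s = 1 := by linarith [hs.2, hs'.1]
      obtain rfl : s' = 0 := by linarith [hs'.1]
      obtain rfl : k' = k + 1 := by exact_mod_cast (by linarith : (k' : ℝ) = k + 1)
      rw [strand_one, strand_zero] at hst
      have hp : letterPerm w[k]? p = p' :=
        Fin.ext (Nat.cast_injective (R := ℝ) (Prod.ext_iff.mp hst).1)
      rw [← hp, colorAt_succ_letterPerm]
  · push_cast at hm
    obtain rfl : s = 0 := by linarith [hs.1, hs'.2]
    obtain rfl : s' = 1 := by linarith [hs'.2]
    obtain rfl : k = 0 := by exact_mod_cast (by linarith : (k : ℝ) = 0)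
    obtain rfl : k' = w.length := by
      exact_mod_cast (by push_cast at hm; linarith : (k' : ℝ) = w.length)
    rw [strand_one, strand_zero, List.getElem?_eq_none le_rfl] at hst
    have hp : p = p' := Fin.ext (Nat.cast_injective (R := ℝ) (Prod.ext_iff.mp hst).1)
    rw [hχ, hp]; rfl

theorem mem_closedBraid {w : List (Fin (n - 1) × Bool)} {x : EuclideanSpace ℝ (Fin 3)} :
    x ∈ closedBraid w ↔ ∃ k < w.length + 1, ∃ s ∈ Set.Icc (0 : ℝ) 1, ∃ p : Fin n,
      x = closedPoint (w.length + 1) w[k]? k p s := by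
  simp only [closedBraid, closedPoint, Set.mem_ofPred_eq, Nat.cast_add, Nat.cast_one]

/-- A coloring of the strands that is compatible with the closure of a braid is constant if the
closed braid is connected. -/
theorem coloring_const_of_isConnected {w : List (Fin (n - 1) × Bool)}
    (hw : IsConnected (closedBraid w)) {χ : Fin n → C} (hχ : colorAt w χ w.length = χ)
    (p₀ p : Fin n) : χ p = χ p₀ := by
  classical
  by_contra hne
  -- the points on strands whose color satisfies a condition form a closed set
  let K (S : Set C) : Set (EuclideanSpace ℝ (Fin 3)) :=
    ⋃ k : Fin (w.length + 1), ⋃ p : {p : Fin n // colorAt w χ k p ∈ S},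
      closedPoint (w.length + 1) w[k.val]? k p '' Set.Icc 0 1
  have hK (S : Set C) : IsClosed (K S) :=
    isClosed_iUnion_of_finite fun k => isClosed_iUnion_of_finite fun p =>
      (isCompact_Icc.image (continuous_closedPoint _ _ _ _)).isClosed
  have hmem {S : Set C} {x} : x ∈ K S ↔ ∃ k < w.length + 1, ∃ s ∈ Set.Icc (0 : ℝ) 1, ∃ p : Fin n,
      colorAt w χ k p ∈ S ∧ x = closedPoint (w.length + 1) w[k]? k p s := by
    simp only [K, Set.mem_iUnion, Set.mem_image]
    constructor
    · rintro ⟨k, p, s, hs, rfl⟩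
      exact ⟨k, k.2, s, hs, p, p.2, rfl⟩
    · rintro ⟨k, hk, s, hs, p, hp, rfl⟩
      exact ⟨⟨k, hk⟩, ⟨p, hp⟩, s, hs, rfl⟩
  have hsub (S : Set C) : closedBraid w ⊆ K S ∪ K Sᶜ := by
    intro x hx
    obtain ⟨k, hk, s, hs, p, rfl⟩ := mem_closedBraid.mp hx
    by_cases hp : colorAt w χ k p ∈ S
    · exact Or.inl (hmem.mpr ⟨k, hk, s, hs, p, hp, rfl⟩)
    · exact Or.inr (hmem.mpr ⟨k, hk, s, hs, p, hp, rfl⟩)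
  have hstart (S : Set C) (p : Fin n) (hp : χ p ∈ S) : (closedBraid w ∩ K S).Nonempty := by
    have h0 : (0 : ℝ) ∈ Set.Icc (0 : ℝ) 1 := by simp
    exact ⟨_, mem_closedBraid.mpr ⟨0, by omega, 0, h0, p, rfl⟩,
      hmem.mpr ⟨0, by omega, 0, h0, p, hp, rfl⟩⟩
  obtain ⟨x, -, hx, hx'⟩ := isPreconnected_closed_iff.mp hw.isPreconnected _ _ (hK {χ p₀})
    (hK {χ p₀}ᶜ) (hsub _) (hstart _ p₀ rfl) (hstart _ p hne)
  obtain ⟨k, hk, s, hs, p, hp, rfl⟩ := hmem.mp hx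
  obtain ⟨k', hk', s', hs', p', hp', h⟩ := hmem.mp hx'
  exact hp' (colorAt_eq_of_closedPoint_eq hχ hk hk' hs hs' h ▸ hp)

end Topology

/-! ### The trace of a braid whose closure is a knot -/

/-- The image of a generator of the Hecke algebra is invertible, by the quadratic relation. -/
noncomputable def Hecke.genUnit {R : Type*} [CommRing R] (h : R) {n i : ℕ} (hi : i < n) :
    (Hecke h n)ˣ where
  val := Hecke.gen h n i
  inv := Hecke.gen h n i - h • 1
  val_inv := by
    rw [mul_sub, (Hecke.isHeckeFamily_gen h n).quad i hi, mul_smul_comm, mul_one,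
      add_sub_cancel_right]
  inv_val := by
    rw [sub_mul, (Hecke.isHeckeFamily_gen h n).quad i hi, smul_mul_assoc, one_mul,
      add_sub_cancel_right]

/-- The homomorphism from the braid group on `n` strands to the units of a Hecke algebra. -/
noncomputable def braidToHecke {R : Type} [CommRing R] (h : R) (n : ℕ) :
    BraidGroup n →* (Hecke h n)ˣ :=
  GroupOfRelations.lift (fun i : Fin (n - 1) => Hecke.genUnit h (show i.val < n by omega)) (by
    have H := Hecke.isHeckeFamily_gen h n
    have hb (i j : Fin (n - 1)) (hij : i.val + 1 = j.val) :
        Hecke.gen h n i * Hecke.gen h n j * Hecke.gen h n i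
          = Hecke.gen h n j * Hecke.gen h n i * Hecke.gen h n j := by
      rw [← hij]; exact H.braid i (by omega)
    rintro _ _ (⟨i, j, hij⟩ | ⟨i, j, hij⟩) <;> ext1 <;>
      simp only [map_mul, FreeGroup.lift_apply_of, Units.val_mul]
    · rcases hij with hij | hij
      · exact hb i j hij
      · exact (hb j i hij).symm
    · rcases hij with hij | hij
      · exact H.comm i j hij (by omega)
      · exact (H.comm j i hij (by omega)).symm)

/-- The permutation of the positions underlying a braid word. -/
def wordPerm {n : ℕ} (w : List (Fin (n - 1) × Bool)) : Equiv.Perm (Fin n) :=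
  (w.map fun l => strandSwap l.1).prod

theorem colorAt_cons {n : ℕ} {C : Type*} (l : Fin (n - 1) × Bool) (w : List (Fin (n - 1) × Bool))
    (χ : Fin n → C) (k : ℕ) :
    colorAt (l :: w) χ (k + 1) = colorAt w (χ ∘ strandSwap l.1) k := by
  induction k with
  | zero => rfl
  | succ k ih => rw [colorAt, ih, colorAt, List.getElem?_cons_succ]

theorem colorAt_length {n : ℕ} {C : Type*} (w : List (Fin (n - 1) × Bool)) (χ : Fin n → C) :
    colorAt w χ w.length = χ ∘ wordPerm w := by
  induction w generalizing χ with
  | nil => rfl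
  | cons l w ih =>
    rw [List.length_cons, colorAt_cons, ih, wordPerm, wordPerm, List.map_cons, List.prod_cons]
    rfl

theorem colorCount_const {C : Type} [DecidableEq C] {n : ℕ} (c : C) {m : ℕ} (hm : m ≤ n) :
    colorCount (fun _ : Fin n => c) m c = m := by
  rw [colorCount]
  simp [Fin.card_filter_val_lt, hm]

theorem braidToFramed_sigma {d n : ℕ} (i : Fin (n - 1)) :
    braidToFramed d n (PresentedGroup.of i) = sigma d n i :=
  GroupOfRelations.lift_of _ _ _

section Knot

variable {C : Type} [Fintype C] [DecidableEq C] {d n : ℕ} [NeZero d] {h : ℂ}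

/-- The matrix of a braid is monomial, and at a constant coloring its coefficient is the image of
the braid in the Hecke algebra of that color. -/
theorem framedRep_braid (col : C → ZMod d) (w : List (Fin (n - 1) × Bool)) :
    ∃ a : (Fin n → C) → ColAlg C h n,
      (framedRep (ColAlg.isColoredFamily_gen (C := C) (h := h)) le_rfl col
        (braidToFramed d n (PresentedGroup.mk _ (FreeGroup.mk w)))).val = mono (wordPerm w) a ∧
      ∀ c, a (fun _ => c) = ColAlg.single c
        (braidToHecke (Polynomial.C h) n (PresentedGroup.mk _ (FreeGroup.mk w))).val := by
  induction w with
  | nil =>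
    refine ⟨fun _ => 1, ?_, fun c => ?_⟩
    · rw [← FreeGroup.one_eq_mk, map_one, map_one, map_one, Units.val_one, ← mono_one]; rfl
    · rw [← FreeGroup.one_eq_mk, map_one, map_one, Units.val_one, map_one]
  | cons l w ih =>
    obtain ⟨a, ha, hac⟩ := ih
    obtain ⟨i, b⟩ := l
    have hgen : ∃ a : (Fin n → C) → ColAlg C h n,
        (framedRep (ColAlg.isColoredFamily_gen (C := C) (h := h)) le_rfl col
          (braidToFramed d n (PresentedGroup.mk _ (FreeGroup.mk [(i, b)])))).val
            = mono (strandSwap i) a ∧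
        ∀ c, a (fun _ => c) = ColAlg.single c
          (braidToHecke (Polynomial.C h) n (PresentedGroup.mk _ (FreeGroup.mk [(i, b)]))).val := by
      have hcount (c : C) : colorCount (fun _ : Fin n => c) i.val c = i.val :=
        colorCount_const c (by omega)
      cases b with
      | true =>
        refine ⟨weight (ColAlg.gen h n) i, ?_, fun c => ?_⟩
        · exact (congrArg (fun x => (framedRep _ _ col x).val) (braidToFramed_sigma i)).trans
            (framedRep_sigma _ _ col i)
        · have hof : (PresentedGroup.mk _ (FreeGroup.mk [(i, true)]) : BraidGroup n)
              = PresentedGroup.of i := rfl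
          rw [hof, braidToHecke, GroupOfRelations.lift_of, weight, if_pos rfl, hcount]
          rfl
      | false =>
        have hinv : (PresentedGroup.mk _ (FreeGroup.mk [(i, false)]) : BraidGroup n)
            = (PresentedGroup.of i)⁻¹ := rfl
        refine ⟨weightInv h (ColAlg.gen h n) i, ?_, fun c => ?_⟩
        · rw [hinv, map_inv, map_inv, braidToFramed_sigma, framedRep, sigma,
            GroupOfRelations.lift_of]
          rfl
        · rw [hinv, map_inv, braidToHecke, GroupOfRelations.lift_of, weightInv, if_pos rfl, hcount]
          change _ = ColAlg.single c (Hecke.gen _ n i - Polynomial.C h • 1)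
          rw [map_sub, map_smul, map_one]
          rfl
    obtain ⟨a', ha', hac'⟩ := hgen
    have hmk : (PresentedGroup.mk _ (FreeGroup.mk ((i, b) :: w)) : BraidGroup n)
        = PresentedGroup.mk _ (FreeGroup.mk [(i, b)]) * PresentedGroup.mk _ (FreeGroup.mk w) := by
      rw [← map_mul, FreeGroup.mul_mk]; rfl
    refine ⟨fun χ => a' χ * a (χ ∘ strandSwap i), ?_, fun c => ?_⟩
    · rw [hmk, map_mul, map_mul, Units.val_mul, ha', ha, mono_mul, wordPerm, wordPerm,
        List.map_cons, List.prod_cons]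
    · rw [hmk, map_mul, Units.val_mul, map_mul, ← hac', ← hac]
      rfl

/-- The trace of a braid that closes to a knot: only the constant colorings contribute, and each
contributes the Ocneanu trace of the braid. -/
theorem stateSum_delta {α : BraidGroup n} (hα : ClosureIsKnot α) (D : Finset (ZMod d)) (q : ℂ) :
    stateSum D q n (delta d q α) = (E D ^ n * D.card) •
      Polynomial.aeval (Polynomial.C (D.card : ℂ) * Polynomial.X)
        (Hecke.ocneanu (Polynomial.C (q - q⁻¹)) Polynomial.X n
          (braidToHecke (Polynomial.C (q - q⁻¹)) n α).val) := by
  obtain ⟨w, rfl, hw⟩ := hα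
  obtain ⟨p₀⟩ : Nonempty (Fin n) := by
    obtain ⟨x, k, hk, s, hs, p, hx⟩ := hw.nonempty
    exact ⟨p⟩
  obtain ⟨a, ha, hac⟩ := framedRep_braid (C := {m // m ∈ D}) (h := q - q⁻¹) Subtype.val w
  rw [stateSum, colTrace_apply, delta, colRep_proj_of, ha]
  have hconst (c : {m // m ∈ D}) : (fun _ => c : Fin n → {m // m ∈ D}) ∘ wordPerm w
      = fun _ => c := rfl
  rw [← Fintype.sum_of_injective (fun (c : {m // m ∈ D}) (_ : Fin n) => c)
    (fun c c' hcc' => congrFun hcc' p₀)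
    (fun _ => Polynomial.aeval (Polynomial.C (D.card : ℂ) * Polynomial.X)
        (Hecke.ocneanu (Polynomial.C (q - q⁻¹)) Polynomial.X n
          (braidToHecke (Polynomial.C (q - q⁻¹)) n
            (PresentedGroup.mk _ (FreeGroup.mk w))).val)) _ ?_ ?_]
  · rw [Finset.sum_const, Finset.card_univ, Fintype.card_coe, ← Nat.cast_smul_eq_nsmul ℂ,
      smul_smul]
  · intro χ hχ
    rw [mono_apply, if_neg, map_zero]
    intro h
    have hcol : colorAt w χ w.length = χ := by rw [colorAt_length, ← h]
    exact hχ ⟨χ p₀, (funext fun p => coloring_const_of_isConnected hw hcol p₀ p).symm⟩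
  · intro c
    rw [mono_apply, if_pos (hconst c).symm, hac, ColAlg.evalTrace_apply, ColAlg.prodTrace_single]

end Knot

end YokonumaHecke

theorem mainTheorem4 (d : ℕ) [NeZero d] (D : Finset (ZMod d)) (hD : D.Nonempty)
    (q : ℂ) (hq : q ≠ 0) :
    (∃! tr : (n : ℕ) → YokonumaHecke.Y d n q →ₗ[ℂ] Polynomial ℂ,
      YokonumaHecke.IsSpecializedTrace d D q tr) ∧
    ∀ (n : ℕ) (α : YokonumaHecke.BraidGroup n), YokonumaHecke.ClosureIsKnot α →
      ∀ (A : Type*) [CommRing A] [Algebra ℂ A] (v : YokonumaHecke.Variables D q A),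
        YokonumaHecke.Theta d D q v α = YokonumaHecke.Theta 1 {0} q (v.divE hD) α ∧
        YokonumaHecke.Theta 1 {0} q (v.divE hD) α = YokonumaHecke.Homflypt q (v.divE hD) α := by
  refine ⟨⟨_, YokonumaHecke.isSpecializedTrace_stateSum hD q, fun tr htr =>
    htr.unique (YokonumaHecke.isSpecializedTrace_stateSum hD q)⟩, fun n α hα A _ _ v => ⟨?_, rfl⟩⟩
  have hcard : (D.card : ℂ) ≠ 0 := by exact_mod_cast hD.card_pos.ne'
  have hn : 0 < n := by
    obtain ⟨w, -, hw⟩ := hα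
    obtain ⟨x, k, hk, s, hs, p, hx⟩ := hw.nonempty
    exact p.pos
  obtain ⟨m, rfl⟩ : ∃ m, n = m + 1 := ⟨n - 1, by omega⟩
  rw [YokonumaHecke.Theta, YokonumaHecke.Theta, YokonumaHecke.specializedTrace_eq_stateSum hD,
    YokonumaHecke.specializedTrace_eq_stateSum (Finset.singleton_nonempty 0),
    YokonumaHecke.stateSum_delta hα, YokonumaHecke.stateSum_delta hα]
  set τ := YokonumaHecke.Hecke.ocneanu (Polynomial.C (q - q⁻¹)) Polynomial.X (m + 1)
    (YokonumaHecke.braidToHecke (Polynomial.C (q - q⁻¹)) (m + 1) α).val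
  set u : Aˣ := Units.map (algebraMap ℂ A).toMonoidHom (Units.mk0 (YokonumaHecke.E D)
    (inv_ne_zero hcard)) with hu
  have hz : (v.divE hD).z = v.z / u := rfl
  have hs : (v.divE hD).sqrtLambda = v.sqrtLambda := rfl
  -- both substitutions replace the variable by `z / E_D`
  have hval : ((v.z / u : Aˣ) : A) = algebraMap ℂ A D.card * (v.z : A) := by
    have h1 : ((u⁻¹ : Aˣ) : A) = algebraMap ℂ A D.card := by
      rw [hu, ← map_inv, Units.coe_map]
      simp [YokonumaHecke.E]
    rw [div_eq_mul_inv, Units.val_mul, h1, mul_comm]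
  have h1 : Polynomial.aeval (v.z : A)
      (Polynomial.aeval (Polynomial.C (D.card : ℂ) * Polynomial.X) τ)
      = Polynomial.aeval ((v.z / u : Aˣ) : A) τ := by
    rw [← Polynomial.aeval_algHom_apply, map_mul, Polynomial.aeval_C, Polynomial.aeval_X, hval]
  have h2 : Polynomial.aeval (Polynomial.C (((({0} : Finset (ZMod 1))).card : ℕ) : ℂ) *
      Polynomial.X) τ = τ := by
    rw [Finset.card_singleton, Nat.cast_one, map_one, one_mul]
    exact Polynomial.aeval_X_left_apply τ
  have h3 : (v.z / u * v.sqrtLambda)⁻¹ = (v.z * v.sqrtLambda)⁻¹ * u := by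
    rw [div_eq_mul_inv]
    rw [mul_inv, mul_inv, mul_inv, inv_inv, mul_right_comm]
  have h4 : ((m + 1 : ℕ) : ℤ) - 1 = (m : ℤ) := by push_cast; ring
  have h5 : ((u ^ m : Aˣ) : A) = algebraMap ℂ A (YokonumaHecke.E D ^ m) := by
    rw [Units.val_pow_eq_pow_val, map_pow]; rfl
  have h6 : YokonumaHecke.E D ^ (m + 1) * D.card = YokonumaHecke.E D ^ m := by
    rw [pow_succ, mul_assoc, YokonumaHecke.E, inv_mul_cancel₀ hcard, mul_one]
  have h7 : YokonumaHecke.E ({0} : Finset (ZMod 1)) = 1 := by simp [YokonumaHecke.E]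
  rw [h2, h7, one_pow, Finset.card_singleton, Nat.cast_one, one_mul, one_smul, h6, map_smul, h1,
    hz, hs, h3, h4, zpow_natCast, zpow_natCast, mul_pow, Units.val_mul, h5, Algebra.smul_def]
  ring
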